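/- Let $A$ be a finite dimensional algebra over a field $k$, and let $\operatorname{mod} A$ be the category of finite dimensional left $A$-modules. All subcategories of $\operatorname{mod} A$ are full and closed under isomorphisms, and modules are considered up to isomorphism. For a module $T$, let $\operatorname{Gen} T$ be the class of factor modules of finite direct sums $T^n$, let $\operatorname{add} T$ be the class of direct summands of the modules $T^n$, and let $T^{\perp}=\{Y\mid \operatorname{Hom}_A(T,Y)=0\}$. For a subcategory $\mathcal X$, let ${}^{\perp_1}\mathcal X=\{Y\mid \operatorname{Ext}^1_A(Y,X)=0 \text{ for all } X\in\mathcal X\}$. A module is basic if it is a direct sum of pairwise non-isomorphic indecomposable modules. Let $\tau=D\operatorname{Tr}$ be the Auslander–Reiten translation. A module $M$ is $\tau$-tilting if $\operatorname{Hom}_A(M,\tau M)=0$ and the number of isomorphism classes of indecomposable direct summands of $M$ equals the number of isomorphism classes of simple $A$-modules; it is support $\tau$-tilting if, for some idempotent $e\in A$, it is a $\tau$-tilting module over $A/AeA$. A module $T$ is tilting if it has projective dimension at most $1$, $\operatorname{Ext}^1_A(T,T)=0$, and there is an exact sequence $0\to A\to T_0\to T_1\to 0$ with $T_0,T_1\in\operatorname{add}T$.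 A pair $(\mathcal C,\mathcal T)$ of subcategories, both closed under direct summands, is a left weak cotorsion pair if $\operatorname{Ext}^1_A(C,T)=0$ for all $C\in\mathcal C$, $T\in\mathcal T$, and for every $M\in\operatorname{mod}A$ there are exact sequences $$0\to Y_M\to X_M\xrightarrow{f_M} M\to 0\qquad\text{and}\qquad M\xrightarrow{g^M} Y^M\to X^M\to 0$$ with $X_M,X^M\in\mathcal C$, $Y_M,Y^M\in\mathcal T$, $f_M$ a right $\mathcal C$-approximation and $g^M$ a left $\mathcal T$-approximation of $M$. It is a (complete) cotorsion pair if, moreover, $g^M$ can be chosen injective for every $M$. A pair $(\mathcal T,\mathcal F)$ is a torsion pair if $\mathcal T=\{X\mid \operatorname{Hom}_A(X,F)=0\ \text{for all } F\in\mathcal F\}$ and $\mathcal F=\{Y\mid \operatorname{Hom}_A(T,Y)=0\ \text{for all } T\in\mathcal T\}$. A triple $(\mathcal C,\mathcal T,\mathcal F)$ is an lw-cotorsion-torsion triple (respectively, a cotorsion-torsion triple) if $(\mathcal C,\mathcal T)$ is a left weak cotorsion pair (respectively, a cotorsion pair) and $(\mathcal T,\mathcal F)$ is a torsion pair. **Theorem.**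 The map $T\mapsto({}^{\perp_1}\operatorname{Gen}T,\ \operatorname{Gen}T,\ T^{\perp})$ is a bijection from isomorphism classes of basic support $\tau$-tilting $A$-modules to lw-cotorsion-torsion triples. Its inverse sends $(\mathcal C,\mathcal T,\mathcal F)$ to the basic module $T$ with $\operatorname{add}T=\mathcal C\cap\mathcal T$: a basic module $T$ satisfies $\operatorname{add}T=\mathcal C\cap\mathcal T$ if and only if $T$ is support $\tau$-tilting and is mapped to $(\mathcal C,\mathcal T,\mathcal F)$. Every basic tilting module is support $\tau$-tilting, and the map restricts to a bijection from isomorphism classes of basic tilting modules to cotorsion-torsion triples. -/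

import Mathlib

open CategoryTheory

universe v u

namespace WeakCotorsion

section ProjectiveCovers

variable {A : Type u} [Ring A]

/-- A submodule `N` of `M` is superfluous if `L + N = M` implies `L = M`. -/
def IsSuperfluous {M : Type*} [AddCommGroup M] [Module A M] (N : Submodule A M) : Prop :=
  ∀ L : Submodule A M, L ⊔ N = ⊤ → L = ⊤

/-- A projective cover: an epimorphism from a projective module with superfluous kernel. -/
structure IsProjectiveCover {P M : Type*} [AddCommGroup P] [Module A P] [AddCommGroup M]
    [Module A M] (f : P →ₗ[A] M) : Prop where
  projective : Module.Projective A P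
  surjective : Function.Surjective f
  superfluous : IsSuperfluous (LinearMap.ker f)

theorem exists_projectiveCover [IsArtinianRing A] (M : FGModuleCat.{u} A) :
    ∃ (P : FGModuleCat.{u} A) (f : P →ₗ[A] M), IsProjectiveCover f := by
  obtain ⟨n, F, hF⟩ := Module.Finite.exists_fin' A M
  let S : Set (Submodule A (Fin n → A)) :=
    {Q | Module.Projective A Q ∧ Function.Surjective (F.domRestrict Q)}
  have hS : S.Nonempty := by
    refine ⟨⊤, Module.Projective.of_equiv (Submodule.topEquiv (R := A)).symm, fun m => ?_⟩
    obtain ⟨x, hx⟩ := hF m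
    exact ⟨⟨x, trivial⟩, hx⟩
  obtain ⟨Q, ⟨hQp, hQs⟩, hmin⟩ := WellFounded.has_min (wellFounded_lt) S hS
  refine ⟨FGModuleCat.of A Q, F.domRestrict Q, hQp, hQs, fun N hN => ?_⟩
  set f : Q →ₗ[A] M := F.domRestrict Q with hf
  have hN' : Function.Surjective (f.domRestrict N) := by
    intro m
    obtain ⟨q, rfl⟩ := hQs m
    have hq : q ∈ N ⊔ LinearMap.ker f := by
      rw [hN]; trivial
    obtain ⟨y, hy, z, hz, rfl⟩ := Submodule.mem_sup.1 hq
    refine ⟨⟨y, hy⟩, ?_⟩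
    have hz' : f z = 0 := hz
    simp [hz']
  obtain ⟨g, hg⟩ := Module.projective_lifting_property (f.domRestrict N) f hN'
  let h : Module.End A Q := N.subtype ∘ₗ g
  have hfh : ∀ x, f (h x) = f x := fun x => LinearMap.congr_fun hg x
  have hpow : ∀ (i : ℕ) x, f ((h ^ i) x) = f x := by
    intro i
    induction i with
    | zero => intro x; simp
    | succ i ih => intro x; rw [pow_succ', Module.End.mul_apply, hfh, ih]
  obtain ⟨i, hi, hi1⟩ := ((h.eventually_isCompl_ker_pow_range_pow).and
    (Filter.eventually_ge_atTop 1)).exists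
  have hR : Module.Projective A (LinearMap.range (h ^ i)) :=
    Module.Projective.of_split (LinearMap.range (h ^ i)).subtype
      (Submodule.projectionOnto _ _ hi.symm)
      (LinearMap.ext fun x => Submodule.projectionOnto_apply_left hi.symm x)
  let R' : Submodule A (Fin n → A) := (LinearMap.range (h ^ i)).map Q.subtype
  have hR' : R' ∈ S := by
    refine ⟨Module.Projective.of_equiv
      (Submodule.equivMapOfInjective Q.subtype Q.injective_subtype _), fun m => ?_⟩
    obtain ⟨q, rfl⟩ := hQs m
    refine ⟨⟨((h ^ i) q : Q), Submodule.mem_map_of_mem ⟨q, rfl⟩⟩, ?_⟩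
    exact hpow i q
  have hle : R' ≤ Q := Submodule.map_subtype_le _ _
  have hEq : R' = Q := by
    by_contra hne
    exact hmin R' hR' (lt_of_le_of_ne hle hne)
  rw [eq_top_iff]
  intro x _
  have hx : (x : Fin n → A) ∈ R' := by
    rw [hEq]
    exact Subtype.property (p := fun y => y ∈ Q) x
  obtain ⟨y, ⟨z, rfl⟩, hy⟩ := hx
  have hxy : (h ^ i) z = x := Subtype.ext hy
  obtain ⟨j, hj⟩ : ∃ j, i = j + 1 := ⟨i - 1, by omega⟩
  have hmem : (h ^ i) z ∈ N := by
    rw [hj, pow_succ', Module.End.mul_apply]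
    exact (g _).2
  exact hxy ▸ hmem

/-- A minimal projective presentation `P₁ → P₀ → M → 0`: exact, with `P₀ → M` and
`P₁ → im (P₁ → P₀) = ker (P₀ → M)` projective covers. -/
structure MinimalPresentation (M : FGModuleCat.{u} A) where
  P₀ : FGModuleCat.{u} A
  P₁ : FGModuleCat.{u} A
  d : P₁ →ₗ[A] P₀
  π : P₀ →ₗ[A] M
  exact : Function.Exact d π
  cover₀ : IsProjectiveCover π
  cover₁ : IsProjectiveCover d.rangeRestrict

theorem nonempty_minimalPresentation [IsArtinianRing A] (M : FGModuleCat.{u} A) :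
    Nonempty (MinimalPresentation M) := by
  obtain ⟨P₀, π, hπ⟩ := exists_projectiveCover M
  obtain ⟨P₁, f, hf⟩ := exists_projectiveCover (FGModuleCat.of A (LinearMap.ker π))
  let d : P₁ →ₗ[A] P₀ := (LinearMap.ker π).subtype ∘ₗ f
  refine ⟨⟨P₀, P₁, d, π, ?_, hπ, hf.projective, d.surjective_rangeRestrict, ?_⟩⟩
  · intro x
    constructor
    · intro hx
      obtain ⟨y, hy⟩ := hf.surjective ⟨x, hx⟩
      exact ⟨y, congrArg Subtype.val hy⟩
    · rintro ⟨y, rfl⟩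
      exact (f y).2
  · have hk : LinearMap.ker d.rangeRestrict = LinearMap.ker f := by
      rw [LinearMap.ker_rangeRestrict]
      exact LinearMap.ker_comp_of_ker_eq_bot f (Submodule.ker_subtype _)
    rw [hk]
    exact hf.superfluous

end ProjectiveCovers

section AuslanderReitenTranslation

/-- The `k`-dual `D X = Hom_k(X, k)` of a right `A`-module `X`, a left `A`-module through
`(a • φ) x = φ (x • a)`. -/
def KDual (k : Type v) (A : Type u) (X : Type*) [Field k] [Ring A] [AddCommGroup X] [Module k X]
    [Module Aᵐᵒᵖ X] [SMulCommClass Aᵐᵒᵖ k X] := X →ₗ[k] k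

section KDual

variable (k : Type v) (A : Type u) (X : Type*) [Field k] [Ring A] [AddCommGroup X] [Module k X]
  [Module Aᵐᵒᵖ X] [SMulCommClass Aᵐᵒᵖ k X]

instance : AddCommGroup (KDual k A X) := inferInstanceAs (AddCommGroup (X →ₗ[k] k))

instance : FunLike (KDual k A X) X k := inferInstanceAs (FunLike (X →ₗ[k] k) X k)

instance : Module A (KDual k A X) where
  smul a φ := LinearMap.comp (φ : X →ₗ[k] k)
    (DistribSMul.toLinearMap k X (MulOpposite.op a))
  one_smul φ := LinearMap.ext fun x => congrArg (φ : X →ₗ[k] k) (one_smul Aᵐᵒᵖ x)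
  mul_smul a b φ := LinearMap.ext fun x => congrArg (φ : X →ₗ[k] k)
    (mul_smul (MulOpposite.op b) (MulOpposite.op a) x)
  smul_zero _ := rfl
  smul_add _ _ _ := rfl
  add_smul a b φ := LinearMap.ext fun x => by
    exact (congrArg (φ : X →ₗ[k] k) (add_smul (MulOpposite.op a) (MulOpposite.op b) x)).trans
      (LinearMap.map_add (φ : X →ₗ[k] k) _ _)
  zero_smul φ := LinearMap.ext fun x => by
    exact (congrArg (φ : X →ₗ[k] k) (zero_smul Aᵐᵒᵖ x)).trans (LinearMap.map_zero (φ : X →ₗ[k] k))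

theorem KDual.smul_apply (a : A) (φ : KDual k A X) (x : X) :
    (a • φ) x = φ (MulOpposite.op a • x) := rfl

end KDual

/-- The map `Hom_A(d, A) : Hom_A(P₀, A) → Hom_A(P₁, A)` of right `A`-modules. -/
def homDual {A : Type u} [Ring A] {P₀ P₁ : Type*} [AddCommGroup P₀] [Module A P₀]
    [AddCommGroup P₁] [Module A P₁] (d : P₁ →ₗ[A] P₀) :
    (P₀ →ₗ[A] A) →ₗ[Aᵐᵒᵖ] (P₁ →ₗ[A] A) where
  toFun g := g ∘ₗ d
  map_add' _ _ := rfl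
  map_smul' _ _ := rfl

/-- The Auslander-Bridger transpose `Tr M`, a right `A`-module, computed from a minimal projective
presentation: the cokernel of `Hom_A(P₀, A) → Hom_A(P₁, A)`. -/
abbrev MinimalPresentation.Tr {A : Type u} [Ring A] {M : FGModuleCat.{u} A}
    (P : MinimalPresentation M) : Type u :=
  (P.P₁ →ₗ[A] A) ⧸ LinearMap.range (homDual P.d)

variable (k : Type v) [Field k] {A : Type u} [Ring A] [Algebra k A] [Module.Finite k A]

/-- A chosen minimal projective presentation (they are all isomorphic). -/
noncomputable def minimalPresentation (M : FGModuleCat.{u} A) : MinimalPresentation M :=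
  haveI : IsArtinianRing A := IsArtinianRing.of_finite k A
  (nonempty_minimalPresentation M).some

/-- The Auslander-Reiten translate `τ M = D Tr M`. -/
abbrev tau (M : FGModuleCat.{u} A) : Type (max u v) :=
  KDual k A (minimalPresentation k M).Tr

end AuslanderReitenTranslation

section Modules

variable {A : Type u} [Ring A]

/-- Isomorphism classes of finitely generated left `A`-modules. -/
abbrev IsoClass (A : Type u) [Ring A] : Type (u + 1) :=
  Quotient (isIsomorphicSetoid (FGModuleCat.{u} A))

/-- The isomorphism class of a module. -/
def isoClass (M : FGModuleCat.{u} A) : IsoClass A := Quotient.mk _ M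

/-- `X` is (isomorphic to) a direct summand of `M`. -/
def IsDirectSummand (X M : Type*) [AddCommGroup X] [Module A X] [AddCommGroup M] [Module A M] :
    Prop :=
  ∃ (i : X →ₗ[A] M) (r : M →ₗ[A] X), r ∘ₗ i = LinearMap.id

/-- A module is indecomposable if it is nonzero and not a direct sum of two nonzero submodules. -/
def IsIndecomposable (M : FGModuleCat.{u} A) : Prop :=
  Nontrivial M ∧ ∀ N L : Submodule A M, IsCompl N L → N = ⊥ ∨ L = ⊥

/-- A module is basic if it is a finite direct sum of pairwise non-isomorphic indecomposables. -/
def IsBasic (M : FGModuleCat.{u} A) : Prop :=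
  ∃ (n : ℕ) (X : Fin n → FGModuleCat.{u} A), (∀ i, IsIndecomposable (X i)) ∧
    (∀ i j, Nonempty (X i ≃ₗ[A] X j) → i = j) ∧ Nonempty (M ≃ₗ[A] ∀ i, X i)

/-- The number of isomorphism classes of indecomposable direct summands of `M`. -/
noncomputable def numIndecomposableSummands (M : FGModuleCat.{u} A) : ℕ∞ :=
  Set.encard {c : IsoClass A | ∃ X : FGModuleCat.{u} A, isoClass X = c ∧ IsIndecomposable X ∧
    IsDirectSummand (A := A) X M}

/-- The number of isomorphism classes of simple `A`-modules. -/
noncomputable def numSimples (A : Type u) [Ring A] : ℕ∞ :=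
  Set.encard {c : IsoClass A | ∃ S : FGModuleCat.{u} A, isoClass S = c ∧ IsSimpleModule A S}

/-- `M` is τ-tilting: `Hom(M, τ M) = 0`, and `M` has as many indecomposable direct summands (up to
isomorphism) as there are simple modules. -/
def IsTauTilting (k : Type v) [Field k] [Algebra k A] [Module.Finite k A]
    (M : FGModuleCat.{u} A) : Prop :=
  (∀ f : M →ₗ[A] tau k M, f = 0) ∧ numIndecomposableSummands M = numSimples A

/-- The two-sided ideal `A e A`. -/
def idealGen (e : A) : Ideal A := (TwoSidedIdeal.span {e}).asIdeal

instance (e : A) : (idealGen e).IsTwoSided :=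
  inferInstanceAs ((TwoSidedIdeal.span {e}).asIdeal).IsTwoSided

/-- `M` is support τ-tilting: for some idempotent `e`, it is (the restriction to `A` of) a τ-tilting
module over `A / A e A`. -/
def IsSupportTauTilting (k : Type v) [Field k] [Algebra k A] [Module.Finite k A]
    (M : FGModuleCat.{u} A) : Prop :=
  ∃ e : A, IsIdempotentElem e ∧ ∃ N : FGModuleCat.{u} (A ⧸ idealGen e),
    IsTauTilting k N ∧
      ∃ φ : M →ₛₗ[Ideal.Quotient.mk (idealGen e)] N, Function.Bijective φ

/-- `Ext¹(X, Y) = 0`. -/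
def ExtOneVanishes (X Y : FGModuleCat.{u} A) : Prop :=
  Subsingleton (Abelian.Ext X.obj Y.obj 1)

end Modules

section Subcategories

variable {A : Type u} [Ring A]

/-- `Gen T`: the factor modules of finite direct sums of copies of `T`. -/
def Gen (T : FGModuleCat.{u} A) : ObjectProperty (FGModuleCat.{u} A) := fun X =>
  ∃ (n : ℕ) (f : (Fin n → T) →ₗ[A] X), Function.Surjective f

/-- `add T`: the direct summands of finite direct sums of copies of `T`. -/
def addClosure (T : FGModuleCat.{u} A) : ObjectProperty (FGModuleCat.{u} A) := fun X =>
  ∃ n : ℕ, IsDirectSummand (A := A) X (Fin n → T)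

/-- `T^⊥ = {Y | Hom(T, Y) = 0}`. -/
def homPerp (T : FGModuleCat.{u} A) : ObjectProperty (FGModuleCat.{u} A) := fun Y =>
  ∀ f : T →ₗ[A] Y, f = 0

/-- `^{⊥₁}𝒳 = {Y | Ext¹(Y, 𝒳) = 0}`. -/
def extPerp (𝒳 : ObjectProperty (FGModuleCat.{u} A)) : ObjectProperty (FGModuleCat.{u} A) :=
  fun Y => ∀ X, 𝒳 X → ExtOneVanishes Y X

/-- `f : X → M` is a right `𝒞`-approximation of `M`. -/
def IsRightApprox (𝒞 : ObjectProperty (FGModuleCat.{u} A)) {X M : FGModuleCat.{u} A}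
    (f : X →ₗ[A] M) : Prop :=
  𝒞 X ∧ ∀ X', 𝒞 X' → ∀ h : X' →ₗ[A] M, ∃ h' : X' →ₗ[A] X, f ∘ₗ h' = h

/-- `g : M → Y` is a left `𝒯`-approximation of `M`. -/
def IsLeftApprox (𝒯 : ObjectProperty (FGModuleCat.{u} A)) {M Y : FGModuleCat.{u} A}
    (g : M →ₗ[A] Y) : Prop :=
  𝒯 Y ∧ ∀ Y', 𝒯 Y' → ∀ h : M →ₗ[A] Y', ∃ h' : Y →ₗ[A] Y', h' ∘ₗ g = h

/-- There is an exact sequence `0 → Y → X → M → 0` with `Y` in `𝒯`, `X` in `𝒞` and `X → M` a right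
`𝒞`-approximation. -/
def HasRightSequence (𝒞 𝒯 : ObjectProperty (FGModuleCat.{u} A)) (M : FGModuleCat.{u} A) : Prop :=
  ∃ (X Y : FGModuleCat.{u} A) (i : Y →ₗ[A] X) (f : X →ₗ[A] M), 𝒞 X ∧ 𝒯 Y ∧
    Function.Injective i ∧ Function.Exact i f ∧ Function.Surjective f ∧ IsRightApprox 𝒞 f

/-- `g : M → Y` is a left `𝒯`-approximation that extends to an exact sequence `M → Y → X → 0` with
`Y` in `𝒯` and `X` in `𝒞`. -/
def IsLeftSequence (𝒞 𝒯 : ObjectProperty (FGModuleCat.{u} A)) {M Y : FGModuleCat.{u} A}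
    (g : M →ₗ[A] Y) : Prop :=
  ∃ (X : FGModuleCat.{u} A) (p : Y →ₗ[A] X), 𝒞 X ∧ 𝒯 Y ∧
    Function.Exact g p ∧ Function.Surjective p ∧ IsLeftApprox 𝒯 g

/-- `(𝒞, 𝒯)` is a left weak cotorsion pair. Both classes are full subcategories closed under direct
summands (in particular under isomorphisms). -/
structure IsLeftWeakCotorsionPair (𝒞 𝒯 : ObjectProperty (FGModuleCat.{u} A)) : Prop where
  summands_left : 𝒞.IsStableUnderRetracts
  summands_right : 𝒯.IsStableUnderRetracts
  ext_vanishes : ∀ X Y, 𝒞 X → 𝒯 Y → ExtOneVanishes X Y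
  right_sequence : ∀ M, HasRightSequence 𝒞 𝒯 M
  left_sequence : ∀ M : FGModuleCat.{u} A, ∃ (Y : FGModuleCat.{u} A) (g : M →ₗ[A] Y),
    IsLeftSequence 𝒞 𝒯 g

/-- `(𝒞, 𝒯)` is a (complete) cotorsion pair: a left weak cotorsion pair in which the left
approximations can be chosen injective. -/
structure IsCotorsionPair (𝒞 𝒯 : ObjectProperty (FGModuleCat.{u} A)) : Prop
    extends IsLeftWeakCotorsionPair 𝒞 𝒯 where
  left_sequence_injective : ∀ M : FGModuleCat.{u} A, ∃ (Y : FGModuleCat.{u} A) (g : M →ₗ[A] Y),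
    IsLeftSequence 𝒞 𝒯 g ∧ Function.Injective g

/-- `(𝒯, ℱ)` is a torsion pair: each class is the `Hom`-orthogonal of the other. -/
structure IsTorsionPair (𝒯 ℱ : ObjectProperty (FGModuleCat.{u} A)) : Prop where
  torsion_iff : ∀ X, 𝒯 X ↔ ∀ Y, ℱ Y → ∀ f : X →ₗ[A] Y, f = 0
  torsionFree_iff : ∀ Y, ℱ Y ↔ ∀ X, 𝒯 X → ∀ f : X →ₗ[A] Y, f = 0

/-- A triple `(𝒞, 𝒯, ℱ)` of full subcategories of `mod A`. -/
@[ext]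
structure SubcatTriple (A : Type u) [Ring A] where
  C : ObjectProperty (FGModuleCat.{u} A)
  T : ObjectProperty (FGModuleCat.{u} A)
  F : ObjectProperty (FGModuleCat.{u} A)

/-- Left weak cotorsion-torsion triples. -/
def IsLwCotorsionTorsion (t : SubcatTriple A) : Prop :=
  IsLeftWeakCotorsionPair t.C t.T ∧ IsTorsionPair t.T t.F

/-- Cotorsion-torsion triples. -/
def IsCotorsionTorsion (t : SubcatTriple A) : Prop :=
  IsCotorsionPair t.C t.T ∧ IsTorsionPair t.T t.F

/-- `T` is a (classical) tilting module: `pd T ≤ 1`, `Ext¹(T, T) = 0`, and there is an exact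
sequence `0 → A → T₀ → T₁ → 0` with `T₀`, `T₁` in `add T`. -/
structure IsTilting (T : FGModuleCat.{u} A) : Prop where
  projectiveDimension_le_one : HasProjectiveDimensionLE T.obj 1
  ext_self : ExtOneVanishes T T
  coresolution : ∃ (T₀ T₁ : FGModuleCat.{u} A) (i : A →ₗ[A] T₀) (p : T₀ →ₗ[A] T₁),
    addClosure T T₀ ∧ addClosure T T₁ ∧
      Function.Injective i ∧ Function.Exact i p ∧ Function.Surjective p

/-- The triple `(^{⊥₁}Gen T, Gen T, T^⊥)`. -/
def tripleOf (T : FGModuleCat.{u} A) : SubcatTriple A := ⟨extPerp (Gen T), Gen T, homPerp T⟩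

theorem gen_le_of_equiv {T T' : FGModuleCat.{u} A} (e : T ≃ₗ[A] T') : Gen T ≤ Gen T' := by
  rintro X ⟨n, f, hf⟩
  refine ⟨n, f ∘ₗ (LinearEquiv.piCongrRight fun _ => e.symm).toLinearMap, ?_⟩
  exact hf.comp (LinearEquiv.surjective _)

theorem homPerp_le_of_equiv {T T' : FGModuleCat.{u} A} (e : T ≃ₗ[A] T') :
    homPerp T ≤ homPerp T' := by
  intro Y hY f
  have h := hY (f ∘ₗ e.toLinearMap)
  ext x
  simpa using LinearMap.congr_fun h (e.symm x)

theorem tripleOf_eq_of_iso {T T' : FGModuleCat.{u} A} (i : T ≅ T') : tripleOf T = tripleOf T' := by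
  have e := FGModuleCat.isoToLinearEquiv i
  have hG : Gen T = Gen T' := le_antisymm (gen_le_of_equiv e) (gen_le_of_equiv e.symm)
  have hP : homPerp T = homPerp T' := le_antisymm (homPerp_le_of_equiv e)
    (homPerp_le_of_equiv e.symm)
  rw [tripleOf, tripleOf, hG, hP]

/-- The map `T ↦ (^{⊥₁}Gen T, Gen T, T^⊥)` on isomorphism classes of modules. -/
def tripleMap : IsoClass A → SubcatTriple A :=
  Quotient.lift tripleOf fun _ _ ⟨i⟩ => tripleOf_eq_of_iso i

/-- The isomorphism classes of basic support τ-tilting modules. -/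
def basicSupportTauTilting (k : Type v) (A : Type u) [Field k] [Ring A] [Algebra k A]
    [Module.Finite k A] : Set (IsoClass A) :=
  isoClass '' {T : FGModuleCat.{u} A | IsBasic T ∧ IsSupportTauTilting k T}

/-- The isomorphism classes of basic tilting modules. -/
def basicTilting (A : Type u) [Ring A] : Set (IsoClass A) :=
  isoClass '' {T : FGModuleCat.{u} A | IsBasic T ∧ IsTilting T}

end Subcategories

end WeakCotorsion

namespace WeakCotorsion

/-! ### Vanishing of `Ext¹` in terms of extending and lifting maps. -/

section ExtOne

variable {A : Type u} [Ring A]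

/-! Both sides of the bijection are compared with `IsSilting`: `Ext¹(T, Gen T) = 0`, and some left
`Gen T`-approximation `A → Y` has `Y` and its cokernel in `add T`.

Silting modules and triples. For a torsion class `𝒯`, a single sequence `A → Y → X → 0` with `A → Y`
a left `𝒯`-approximation and `Ext¹(X, 𝒯) = 0` controls everything. Pushing `A^n → Y^n` out along a
surjection `A^n → M` produces the left sequence of every `M` (`IsApproxSequence.exists_left`), and
Salce's trick turns left sequences of syzygies into right sequences
(`IsApproxSequence.exists_right`). It follows that `add (Y ⊕ X)` is `^{⊥₁}𝒯 ∩ 𝒯`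
(`addClosure_prod_eq`) and generates `𝒯` (`gen_eq`). Since `𝒞 = ^{⊥₁}𝒯` in every left weak cotorsion
pair, the triple and the additive closure `𝒞 ∩ 𝒯` determine each other, and by Krull–Schmidt an
additive closure `add M` is the same as a basic module. Tilting modules give the case of injective
`A → Y`; conversely, if every module embeds into one of `𝒯`, then `Ext¹(T, 𝒯) = 0` forces projective
dimension at most 1.

Silting and support `τ`-tilting modules. For a minimal presentation `d : P₁ → P₀` of `M`, `Hom(N,
τM) = 0` means that every map `P₁ → N` extends along `d`, and this is equivalent to `Ext¹(M, Gen N)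
= 0`; for `N = M` this is `forall_hom_tau_eq_zero_iff`. Hence on `Gen T` the functions `dim Hom(X_j,
-)`, for the indecomposable summands `X_j` of a `τ`-rigid `T`, agree with additive functions, that
is, with integer vectors indexed by the simple modules. These vectors are independent, so there are
at most as many summands as simples; if `T` is silting and every simple embeds into a module of `Gen
T`, they span enough to give equality (`IsSilting.numSimples_le`). Bongartz completion
(`exists_isSilting_addClosure`) makes a `τ`-rigid module a summand of a silting one, and the upper
bound shows that a `τ`-tilting module has nothing left to add. For the support,
`exists_support_idempotent` picks an idempotent `e` killing `M` with `Ae` maximal, and silting is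
transferred between `A` and `A/AeA`. -/

theorem shortExact_of_linearMap {X Y Z : FGModuleCat.{u} A} (i : X →ₗ[A] Y) (p : Y →ₗ[A] Z)
    (hi : Function.Injective i) (hip : Function.Exact i p) (hp : Function.Surjective p) :
    ∃ (w : ModuleCat.ofHom i ≫ ModuleCat.ofHom p = 0),
      (ShortComplex.mk (C := ModuleCat.{u} A) (X₁ := X.obj) (X₂ := Y.obj) (X₃ := Z.obj)
        (ModuleCat.ofHom i) (ModuleCat.ofHom p) w).ShortExact := by
  have w : ModuleCat.ofHom i ≫ ModuleCat.ofHom p = 0 := by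
    ext x
    exact hip.apply_apply_eq_zero x
  refine ⟨w, ?_⟩
  refine { exact := ?_, mono_f := ?_, epi_g := ?_ }
  · rw [ShortComplex.ShortExact.moduleCat_exact_iff_function_exact]
    exact hip
  · exact (ModuleCat.mono_iff_injective _).2 hi
  · exact (ModuleCat.epi_iff_surjective _).2 hp

/-- Maps into `Y` extend along a monomorphism with cokernel `X`, if `Ext¹(X, Y) = 0`. -/
theorem ExtOneVanishes.exists_extend {X Y K E : FGModuleCat.{u} A} (h : ExtOneVanishes X Y)
    (i : K →ₗ[A] E) (p : E →ₗ[A] X) (hi : Function.Injective i) (hip : Function.Exact i p)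
    (hp : Function.Surjective p) (f : K →ₗ[A] Y) : ∃ g : E →ₗ[A] Y, g ∘ₗ i = f := by
  obtain ⟨w, hS⟩ := shortExact_of_linearMap i p hi hip hp
  have hsub : Subsingleton (Abelian.Ext X.obj Y.obj 1) := h
  obtain ⟨x, hx⟩ := Abelian.Ext.contravariant_sequence_exact₁ hS Y.obj
    (Abelian.Ext.mk₀ (ModuleCat.ofHom f)) (n₁ := 1) rfl
    (Subsingleton.elim (α := Abelian.Ext X.obj Y.obj 1) _ _)
  obtain ⟨g, rfl⟩ := (Abelian.Ext.mk₀_bijective _ _).2 x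
  rw [Abelian.Ext.mk₀_comp_mk₀] at hx
  have := (Abelian.Ext.mk₀_bijective _ _).1 hx
  exact ⟨g.hom, congrArg ModuleCat.Hom.hom this⟩

/-- Maps from `X` lift along an epimorphism with kernel `Y`, if `Ext¹(X, Y) = 0`. -/
theorem ExtOneVanishes.exists_lift {X Y E Z : FGModuleCat.{u} A} (h : ExtOneVanishes X Y)
    (i : Y →ₗ[A] E) (p : E →ₗ[A] Z) (hi : Function.Injective i) (hip : Function.Exact i p)
    (hp : Function.Surjective p) (f : X →ₗ[A] Z) : ∃ g : X →ₗ[A] E, p ∘ₗ g = f := by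
  obtain ⟨w, hS⟩ := shortExact_of_linearMap i p hi hip hp
  have hsub : Subsingleton (Abelian.Ext X.obj Y.obj 1) := h
  obtain ⟨x, hx⟩ := Abelian.Ext.covariant_sequence_exact₃ X.obj hS
    (Abelian.Ext.mk₀ (ModuleCat.ofHom f)) (n₁ := 1) rfl
    (Subsingleton.elim (α := Abelian.Ext X.obj Y.obj 1) _ _)
  obtain ⟨g, rfl⟩ := (Abelian.Ext.mk₀_bijective _ _).2 x
  rw [Abelian.Ext.mk₀_comp_mk₀] at hx
  have := (Abelian.Ext.mk₀_bijective _ _).1 hx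
  exact ⟨g.hom, congrArg ModuleCat.Hom.hom this⟩

/-- As `Ext¹(P, Y) = 0`, every class in `Ext¹(X, Y)` is the extension class composed with a map `K →
Y`; if that map extends to `P`, the composite vanishes. -/
theorem extOneVanishes_of_extend {X Y K P : FGModuleCat.{u} A} [Module.Projective A P]
    (i : K →ₗ[A] P) (p : P →ₗ[A] X) (hi : Function.Injective i) (hip : Function.Exact i p)
    (hp : Function.Surjective p) (h : ∀ f : K →ₗ[A] Y, ∃ g : P →ₗ[A] Y, g ∘ₗ i = f) :
    ExtOneVanishes X Y := by
  obtain ⟨w, hS⟩ := shortExact_of_linearMap i p hi hip hp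
  have : Projective P.obj := (IsProjective.iff_projective P).1 inferInstance
  refine subsingleton_of_forall_eq 0 fun x => ?_
  obtain ⟨y, rfl⟩ := Abelian.Ext.contravariant_sequence_exact₃ hS Y.obj x
    (Abelian.Ext.eq_zero_of_projective _) (n₀ := 0) rfl
  obtain ⟨f, rfl⟩ := (Abelian.Ext.mk₀_bijective _ _).2 y
  obtain ⟨g, hg⟩ := h f.hom
  have hf : f = ModuleCat.ofHom i ≫ ModuleCat.ofHom g := ModuleCat.hom_ext hg.symm
  rw [hf, ← Abelian.Ext.mk₀_comp_mk₀]
  exact hS.extClass_comp_assoc _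

/-- If `pd X ≤ 1`, then `Ext¹(X, -)` is right exact. -/
theorem ExtOneVanishes.of_surjective {X Y Z : FGModuleCat.{u} A} [IsNoetherianRing A]
    (hX : HasProjectiveDimensionLE X.obj 1) (h : ExtOneVanishes X Y) (p : Y →ₗ[A] Z)
    (hp : Function.Surjective p) : ExtOneVanishes X Z := by
  obtain ⟨w, hS⟩ := shortExact_of_linearMap (X := FGModuleCat.of A (LinearMap.ker p))
    (LinearMap.ker p).subtype p Subtype.val_injective
    (LinearMap.exact_subtype_ker_map p) hp
  refine subsingleton_of_forall_eq 0 fun x => ?_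
  -- The obstruction to lifting `x` to `Ext¹(X, Y)` lies in `Ext²(X, ker p) = 0`.
  obtain ⟨y, rfl⟩ := Abelian.Ext.covariant_sequence_exact₃ X.obj hS x (n₁ := 2) rfl
    (Abelian.Ext.eq_zero_of_hasProjectiveDimensionLT _ 2 le_rfl)
  have hsub : Subsingleton (Abelian.Ext X.obj Y.obj 1) := h
  rw [Subsingleton.elim (α := Abelian.Ext X.obj Y.obj 1) y 0, Abelian.Ext.zero_comp]

theorem hasProjectiveDimensionLE_one {X P K : FGModuleCat.{u} A} [Module.Projective A P]
    [Module.Projective A K]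
    (i : K →ₗ[A] P) (p : P →ₗ[A] X) (hi : Function.Injective i) (hip : Function.Exact i p)
    (hp : Function.Surjective p) : HasProjectiveDimensionLE X.obj 1 := by
  obtain ⟨w, hS⟩ := shortExact_of_linearMap i p hi hip hp
  have : Projective P.obj := (IsProjective.iff_projective P).1 inferInstance
  have : Projective K.obj := (IsProjective.iff_projective K).1 inferInstance
  exact hS.hasProjectiveDimensionLT_X₃ 1 (inferInstanceAs (HasProjectiveDimensionLT K.obj 1))
    (inferInstanceAs (HasProjectiveDimensionLT P.obj 2))

end ExtOne

/-! ### Pushouts of modules and of extensions. -/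

section Pushout

variable {A : Type u} [Ring A]

/-- Pushouts of finitely generated modules. -/
theorem exists_pushout {K P L : FGModuleCat.{u} A} (i : K →ₗ[A] P) (l : K →ₗ[A] L) :
    ∃ (E : FGModuleCat.{u} A) (a : P →ₗ[A] E) (j : L →ₗ[A] E), a ∘ₗ i = j ∘ₗ l ∧
      (∀ e, ∃ x y, e = a x + j y) ∧
      (∀ x y, a x = j y → ∃ z, i z = x ∧ l z = y) ∧
      ∀ (W : FGModuleCat.{u} A) (s : P →ₗ[A] W) (t : L →ₗ[A] W), s ∘ₗ i = t ∘ₗ l →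
        ∃ r : E →ₗ[A] W, r ∘ₗ a = s ∧ r ∘ₗ j = t := by
  let N : Submodule A (P × L) := LinearMap.range (i.prod (-l))
  refine ⟨FGModuleCat.of A ((P × L) ⧸ N), N.mkQ ∘ₗ LinearMap.inl A P L,
    N.mkQ ∘ₗ LinearMap.inr A P L, ?_, ?_, ?_, ?_⟩
  · ext z
    refine (Submodule.Quotient.eq N).2 ⟨z, ?_⟩
    simp
  · intro e
    obtain ⟨⟨x, y⟩, rfl⟩ := N.mkQ_surjective e
    refine ⟨x, y, ?_⟩
    simp only [LinearMap.comp_apply, ← map_add]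
    simp
  · intro x y h
    obtain ⟨z, hz⟩ := (Submodule.Quotient.eq N).1 h
    refine ⟨z, ?_⟩
    simpa using hz
  · intro W s t h
    refine ⟨N.liftQ (s.coprod t) ?_, ?_, ?_⟩
    · rintro _ ⟨z, rfl⟩
      have := LinearMap.congr_fun h z
      simp only [LinearMap.comp_apply] at this
      simp [this]
    · ext x
      simp
    · ext x
      simp

/-- The pushout of an extension `0 → K → P → X → 0` along a map `K → L`. -/
theorem exists_pushout_extension {K P L X : FGModuleCat.{u} A} (i : K →ₗ[A] P) (π : P →ₗ[A] X)
    (hi : Function.Injective i) (hiπ : Function.Exact i π) (hπ : Function.Surjective π)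
    (l : K →ₗ[A] L) :
    ∃ (E : FGModuleCat.{u} A) (a : P →ₗ[A] E) (j : L →ₗ[A] E) (q : E →ₗ[A] X),
      Function.Injective j ∧ Function.Exact j q ∧ Function.Surjective q ∧
      q ∘ₗ a = π ∧ a ∘ₗ i = j ∘ₗ l ∧ (∀ e, ∃ x y, e = a x + j y) ∧
      ∀ (W : FGModuleCat.{u} A) (s : P →ₗ[A] W) (t : L →ₗ[A] W), s ∘ₗ i = t ∘ₗ l →
        ∃ r : E →ₗ[A] W, r ∘ₗ a = s ∧ r ∘ₗ j = t := by
  obtain ⟨E, a, j, h1, h2, h3, h4⟩ := exists_pushout i l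
  obtain ⟨q, hq1, hq2⟩ := h4 X π 0 (by ext z; simpa using hiπ.apply_apply_eq_zero z)
  refine ⟨E, a, j, q, ?_, ?_, ?_, hq1, h1, h2, h4⟩
  · rw [injective_iff_map_eq_zero]
    intro y hy
    obtain ⟨z, hz1, hz2⟩ := h3 0 y (by rw [map_zero, hy])
    have : z = 0 := hi (hz1.trans (map_zero i).symm)
    rw [← hz2, this, map_zero]
  · intro e
    constructor
    · intro he
      obtain ⟨x, y, rfl⟩ := h2 e
      have hx : π x = 0 := by
        have e1 := LinearMap.congr_fun hq1 x
        have e2 := LinearMap.congr_fun hq2 y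
        simp only [LinearMap.comp_apply, LinearMap.zero_apply] at e1 e2
        rw [map_add, e1, e2, add_zero] at he
        exact he
      obtain ⟨z, rfl⟩ := (hiπ x).1 hx
      have e3 := LinearMap.congr_fun h1 z
      refine ⟨l z + y, ?_⟩
      rw [map_add]
      exact congrArg (· + j y) e3.symm
    · rintro ⟨y, rfl⟩
      exact LinearMap.congr_fun hq2 y
  · intro x
    obtain ⟨y, rfl⟩ := hπ x
    exact ⟨a y, LinearMap.congr_fun hq1 y⟩

/-- A split epimorphism gives a retraction of its kernel. -/
theorem exists_retraction {X Y E : Type*} [AddCommGroup X] [Module A X] [AddCommGroup Y]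
    [Module A Y] [AddCommGroup E] [Module A E] (j : Y →ₗ[A] E) (q : E →ₗ[A] X)
    (hj : Function.Injective j) (hjq : Function.Exact j q) (s : X →ₗ[A] E)
    (hs : q ∘ₗ s = LinearMap.id) : ∃ r : E →ₗ[A] Y, r ∘ₗ j = LinearMap.id := by
  have hr : ∀ e, ∃ y, j y = e - s (q e) := by
    intro e
    refine (hjq _).1 ?_
    have := LinearMap.congr_fun hs (q e)
    simp only [LinearMap.comp_apply, LinearMap.id_apply] at this
    rw [map_sub, this, sub_self]
  choose r hr using hr
  refine ⟨{ toFun := r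
            map_add' := fun x y => hj (by rw [map_add, hr, hr, hr, map_add, map_add]; abel)
            map_smul' := fun c x => hj (by
              rw [RingHom.id_apply, map_smul, hr, hr, map_smul, map_smul, smul_sub]) }, ?_⟩
  ext y
  refine hj ?_
  change j (r (j y)) = j y
  rw [hr, hjq.apply_apply_eq_zero, map_zero, sub_zero]

variable [IsNoetherianRing A]

/-- Push `0 → K → A^n → X → 0` out along a map `K → Y`. A section of the resulting extension gives a
retraction onto `Y`, whose composite with `A^n → E` extends the given map. This reduces `Ext`
vanishing to constructing sections. -/
theorem extOneVanishes_of_split {X Y : FGModuleCat.{u} A}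
    (h : ∀ (E : FGModuleCat.{u} A) (i : Y →ₗ[A] E) (p : E →ₗ[A] X), Function.Injective i →
      Function.Exact i p → Function.Surjective p → ∃ s : X →ₗ[A] E, p ∘ₗ s = LinearMap.id) :
    ExtOneVanishes X Y := by
  obtain ⟨n, π, hπ⟩ := Module.Finite.exists_fin' A X
  let P := FGModuleCat.of A (Fin n → A)
  let K := FGModuleCat.of A (LinearMap.ker π)
  let i : K →ₗ[A] P := (LinearMap.ker π).subtype
  have hi : Function.Injective i := Subtype.val_injective
  have hiπ : Function.Exact i π := LinearMap.exact_subtype_ker_map π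
  refine extOneVanishes_of_extend (K := K) (P := P) i π hi hiπ hπ fun f => ?_
  obtain ⟨E, a, j, q, hj, hjq, hq, -, h1, -, -⟩ := exists_pushout_extension (P := P) i π hi hiπ hπ f
  obtain ⟨s, hs⟩ := h E j q hj hjq hq
  obtain ⟨r, hr⟩ := exists_retraction j q hj hjq s hs
  refine ⟨r ∘ₗ a, ?_⟩
  rw [LinearMap.comp_assoc, h1, ← LinearMap.comp_assoc, hr, LinearMap.id_comp]

end Pushout

end WeakCotorsion

namespace WeakCotorsion

/-! ### Additive closures through factorizations of the identity. -/

section Factorization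

variable {A : Type u} [Ring A]

/-- `f` factors through a finite direct sum of copies of `T`. -/
def FactorsThrough (T : FGModuleCat.{u} A) {X Y : Type*} [AddCommGroup X] [Module A X]
    [AddCommGroup Y] [Module A Y] (f : X →ₗ[A] Y) : Prop :=
  ∃ (n : ℕ) (a : Fin n → X →ₗ[A] T) (b : Fin n → T →ₗ[A] Y), f = ∑ i, b i ∘ₗ a i

variable {T : FGModuleCat.{u} A} {X Y Z : Type*} [AddCommGroup X] [Module A X]
    [AddCommGroup Y] [Module A Y] [AddCommGroup Z] [Module A Z]

theorem FactorsThrough.add {f g : X →ₗ[A] Y} (hf : FactorsThrough T f)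
    (hg : FactorsThrough T g) : FactorsThrough T (f + g) := by
  obtain ⟨n, a, b, rfl⟩ := hf
  obtain ⟨m, c, d, rfl⟩ := hg
  refine ⟨n + m, Fin.append a c, Fin.append b d, ?_⟩
  simp [Fin.sum_univ_add]

theorem FactorsThrough.zero : FactorsThrough T (0 : X →ₗ[A] Y) :=
  ⟨0, Fin.elim0, Fin.elim0, by simp⟩

theorem FactorsThrough.sum {ι : Type*} (s : Finset ι) {f : ι → X →ₗ[A] Y}
    (hf : ∀ i ∈ s, FactorsThrough T (f i)) : FactorsThrough T (∑ i ∈ s, f i) :=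
  Finset.sum_induction f (FactorsThrough T) (fun _ _ => FactorsThrough.add) FactorsThrough.zero hf

theorem FactorsThrough.comp_left {f : X →ₗ[A] Y} (hf : FactorsThrough T f) (g : Y →ₗ[A] Z) :
    FactorsThrough T (g ∘ₗ f) := by
  obtain ⟨n, a, b, rfl⟩ := hf
  refine ⟨n, a, fun i => g ∘ₗ b i, ?_⟩
  ext x
  simp

theorem FactorsThrough.comp_right {f : Y →ₗ[A] Z} (hf : FactorsThrough T f) (g : X →ₗ[A] Y) :
    FactorsThrough T (f ∘ₗ g) := by
  obtain ⟨n, a, b, rfl⟩ := hf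
  refine ⟨n, fun i => a i ∘ₗ g, b, ?_⟩
  ext x
  simp

theorem factorsThrough_comp (a : X →ₗ[A] T) (b : T →ₗ[A] Y) : FactorsThrough T (b ∘ₗ a) :=
  ⟨1, fun _ => a, fun _ => b, by simp⟩

theorem FactorsThrough.trans {T' : FGModuleCat.{u} A} {f : X →ₗ[A] Y} (hf : FactorsThrough T f)
    (h : FactorsThrough T' (LinearMap.id : T →ₗ[A] T)) : FactorsThrough T' f := by
  obtain ⟨n, a, b, rfl⟩ := hf
  refine FactorsThrough.sum _ fun i _ => ?_
  have := (h.comp_right (a i)).comp_left (b i)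
  rwa [LinearMap.id_comp] at this

theorem factorsThrough_id_pi (n : ℕ) :
    FactorsThrough T (LinearMap.id : (Fin n → T) →ₗ[A] (Fin n → T)) := by
  refine ⟨n, fun i => LinearMap.proj i, fun i => LinearMap.single A (fun _ => (T : Type u)) i, ?_⟩
  ext i x j
  simp

/-- Maps that factor through sums of copies of `T` are closed under sums and two-sided composition,
so this criterion makes the closure properties of `add T` formal. -/
theorem addClosure_iff {X : FGModuleCat.{u} A} :
    addClosure T X ↔ FactorsThrough T (LinearMap.id : X →ₗ[A] X) := by
  constructor
  · rintro ⟨n, i, r, h⟩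
    rw [← h]
    have := ((factorsThrough_id_pi (T := T) n).comp_right i).comp_left r
    rwa [LinearMap.id_comp] at this
  · rintro ⟨n, a, b, h⟩
    refine ⟨n, LinearMap.pi a, ∑ i, b i ∘ₗ LinearMap.proj i, ?_⟩
    rw [h]
    ext x
    simp

theorem addClosure_self : addClosure T T :=
  addClosure_iff.2 (factorsThrough_comp LinearMap.id LinearMap.id)

theorem addClosure.trans {X Y : FGModuleCat.{u} A} (h : addClosure T X) (h' : addClosure X Y) :
    addClosure T Y :=
  addClosure_iff.2 ((addClosure_iff.1 h').trans (addClosure_iff.1 h))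

theorem addClosure_of_isDirectSummand {X : FGModuleCat.{u} A}
    (h : IsDirectSummand (A := A) X T) : addClosure T X := by
  obtain ⟨i, r, h⟩ := h
  exact addClosure_iff.2 (h ▸ factorsThrough_comp i r)

theorem addClosure_of_equiv {X : FGModuleCat.{u} A} (e : T ≃ₗ[A] X) : addClosure T X :=
  addClosure_of_isDirectSummand ⟨e.symm.toLinearMap, e.toLinearMap, by ext; simp⟩

theorem addClosure_le {T' : FGModuleCat.{u} A} (h : addClosure T' T) :
    addClosure T ≤ addClosure T' :=
  fun _ hX => h.trans hX

theorem addClosure_pi (n : ℕ) : addClosure T (FGModuleCat.of A (Fin n → T)) :=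
  addClosure_iff.2 (factorsThrough_id_pi n)

theorem addClosure.prod {X Y : FGModuleCat.{u} A} (hX : addClosure T X) (hY : addClosure T Y) :
    addClosure T (FGModuleCat.of A (X × Y)) := by
  rw [addClosure_iff] at *
  have h1 := (hX.comp_right (LinearMap.fst A X Y)).comp_left (LinearMap.inl A X Y)
  have h2 := (hY.comp_right (LinearMap.snd A X Y)).comp_left (LinearMap.inr A X Y)
  convert h1.add h2 using 1
  ext x <;> simp

theorem addClosure_prod_left {X Y : FGModuleCat.{u} A} :
    addClosure (FGModuleCat.of A (X × Y)) X :=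
  addClosure_of_isDirectSummand ⟨LinearMap.inl A X Y, LinearMap.fst A X Y, by ext; simp⟩

theorem addClosure_prod_right {X Y : FGModuleCat.{u} A} :
    addClosure (FGModuleCat.of A (X × Y)) Y :=
  addClosure_of_isDirectSummand ⟨LinearMap.inr A X Y, LinearMap.snd A X Y, by ext; simp⟩

theorem ExtOneVanishes.of_addClosure [IsNoetherianRing A] {X Z : FGModuleCat.{u} A}
    (hT : ExtOneVanishes T Z) (h : addClosure T X) : ExtOneVanishes X Z := by
  refine extOneVanishes_of_split fun E i p hi hip hp => ?_
  obtain ⟨n, a, b, h⟩ := addClosure_iff.1 h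
  choose c hc using fun j => hT.exists_lift i p hi hip hp (b j)
  refine ⟨∑ j, c j ∘ₗ a j, ?_⟩
  rw [h]
  ext x
  have (j) (y) : p (c j y) = b j y := LinearMap.congr_fun (hc j) y
  simp [this]

theorem exists_factor_of_exact (a : X →ₗ[A] Y) (z : Y →ₗ[A] Z)
    (haz : Function.Exact a z) (hz : Function.Surjective z) {W : Type*} [AddCommGroup W]
    [Module A W] (D : Y →ₗ[A] W) (hD : D ∘ₗ a = 0) : ∃ u : Z →ₗ[A] W, u ∘ₗ z = D := by
  have hk : LinearMap.ker z ≤ LinearMap.ker D := by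
    intro y hy
    obtain ⟨x, rfl⟩ := (haz y).1 hy
    exact LinearMap.congr_fun hD x
  refine ⟨(LinearMap.ker z).liftQ D hk ∘ₗ (z.quotKerEquivOfSurjective hz).symm.toLinearMap, ?_⟩
  ext y
  have : (z.quotKerEquivOfSurjective hz).symm (z y) = (LinearMap.ker z).mkQ y := by
    rw [LinearEquiv.symm_apply_eq]
    rfl
  simp [this]

end Factorization

/-! ### Traces and the torsion pair generated by a module. -/

section Trace

variable {A : Type u} [Ring A]

/-- The trace of `T` in `X`: the sum of the images of all maps `T → X`. -/
def trace (T : FGModuleCat.{u} A) (X : Type*) [AddCommGroup X] [Module A X] : Submodule A X :=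
  ⨆ f : T →ₗ[A] X, LinearMap.range f

variable {T : FGModuleCat.{u} A}

theorem range_le_trace {X : Type*} [AddCommGroup X] [Module A X] (f : T →ₗ[A] X) :
    LinearMap.range f ≤ trace T X :=
  le_iSup (fun f : T →ₗ[A] X => LinearMap.range f) f

theorem map_trace_le {X Y : Type*} [AddCommGroup X] [Module A X] [AddCommGroup Y] [Module A Y]
    (g : X →ₗ[A] Y) : (trace T X).map g ≤ trace T Y := by
  rw [trace, Submodule.map_iSup]
  refine iSup_le fun f => ?_
  rw [← LinearMap.range_comp]
  exact range_le_trace _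

/-- The images of all maps from `T` may be used at once: `X` is finitely generated, so `⊤` is a
compact element and finitely many of them already cover it. -/
theorem gen_iff_trace {X : FGModuleCat.{u} A} : Gen T X ↔ trace T X = ⊤ := by
  classical
  constructor
  · rintro ⟨n, f, hf⟩
    rw [eq_top_iff, ← LinearMap.range_eq_top.2 hf]
    rintro _ ⟨x, rfl⟩
    have hx : x = ∑ i, LinearMap.single A (fun _ => (T : Type u)) i (x i) := by
      ext j
      simp
    rw [hx, map_sum]
    exact Submodule.sum_mem _ fun i _ => range_le_trace
      (f ∘ₗ LinearMap.single A (fun _ => (T : Type u)) i) ⟨x i, rfl⟩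
  · intro h
    have hfg : (⊤ : Submodule A X).FG := Module.Finite.fg_top
    rw [Submodule.fg_iff_compact] at hfg
    obtain ⟨s, hs⟩ := CompleteLattice.IsCompactElement.exists_finset_of_le_iSup _ hfg
      (fun f : T →ₗ[A] X => LinearMap.range f) h.ge
    refine ⟨s.card, ∑ i, (s.equivFin.symm i : T →ₗ[A] X) ∘ₗ LinearMap.proj i, ?_⟩
    rw [← LinearMap.range_eq_top, eq_top_iff]
    refine hs.trans (iSup₂_le fun f hf => ?_)
    rintro _ ⟨x, rfl⟩
    refine ⟨Pi.single (s.equivFin ⟨f, hf⟩) x, ?_⟩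
    rw [LinearMap.sum_apply, Finset.sum_eq_single (s.equivFin ⟨f, hf⟩)]
    · simp
    · intro b _ hb
      simp [Pi.single_eq_of_ne hb]
    · simp

theorem gen_self : Gen T T :=
  gen_iff_trace.2 (eq_top_iff.2 fun x _ => range_le_trace LinearMap.id ⟨x, rfl⟩)

theorem Gen.of_surjective {X Y : FGModuleCat.{u} A} (h : Gen T X) (f : X →ₗ[A] Y)
    (hf : Function.Surjective f) : Gen T Y := by
  obtain ⟨n, g, hg⟩ := h
  exact ⟨n, f ∘ₗ g, hf.comp hg⟩

theorem Gen.trans {T' X : FGModuleCat.{u} A} (h : Gen T' T) (hX : Gen T X) : Gen T' X := by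
  rw [gen_iff_trace] at *
  rw [eq_top_iff, ← hX]
  refine iSup_le fun f => ?_
  rw [LinearMap.range_eq_map, ← h]
  exact map_trace_le f

theorem gen_of_addClosure {X : FGModuleCat.{u} A} (h : addClosure T X) : Gen T X := by
  obtain ⟨n, i, r, h⟩ := h
  exact ⟨n, r, fun x => ⟨i x, LinearMap.congr_fun h x⟩⟩

theorem gen_trace [IsNoetherianRing A] (X : FGModuleCat.{u} A) :
    Gen T (FGModuleCat.of A (trace T X)) := by
  rw [gen_iff_trace]
  have h : (trace T X) ≤ (trace T (trace T X)).map (trace T X).subtype := by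
    refine iSup_le fun f => ?_
    rintro _ ⟨x, rfl⟩
    refine ⟨⟨f x, range_le_trace f ⟨x, rfl⟩⟩, ?_, rfl⟩
    exact range_le_trace (f.codRestrict (trace T X) fun x => range_le_trace f ⟨x, rfl⟩) ⟨x, rfl⟩
  rw [eq_top_iff]
  rintro x -
  obtain ⟨y, hy, hyx⟩ := h x.2
  rwa [← Subtype.ext hyx]

theorem le_ker_of_forall_eq_zero {X Y : Type*} [AddCommGroup X] [Module A X] [AddCommGroup Y]
    [Module A Y] (hY : ∀ f : T →ₗ[A] Y, f = 0) (f : X →ₗ[A] Y) : trace T X ≤ LinearMap.ker f := by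
  refine iSup_le fun g => ?_
  rintro _ ⟨x, rfl⟩
  exact LinearMap.congr_fun (hY (f ∘ₗ g)) x

/-- If `T` has no extensions by the modules it generates, `T` has no maps to `X / tr_T X`. -/
theorem homPerp_quotient_trace [IsNoetherianRing A] {S : FGModuleCat.{u} A} (X : FGModuleCat.{u} A)
    (hS : ExtOneVanishes S (FGModuleCat.of A (trace S X))) :
    homPerp S (FGModuleCat.of A (X ⧸ trace S X)) := by
  intro f
  obtain ⟨g, hg⟩ := hS.exists_lift (E := X) (Z := FGModuleCat.of A (X ⧸ trace S X))
    (trace S X).subtype (trace S X).mkQ Subtype.val_injective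
    (LinearMap.exact_subtype_mkQ _) (Submodule.mkQ_surjective _) f
  rw [← hg]
  ext x
  exact (Submodule.Quotient.mk_eq_zero _).2 (range_le_trace g ⟨x, rfl⟩)

/-- The trace of `T` in `X` lies in `Gen T`, so `Ext¹(T, -)` kills it and `X / tr X` is in `T^⊥`. If
`X` has no maps to `T^⊥`, the projection to this quotient is zero and `X` is its own trace. -/
theorem isTorsionPair_gen [IsNoetherianRing A] (hT : extPerp (Gen T) T) :
    IsTorsionPair (Gen T) (homPerp T) where
  torsion_iff X := by
    constructor
    · intro hX Y hY f
      rw [gen_iff_trace] at hX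
      have := le_ker_of_forall_eq_zero hY f
      rw [hX, top_le_iff] at this
      exact LinearMap.ker_eq_top.1 this
    · intro h
      rw [gen_iff_trace]
      have := h _ (homPerp_quotient_trace X (hT _ (gen_trace X))) (trace T X).mkQ
      rw [← Submodule.ker_mkQ (trace T X), this, LinearMap.ker_zero]
  torsionFree_iff Y := by
    constructor
    · intro hY X hX f
      rw [gen_iff_trace] at hX
      have := le_ker_of_forall_eq_zero hY f
      rw [hX, top_le_iff] at this
      exact LinearMap.ker_eq_top.1 this
    · intro h f
      exact h T gen_self f

end Trace

/-! ### Torsion classes, approximation sequences and `Ext`-projectives. -/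

section TorsionClass

variable {A : Type u} [Ring A]

/-- Classes of modules closed under factor modules and extensions. -/
structure IsTorsionClass (𝒯 : ObjectProperty (FGModuleCat.{u} A)) : Prop where
  of_surjective : ∀ {X Y : FGModuleCat.{u} A} (f : X →ₗ[A] Y), Function.Surjective f → 𝒯 X → 𝒯 Y
  of_exact : ∀ {X E Z : FGModuleCat.{u} A} (i : X →ₗ[A] E) (p : E →ₗ[A] Z),
    Function.Injective i → Function.Exact i p → Function.Surjective p → 𝒯 X → 𝒯 Z → 𝒯 E

theorem IsTorsionPair.isTorsionClass {𝒯 ℱ : ObjectProperty (FGModuleCat.{u} A)}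
    (h : IsTorsionPair 𝒯 ℱ) : IsTorsionClass 𝒯 where
  of_surjective f hf hX := by
    rw [h.torsion_iff] at *
    intro W hW g
    have := hX W hW (g ∘ₗ f)
    ext y
    obtain ⟨x, rfl⟩ := hf y
    exact LinearMap.congr_fun this x
  of_exact i p hi hip hp hX hZ := by
    rw [h.torsion_iff] at *
    intro W hW g
    obtain ⟨u, rfl⟩ := exists_factor_of_exact i p hip hp g (hX W hW _)
    rw [hZ W hW u, LinearMap.zero_comp]

variable {𝒯 : ObjectProperty (FGModuleCat.{u} A)}

theorem IsTorsionClass.prod (h : IsTorsionClass 𝒯) {X Y : FGModuleCat.{u} A} (hX : 𝒯 X)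
    (hY : 𝒯 Y) : 𝒯 (FGModuleCat.of A (X × Y)) :=
  h.of_exact (X := X) (E := FGModuleCat.of A (X × Y)) (Z := Y) (LinearMap.inl A X Y)
    (LinearMap.snd A X Y) LinearMap.inl_injective Function.Exact.inl_snd LinearMap.snd_surjective
    hX hY

theorem IsTorsionClass.pi (h : IsTorsionClass 𝒯) {X : FGModuleCat.{u} A} (hX : 𝒯 X) (n : ℕ) :
    𝒯 (FGModuleCat.of A (Fin n → X)) := by
  induction n with
  | zero =>
    exact h.of_surjective (X := X) (Y := FGModuleCat.of A (Fin 0 → X)) 0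
      (fun x => ⟨0, Subsingleton.elim _ _⟩) hX
  | succ n ih =>
    exact h.of_surjective (X := FGModuleCat.of A (X × (Fin n → X)))
      (Y := FGModuleCat.of A (Fin (n + 1) → X))
      (Fin.consLinearEquiv A (fun _ => (X : Type u))).toLinearMap (LinearEquiv.surjective _)
      (h.prod (Y := FGModuleCat.of A (Fin n → X)) hX ih)

theorem IsTorsionClass.gen_le (h : IsTorsionClass 𝒯) {X : FGModuleCat.{u} A} (hX : 𝒯 X) :
    Gen X ≤ 𝒯 := by
  rintro Y ⟨n, f, hf⟩
  exact h.of_surjective (X := FGModuleCat.of A (Fin n → X)) f hf (h.pi hX n)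

theorem extPerp_addClosure [IsNoetherianRing A] {X Y : FGModuleCat.{u} A} (hX : extPerp 𝒯 X)
    (h : addClosure X Y) : extPerp 𝒯 Y :=
  fun Z hZ => (hX Z hZ).of_addClosure h

/-- A left `𝒯`-approximation of a projective module is `Ext`-projective in `𝒯`, if its cokernel
is. -/
theorem IsTorsionClass.extPerp_of_approx [IsNoetherianRing A] (h𝒯 : IsTorsionClass 𝒯)
    {P Y X : FGModuleCat.{u} A} [Module.Projective A P] (g : P →ₗ[A] Y) (p : Y →ₗ[A] X)
    (hgp : Function.Exact g p) (hp : Function.Surjective p) (hY : 𝒯 Y) (hX : extPerp 𝒯 X)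
    (hg : ∀ Z, 𝒯 Z → ∀ h : P →ₗ[A] Z, ∃ h' : Y →ₗ[A] Z, h' ∘ₗ g = h) : extPerp 𝒯 Y := by
  intro Z hZ
  refine extOneVanishes_of_split fun W i q hi hiq hq => ?_
  have hW : 𝒯 W := h𝒯.of_exact i q hi hiq hq hZ hY
  obtain ⟨s, hs'⟩ := Module.projective_lifting_property q g hq
  obtain ⟨h, rfl⟩ := hg W hW s
  -- `q ∘ h` is the identity on the image of `g`, so its defect descends to `X`, where `Ext`
  -- vanishing lifts it to `W`; adding the lift turns `h` into a section.
  obtain ⟨u, hu⟩ := exists_factor_of_exact g p hgp hp (LinearMap.id - q ∘ₗ h) (by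
    rw [LinearMap.sub_comp, LinearMap.comp_assoc, hs', LinearMap.id_comp, sub_self])
  obtain ⟨u', rfl⟩ := (hX Z hZ).exists_lift i q hi hiq hq u
  refine ⟨h + u' ∘ₗ p, ?_⟩
  rw [LinearMap.comp_add, ← LinearMap.comp_assoc, hu]
  abel

/-- `A → Y → X → 0` is exact, `A → Y` is a left `𝒯`-approximation and `Ext¹(X, 𝒯) = 0`. -/
structure IsApproxSequence (𝒯 : ObjectProperty (FGModuleCat.{u} A)) {Y X : FGModuleCat.{u} A}
    (g : A →ₗ[A] Y) (p : Y →ₗ[A] X) : Prop where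
  exact : Function.Exact g p
  surjective : Function.Surjective p
  mem : 𝒯 Y
  ext : extPerp 𝒯 X
  approx : ∀ Z, 𝒯 Z → ∀ h : A →ₗ[A] Z, ∃ h' : Y →ₗ[A] Z, h' ∘ₗ g = h

namespace IsApproxSequence

variable {Y X : FGModuleCat.{u} A} {g : A →ₗ[A] Y} {p : Y →ₗ[A] X}

theorem approx_pi (hs : IsApproxSequence 𝒯 g p) {n : ℕ} {Z : FGModuleCat.{u} A} (hZ : 𝒯 Z)
    (h : (Fin n → A) →ₗ[A] Z) : ∃ h' : (Fin n → Y) →ₗ[A] Z, h' ∘ₗ g.compLeft (Fin n) = h := by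
  choose t ht using fun i => hs.approx Z hZ (h ∘ₗ LinearMap.single A (fun _ => A) i)
  refine ⟨∑ i, t i ∘ₗ LinearMap.proj i, ?_⟩
  ext i
  have := LinearMap.congr_fun (ht i) 1
  simp only [LinearMap.comp_apply, LinearMap.sum_apply] at this ⊢
  rw [Finset.sum_eq_single i]
  · simpa using this
  · intro j _ hj
    simp [Pi.single_eq_of_ne hj]
  · simp

/-- Push `A^n → Y^n` out along a surjection `A^n → M`. The pushout is a factor of `Y^n`, hence in
`𝒯`; the cokernel `X^n` does not change; the approximation property follows from the universal
property. -/
theorem exists_left (hs : IsApproxSequence 𝒯 g p) (h𝒯 : IsTorsionClass 𝒯)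
    (M : FGModuleCat.{u} A) :
    ∃ (n : ℕ) (L : FGModuleCat.{u} A) (l : M →ₗ[A] L) (q : L →ₗ[A] (Fin n → X)), 𝒯 L ∧
      Function.Exact l q ∧ Function.Surjective q ∧
      (∀ Z, 𝒯 Z → ∀ h : M →ₗ[A] Z, ∃ h' : L →ₗ[A] Z, h' ∘ₗ l = h) ∧
      (Function.Injective g → Function.Injective l) := by
  obtain ⟨n, π, hπ⟩ := Module.Finite.exists_fin' A M
  obtain ⟨L, l, j, h1, h2, h3, h4⟩ := exists_pushout (K := FGModuleCat.of A (Fin n → A)) (P := M)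
    (L := FGModuleCat.of A (Fin n → Y)) π (g.compLeft (Fin n))
  have h1' (x) : l (π x) = j (g.compLeft (Fin n) x) := LinearMap.congr_fun h1 x
  have hj : Function.Surjective j := by
    intro e
    obtain ⟨x, y, rfl⟩ := h2 e
    obtain ⟨z, rfl⟩ := hπ x
    exact ⟨g.compLeft (Fin n) z + y, by rw [map_add, h1']⟩
  obtain ⟨q, hq1, hq2⟩ := h4 (FGModuleCat.of A (Fin n → X)) 0 (p.compLeft (Fin n)) (by
    ext x i
    simp [hs.exact.apply_apply_eq_zero])
  have hq2' (x) : q (j x) = p.compLeft (Fin n) x := LinearMap.congr_fun hq2 x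
  refine ⟨n, L, l, q, ?_, ?_, ?_, ?_, ?_⟩
  · exact h𝒯.of_surjective j hj (h𝒯.pi hs.mem n)
  · intro e
    constructor
    · intro he
      obtain ⟨y, rfl⟩ := hj e
      rw [hq2'] at he
      choose z hz using fun i => (hs.exact (y i)).1 (congrFun he i)
      exact ⟨π z, by rw [h1']; congr 1; ext i; exact hz i⟩
    · rintro ⟨x, rfl⟩
      exact LinearMap.congr_fun hq1 x
  · intro x
    choose y hy using fun i => hs.surjective (x i)
    exact ⟨j y, by rw [hq2']; ext i; exact hy i⟩
  · intro Z hZ h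
    obtain ⟨t, ht⟩ := hs.approx_pi hZ (h ∘ₗ π)
    obtain ⟨r, hr, -⟩ := h4 Z h t ht.symm
    exact ⟨r, hr⟩
  · intro hg
    rw [injective_iff_map_eq_zero]
    intro x hx
    obtain ⟨z, rfl, hz⟩ := h3 x 0 (by rw [hx, map_zero])
    have : z = 0 := by
      ext i
      exact hg ((congrFun hz i).trans (map_zero g).symm)
    rw [this, map_zero]

variable [IsNoetherianRing A]

theorem extPerp_middle (hs : IsApproxSequence 𝒯 g p) (h𝒯 : IsTorsionClass 𝒯) : extPerp 𝒯 Y :=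
  h𝒯.extPerp_of_approx (P := FGModuleCat.of A A) g p hs.exact hs.surjective hs.mem hs.ext hs.approx

/-- Salce's trick: for `K = ker (A^n → N)`, push `0 → K → A^n → N → 0` out along the left sequence
`K → L → X^m → 0`. The middle term `E` is an extension of `N` by `L`, and also sits in an exact
sequence `A^n → E → X^m → 0`, which gives its `Ext` vanishing. -/
theorem exists_right (hs : IsApproxSequence 𝒯 g p) (h𝒯 : IsTorsionClass 𝒯)
    (N : FGModuleCat.{u} A) :
    ∃ (L E : FGModuleCat.{u} A) (j : L →ₗ[A] E) (q : E →ₗ[A] N), 𝒯 L ∧ extPerp 𝒯 E ∧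
      Function.Injective j ∧ Function.Exact j q ∧ Function.Surjective q ∧
      (𝒯 N → addClosure (FGModuleCat.of A (Y × X)) E) := by
  obtain ⟨n, π, hπ⟩ := Module.Finite.exists_fin' A N
  let P := FGModuleCat.of A (Fin n → A)
  let K := FGModuleCat.of A (LinearMap.ker π)
  let i : K →ₗ[A] P := (LinearMap.ker π).subtype
  have hi : Function.Injective i := Subtype.val_injective
  have hiπ : Function.Exact i π := LinearMap.exact_subtype_ker_map π
  obtain ⟨m, L, l, ql, hL, hlq, hql, hl, -⟩ := hs.exists_left h𝒯 K
  obtain ⟨E, a, j, q, hj, hjq, hq, hqa, h1, h2, h3⟩ :=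
    exists_pushout_extension (P := P) i π hi hiπ hπ l
  obtain ⟨z, hza, hzj⟩ := h3 (FGModuleCat.of A (Fin m → X)) 0 ql (by
    ext x : 1
    simpa using (hlq.apply_apply_eq_zero x).symm)
  have hzj' (y) : z (j y) = ql y := LinearMap.congr_fun hzj y
  have hza' (y) : z (a y) = 0 := LinearMap.congr_fun hza y
  have h1' (y) : a (i y) = j (l y) := LinearMap.congr_fun h1 y
  have haz : Function.Exact a z := by
    intro e
    constructor
    · intro he
      obtain ⟨x, y, rfl⟩ := h2 e
      rw [map_add, hza', hzj', zero_add] at he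
      obtain ⟨k, rfl⟩ := (hlq y).1 he
      exact ⟨x + i k, by rw [map_add, h1']⟩
    · rintro ⟨y, rfl⟩
      exact hza' y
  have hz : Function.Surjective z := by
    intro x
    obtain ⟨y, rfl⟩ := hql x
    exact ⟨j y, hzj' y⟩
  have hXm : extPerp 𝒯 (FGModuleCat.of A (Fin m → X)) :=
    extPerp_addClosure hs.ext (addClosure_pi m)
  refine ⟨L, E, j, q, hL, ?_, hj, hjq, hq, ?_⟩
  · intro Z hZ
    refine extOneVanishes_of_split fun W i' p' hi' hip' hp' => ?_
    obtain ⟨s, hs'⟩ := Module.projective_lifting_property (P := P) p' a hp'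
    have hsp (x) : p' (s x) = a x := LinearMap.congr_fun hs' x
    -- `W` need not lie in `𝒯`, so the approximation `l` cannot be applied to it. The preimage of
    -- `range j` in `W` contains the image of `s ∘ i`, and it is in `𝒯` as an extension of a factor
    -- of `L` by `Z`.
    obtain ⟨t, ht⟩ : ∃ t : L →ₗ[A] W, s ∘ₗ i = t ∘ₗ l := by
      let R := LinearMap.range j
      let WL : Submodule A W := R.comap p'
      have hWL : 𝒯 (FGModuleCat.of A WL) := by
        refine h𝒯.of_exact (X := Z) (E := FGModuleCat.of A WL) (Z := FGModuleCat.of A R)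
          (i'.codRestrict WL fun x => ?_) (p'.restrict fun x hx => hx) ?_ ?_ ?_ hZ ?_
        · change p' (i' x) ∈ R
          rw [hip'.apply_apply_eq_zero]
          exact R.zero_mem
        · intro x y hxy
          exact hi' (congrArg Subtype.val hxy)
        · intro w
          constructor
          · intro hw
            obtain ⟨x, hx⟩ := (hip' w.1).1 (congrArg Subtype.val hw)
            exact ⟨x, Subtype.ext hx⟩
          · rintro ⟨x, rfl⟩
            exact Subtype.ext (hip'.apply_apply_eq_zero x)
        · rintro ⟨y, hy⟩
          obtain ⟨w, rfl⟩ := hp' y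
          exact ⟨⟨w, hy⟩, rfl⟩
        · exact h𝒯.of_surjective (X := L) (Y := FGModuleCat.of A R) j.rangeRestrict
            j.surjective_rangeRestrict hL
      obtain ⟨t, ht⟩ := hl _ hWL ((s ∘ₗ i).codRestrict WL fun x => by
        change p' (s (i x)) ∈ R
        rw [hsp, h1']
        exact ⟨_, rfl⟩)
      refine ⟨WL.subtype ∘ₗ t, ?_⟩
      rw [LinearMap.comp_assoc, ht]
      rfl
    obtain ⟨r, hra, -⟩ := h3 W s t ht
    obtain ⟨u, hu⟩ := exists_factor_of_exact a z haz hz (LinearMap.id - p' ∘ₗ r) (by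
      rw [LinearMap.sub_comp, LinearMap.comp_assoc, hra, hs', LinearMap.id_comp, sub_self])
    obtain ⟨u', rfl⟩ := (hXm Z hZ).exists_lift i' p' hi' hip' hp' u
    refine ⟨r + u' ∘ₗ z, ?_⟩
    rw [LinearMap.comp_add, ← LinearMap.comp_assoc, hu]
    abel
  · intro hN
    have hE : 𝒯 E := h𝒯.of_exact j q hj hjq hq hL hN
    -- Now `E` is in `𝒯`, so `a` factors through `A^n → Y^n` by `b`, while the pushout property
    -- gives `c : E → Y^n`. As `b ∘ c ∘ a = a`, the identity of `E` is a map through `Y^n` plus a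
    -- map through `X^m`.
    obtain ⟨b, hb⟩ := hs.approx_pi hE a
    obtain ⟨t, ht⟩ := hl _ (h𝒯.pi hs.mem n) (g.compLeft (Fin n) ∘ₗ i)
    obtain ⟨c, hc, -⟩ := h3 (FGModuleCat.of A (Fin n → Y)) (g.compLeft (Fin n)) t ht.symm
    obtain ⟨u, hu⟩ := exists_factor_of_exact a z haz hz (LinearMap.id - b ∘ₗ c) (by
      rw [LinearMap.sub_comp, LinearMap.comp_assoc, hc, hb, LinearMap.id_comp, sub_self])
    have hid : (LinearMap.id : E →ₗ[A] E) = b ∘ₗ c + u ∘ₗ z := by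
      rw [hu]
      abel
    rw [addClosure_iff, hid]
    have h1 := (((factorsThrough_id_pi (T := Y) n).comp_right c).comp_left b).trans
      (addClosure_iff.1 (addClosure_prod_left (X := Y) (Y := X)))
    have h2 := (((factorsThrough_id_pi (T := X) m).comp_right z).comp_left u).trans
      (addClosure_iff.1 (addClosure_prod_right (X := Y) (Y := X)))
    exact h1.add h2

/-- If `Z` is `Ext`-projective in `𝒯`, the sequence `0 → L → E → Z → 0` of `exists_right` splits
because `L` is in `𝒯`; thus `Z` is a summand of `E`, which is in `add (Y ⊕ X)`. -/
theorem addClosure_prod_eq (hs : IsApproxSequence 𝒯 g p) (h𝒯 : IsTorsionClass 𝒯) :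
    addClosure (FGModuleCat.of A (Y × X)) = extPerp 𝒯 ⊓ 𝒯 := by
  have hX : 𝒯 X := h𝒯.of_surjective p hs.surjective hs.mem
  refine le_antisymm ?_ ?_
  · intro Z hZ
    refine ⟨fun W hW => ?_, h𝒯.gen_le (h𝒯.prod hs.mem hX) _ (gen_of_addClosure hZ)⟩
    refine ExtOneVanishes.of_addClosure (extOneVanishes_of_split fun E i q hi hiq hq => ?_) hZ
    obtain ⟨s, hs1⟩ := (hs.extPerp_middle h𝒯 W hW).exists_lift i q hi hiq hq (LinearMap.inl A Y X)
    obtain ⟨t, ht1⟩ := (hs.ext W hW).exists_lift i q hi hiq hq (LinearMap.inr A Y X)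
    refine ⟨s.coprod t, ?_⟩
    rw [LinearMap.comp_coprod, hs1, ht1]
    exact LinearMap.coprod_inl_inr
  · rintro Z ⟨hZ, hZ'⟩
    obtain ⟨L, E, j, q, hL, -, hj, hjq, hq, hE⟩ := hs.exists_right h𝒯 Z
    obtain ⟨s, hs'⟩ := (hZ L hL).exists_lift j q hj hjq hq LinearMap.id
    exact (hE hZ').trans (addClosure_of_isDirectSummand ⟨s, q, hs'⟩)

/-- A surjection `A^n → Z` onto a module of `𝒯` factors through `Y^n`, which must then surject onto
`Z`, and `Y` is in `add T`. -/
theorem gen_eq (hs : IsApproxSequence 𝒯 g p) (h𝒯 : IsTorsionClass 𝒯) {T : FGModuleCat.{u} A}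
    (hT : addClosure T = extPerp 𝒯 ⊓ 𝒯) : Gen T = 𝒯 := by
  refine le_antisymm (h𝒯.gen_le ?_) fun Z hZ => ?_
  · have : (extPerp 𝒯 ⊓ 𝒯) T := hT ▸ addClosure_self
    exact this.2
  · have hY : addClosure T Y := by
      rw [hT]
      exact ⟨hs.extPerp_middle h𝒯, hs.mem⟩
    refine (gen_of_addClosure hY).trans ?_
    obtain ⟨n, π, hπ⟩ := Module.Finite.exists_fin' A Z
    obtain ⟨h, rfl⟩ := hs.approx_pi hZ π
    exact ⟨n, h, Function.Surjective.of_comp (g := g.compLeft (Fin n)) hπ⟩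

end IsApproxSequence

end TorsionClass

end WeakCotorsion

namespace WeakCotorsion

/-! ### Silting modules and left weak cotorsion-torsion triples. -/

section Silting

variable {A : Type u} [Ring A]

/-- `Ext¹(T, Gen T) = 0`, and there is an exact sequence `A → Y → X → 0` with `Y`, `X` in `add T`
and `A → Y` a left `Gen T`-approximation. -/
structure IsSilting (T : FGModuleCat.{u} A) : Prop where
  ext : extPerp (Gen T) T
  sequence : ∃ (Y X : FGModuleCat.{u} A) (g : A →ₗ[A] Y) (p : Y →ₗ[A] X),
    addClosure T Y ∧ addClosure T X ∧ Function.Exact g p ∧ Function.Surjective p ∧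
      ∀ Z, Gen T Z → ∀ h : A →ₗ[A] Z, ∃ h' : Y →ₗ[A] Z, h' ∘ₗ g = h

theorem isStableUnderRetracts_of_isDirectSummand {𝒳 : ObjectProperty (FGModuleCat.{u} A)}
    (h : ∀ X Y : FGModuleCat.{u} A, IsDirectSummand (A := A) X Y → 𝒳 Y → 𝒳 X) :
    𝒳.IsStableUnderRetracts where
  of_retract {X Y} r hY := h X Y ⟨r.i.hom.hom, r.r.hom.hom, by
    rw [← FGModuleCat.hom_hom_comp, r.retract]
    rfl⟩ hY

theorem IsStableUnderRetracts.of_isDirectSummand {𝒳 : ObjectProperty (FGModuleCat.{u} A)}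
    (h : 𝒳.IsStableUnderRetracts) {X Y : FGModuleCat.{u} A}
    (hXY : IsDirectSummand (A := A) X Y) (hY : 𝒳 Y) : 𝒳 X := by
  obtain ⟨i, r, hir⟩ := hXY
  exact h.of_retract ⟨FGModuleCat.ofHom i, FGModuleCat.ofHom r, FGModuleCat.hom_ext hir⟩ hY

/-- If `Ext¹(M, 𝒯) = 0`, the right sequence of `M` splits, so `M` is a summand of a module of `𝒞`.
Hence `𝒯` determines the pair. -/
theorem IsLeftWeakCotorsionPair.eq_extPerp {𝒞 𝒯 : ObjectProperty (FGModuleCat.{u} A)}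
    (h : IsLeftWeakCotorsionPair 𝒞 𝒯) : 𝒞 = extPerp 𝒯 := by
  refine le_antisymm (fun X hX Y hY => h.ext_vanishes X Y hX hY) fun M hM => ?_
  obtain ⟨X, Y, i, f, hX, hY, hi, hif, hf, -⟩ := h.right_sequence M
  obtain ⟨s, hs⟩ := (hM Y hY).exists_lift i f hi hif hf LinearMap.id
  exact IsStableUnderRetracts.of_isDirectSummand h.summands_left ⟨s, f, hs⟩ hX

theorem IsLeftSequence.isApproxSequence {𝒞 𝒯 : ObjectProperty (FGModuleCat.{u} A)}
    {Y : FGModuleCat.{u} A} {g : A →ₗ[A] Y}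
    (hg : IsLeftSequence (M := FGModuleCat.of A A) 𝒞 𝒯 g) (h : 𝒞 ≤ extPerp 𝒯) :
    ∃ (X : FGModuleCat.{u} A) (p : Y →ₗ[A] X), IsApproxSequence 𝒯 g p := by
  obtain ⟨X, p, hX, hY, hgp, hp, -, happ⟩ := hg
  exact ⟨X, p, hgp, hp, hY, h X hX, happ⟩

theorem IsLwCotorsionTorsion.exists_approxSequence {t : SubcatTriple A}
    (ht : IsLwCotorsionTorsion t) :
    ∃ (Y X : FGModuleCat.{u} A) (g : A →ₗ[A] Y) (p : Y →ₗ[A] X), IsApproxSequence t.T g p := by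
  obtain ⟨Y, g, hg⟩ := ht.1.left_sequence (FGModuleCat.of A A)
  obtain ⟨X, p, hs⟩ := hg.isApproxSequence ht.1.eq_extPerp.le
  exact ⟨Y, X, g, p, hs⟩

variable [IsNoetherianRing A]

theorem isTorsionClass_gen {T : FGModuleCat.{u} A} (hT : extPerp (Gen T) T) :
    IsTorsionClass (Gen T) :=
  (isTorsionPair_gen hT).isTorsionClass

namespace IsSilting

variable {T : FGModuleCat.{u} A}

theorem exists_approxSequence (hT : IsSilting T) :
    ∃ (Y X : FGModuleCat.{u} A) (g : A →ₗ[A] Y) (p : Y →ₗ[A] X),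
      addClosure T Y ∧ addClosure T X ∧ IsApproxSequence (Gen T) g p := by
  obtain ⟨Y, X, g, p, hY, hX, hgp, hp, hg⟩ := hT.sequence
  exact ⟨Y, X, g, p, hY, hX, hgp, hp, gen_of_addClosure hY, extPerp_addClosure hT.ext hX, hg⟩

/-- `add T` lies between `add (Y ⊕ X)` and the `Ext`-projectives of `Gen T`, which coincide by
`addClosure_prod_eq`. -/
theorem addClosure_eq (hT : IsSilting T) : addClosure T = extPerp (Gen T) ⊓ Gen T := by
  obtain ⟨Y, X, g, p, hY, hX, hs⟩ := hT.exists_approxSequence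
  refine le_antisymm (fun Z hZ => ⟨extPerp_addClosure hT.ext hZ, gen_of_addClosure hZ⟩) ?_
  rw [← hs.addClosure_prod_eq (isTorsionClass_gen hT.ext)]
  exact addClosure_le (hY.prod hX)

end IsSilting

namespace IsApproxSequence

variable {𝒯 : ObjectProperty (FGModuleCat.{u} A)} {Y X : FGModuleCat.{u} A} {g : A →ₗ[A] Y}
  {p : Y →ₗ[A] X}

theorem isSilting (hs : IsApproxSequence 𝒯 g p) (h𝒯 : IsTorsionClass 𝒯) {T : FGModuleCat.{u} A}
    (hT : addClosure T = extPerp 𝒯 ⊓ 𝒯) : IsSilting T where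
  ext := by
    have : (extPerp 𝒯 ⊓ 𝒯) T := hT ▸ addClosure_self
    rw [hs.gen_eq h𝒯 hT]
    exact this.1
  sequence := by
    refine ⟨Y, X, g, p, ?_, ?_, hs.exact, hs.surjective, ?_⟩
    · rw [hT]
      exact ⟨hs.extPerp_middle h𝒯, hs.mem⟩
    · rw [hT]
      exact ⟨hs.ext, h𝒯.of_surjective p hs.surjective hs.mem⟩
    · rw [hs.gen_eq h𝒯 hT]
      exact hs.approx

theorem exists_leftSequence (hs : IsApproxSequence 𝒯 g p) (h𝒯 : IsTorsionClass 𝒯)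
    (M : FGModuleCat.{u} A) :
    ∃ (L : FGModuleCat.{u} A) (l : M →ₗ[A] L), IsLeftSequence (extPerp 𝒯) 𝒯 l ∧
      (Function.Injective g → Function.Injective l) := by
  obtain ⟨n, L, l, q, hL, hlq, hq, hl, hinj⟩ := hs.exists_left h𝒯 M
  exact ⟨L, l, ⟨FGModuleCat.of A (Fin n → X), q, extPerp_addClosure hs.ext (addClosure_pi n), hL,
    hlq, hq, hL, hl⟩, hinj⟩

theorem isLeftWeakCotorsionPair (hs : IsApproxSequence 𝒯 g p) (h𝒯 : IsTorsionClass 𝒯) :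
    IsLeftWeakCotorsionPair (extPerp 𝒯) 𝒯 where
  summands_left := isStableUnderRetracts_of_isDirectSummand fun X Y h hY =>
    extPerp_addClosure hY (addClosure_of_isDirectSummand h)
  summands_right := isStableUnderRetracts_of_isDirectSummand fun X Y h hY =>
    h𝒯.gen_le hY _ (gen_of_addClosure (addClosure_of_isDirectSummand h))
  ext_vanishes X Y hX hY := hX Y hY
  right_sequence M := by
    obtain ⟨L, E, j, q, hL, hE, hj, hjq, hq, -⟩ := hs.exists_right h𝒯 M
    exact ⟨E, L, j, q, hE, hL, hj, hjq, hq, hE, fun X' hX' h =>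
      (hX' L hL).exists_lift j q hj hjq hq h⟩
  left_sequence M := by
    obtain ⟨L, l, hl, -⟩ := hs.exists_leftSequence h𝒯 M
    exact ⟨L, l, hl⟩

theorem isCotorsionPair (hs : IsApproxSequence 𝒯 g p) (h𝒯 : IsTorsionClass 𝒯)
    (hg : Function.Injective g) : IsCotorsionPair (extPerp 𝒯) 𝒯 where
  toIsLeftWeakCotorsionPair := hs.isLeftWeakCotorsionPair h𝒯
  left_sequence_injective M := by
    obtain ⟨L, l, hl, hinj⟩ := hs.exists_leftSequence h𝒯 M
    exact ⟨L, l, hl, hinj hg⟩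

end IsApproxSequence

theorem IsSilting.isLwCotorsionTorsion {T : FGModuleCat.{u} A} (hT : IsSilting T) :
    IsLwCotorsionTorsion (tripleOf T) := by
  obtain ⟨Y, X, g, p, -, -, hs⟩ := hT.exists_approxSequence
  exact ⟨hs.isLeftWeakCotorsionPair (isTorsionClass_gen hT.ext), isTorsionPair_gen hT.ext⟩

namespace IsLwCotorsionTorsion

variable {t : SubcatTriple A}

theorem exists_addClosure_eq (ht : IsLwCotorsionTorsion t) :
    ∃ T : FGModuleCat.{u} A, addClosure T = t.C ⊓ t.T := by
  obtain ⟨Y, X, g, p, hs⟩ := ht.exists_approxSequence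
  exact ⟨_, by rw [hs.addClosure_prod_eq ht.2.isTorsionClass, ht.1.eq_extPerp]⟩

theorem isSilting (ht : IsLwCotorsionTorsion t) {T : FGModuleCat.{u} A}
    (hT : addClosure T = t.C ⊓ t.T) : IsSilting T := by
  obtain ⟨Y, X, g, p, hs⟩ := ht.exists_approxSequence
  rw [ht.1.eq_extPerp] at hT
  exact hs.isSilting ht.2.isTorsionClass hT

theorem tripleOf_eq (ht : IsLwCotorsionTorsion t) {T : FGModuleCat.{u} A}
    (hT : addClosure T = t.C ⊓ t.T) : tripleOf T = t := by
  obtain ⟨Y, X, g, p, hs⟩ := ht.exists_approxSequence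
  have hC := ht.1.eq_extPerp
  have hG : Gen T = t.T := hs.gen_eq ht.2.isTorsionClass (by rw [← hC, hT])
  have hS := ht.isSilting hT
  refine SubcatTriple.ext ?_ hG ?_
  · change extPerp (Gen T) = t.C
    rw [hG, hC]
  · refine funext fun Z => propext ?_
    change homPerp T Z ↔ t.F Z
    rw [(isTorsionPair_gen hS.ext).torsionFree_iff, ht.2.torsionFree_iff, hG]

end IsLwCotorsionTorsion

end Silting

/-! ### Tilting modules and cotorsion pairs. -/

section Tilting

variable {A : Type u} [Ring A] [IsNoetherianRing A] {T : FGModuleCat.{u} A}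

theorem ExtOneVanishes.pi {X Y : FGModuleCat.{u} A} (h : ExtOneVanishes X Y) (n : ℕ) :
    ExtOneVanishes X (FGModuleCat.of A (Fin n → Y)) := by
  obtain ⟨m, π, hπ⟩ := Module.Finite.exists_fin' A X
  let P := FGModuleCat.of A (Fin m → A)
  let K := FGModuleCat.of A (LinearMap.ker π)
  let i : K →ₗ[A] P := (LinearMap.ker π).subtype
  have hi : Function.Injective i := Subtype.val_injective
  have hiπ : Function.Exact i π := LinearMap.exact_subtype_ker_map π
  refine extOneVanishes_of_extend (K := K) (P := P) i π hi hiπ hπ fun f => ?_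
  choose g hg using fun j => h.exists_extend (E := P) i π hi hiπ hπ (LinearMap.proj j ∘ₗ f)
  refine ⟨LinearMap.pi g, ?_⟩
  ext x j
  exact LinearMap.congr_fun (hg j) x

theorem IsTilting.extPerp_gen (hT : IsTilting T) : extPerp (Gen T) T := by
  rintro X ⟨n, f, hf⟩
  exact (hT.ext_self.pi n).of_surjective hT.projectiveDimension_le_one f hf

theorem IsTilting.exists_approxSequence (hT : IsTilting T) :
    ∃ (Y X : FGModuleCat.{u} A) (g : A →ₗ[A] Y) (p : Y →ₗ[A] X), addClosure T Y ∧
      addClosure T X ∧ IsApproxSequence (Gen T) g p ∧ Function.Injective g := by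
  obtain ⟨Y, X, g, p, hY, hX, hg, hgp, hp⟩ := hT.coresolution
  have hext : extPerp (Gen T) X := extPerp_addClosure hT.extPerp_gen hX
  exact ⟨Y, X, g, p, hY, hX, ⟨hgp, hp, gen_of_addClosure hY, hext, fun Z hZ h =>
    (hext Z hZ).exists_extend (K := FGModuleCat.of A A) g p hg hgp hp h⟩, hg⟩

theorem IsTilting.isSilting (hT : IsTilting T) : IsSilting T := by
  obtain ⟨Y, X, g, p, hY, hX, hs, -⟩ := hT.exists_approxSequence
  exact ⟨hT.extPerp_gen, Y, X, g, p, hY, hX, hs.exact, hs.surjective, hs.approx⟩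

theorem IsTilting.isCotorsionTorsion (hT : IsTilting T) : IsCotorsionTorsion (tripleOf T) := by
  obtain ⟨Y, X, g, p, hY, hX, hs, hg⟩ := hT.exists_approxSequence
  exact ⟨hs.isCotorsionPair (isTorsionClass_gen hT.extPerp_gen) hg,
    isTorsionPair_gen hT.extPerp_gen⟩

/-- If every module embeds into a module in `𝒯`, then `Ext¹(T, 𝒯) = 0` implies `pd T ≤ 1`. -/
theorem hasProjectiveDimensionLE_one_of_extPerp {𝒯 : ObjectProperty (FGModuleCat.{u} A)}
    (h𝒯 : IsTorsionClass 𝒯) (hT : extPerp 𝒯 T)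
    (h : ∀ M : FGModuleCat.{u} A, ∃ (Z : FGModuleCat.{u} A) (g : M →ₗ[A] Z), 𝒯 Z ∧
      Function.Injective g) : HasProjectiveDimensionLE T.obj 1 := by
  obtain ⟨n, π, hπ⟩ := Module.Finite.exists_fin' A T
  let P := FGModuleCat.of A (Fin n → A)
  let K := FGModuleCat.of A (LinearMap.ker π)
  let i : K →ₗ[A] P := (LinearMap.ker π).subtype
  have hi : Function.Injective i := Subtype.val_injective
  have hiπ : Function.Exact i π := LinearMap.exact_subtype_ker_map π
  -- The goal is that the syzygy `K` is projective. A free module `Q` covering it is embedded into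
  -- `Z` in `𝒯`. Modulo `U = g (ker ρ)` the embedding descends to `K → Z / U`, which extends to `P`
  -- because `Z / U` is in `𝒯`, and then lifts to `s : P → Z`.
  obtain ⟨m, ρ, hρ⟩ := Module.Finite.exists_fin' A K
  let Q := FGModuleCat.of A (Fin m → A)
  obtain ⟨Z, g, hZ, hg⟩ := h Q
  let U : Submodule A Z := (LinearMap.ker ρ).map g
  have hZU : 𝒯 (FGModuleCat.of A (Z ⧸ U)) :=
    h𝒯.of_surjective (Y := FGModuleCat.of A (Z ⧸ U)) U.mkQ U.mkQ_surjective hZ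
  obtain ⟨c, hc⟩ := exists_factor_of_exact (LinearMap.ker ρ).subtype ρ
    (LinearMap.exact_subtype_ker_map ρ) hρ (U.mkQ ∘ₗ g) (by
      ext x
      exact (Submodule.Quotient.mk_eq_zero _).2 ⟨x, x.2, rfl⟩)
  obtain ⟨b, hb⟩ := (hT _ hZU).exists_extend (E := P) i π hi hiπ hπ c
  obtain ⟨s, hs⟩ := Module.projective_lifting_property (P := P) U.mkQ b U.mkQ_surjective
  -- On `K` the map `s` agrees with `g` modulo `g (ker ρ)`, so `s (i x)` has a preimage under `g`
  -- lying over `x`. It is unique since `g` is injective, which makes the section of `ρ` linear.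
  have hsec : ∀ x : K, ∃ y : Q, g y = s (i x) ∧ ρ y = x := by
    intro x
    obtain ⟨y, rfl⟩ := hρ x
    have h1 : U.mkQ (s (i (ρ y))) = U.mkQ (g y) := by
      have e1 := LinearMap.congr_fun hs (i (ρ y))
      have e2 := LinearMap.congr_fun hb (ρ y)
      have e3 := LinearMap.congr_fun hc y
      simp only [LinearMap.comp_apply] at e1 e2 e3
      rw [e1, e2, e3]
    obtain ⟨w, hw, hw'⟩ := (Submodule.Quotient.eq U).1 h1
    refine ⟨w + y, ?_, ?_⟩
    · rw [map_add, hw']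
      abel
    · rw [map_add, show ρ w = 0 from hw, zero_add]
  choose σ hσ1 hσ2 using hsec
  have : Module.Projective A K := by
    refine Module.Projective.of_split (M := Q)
      { toFun := σ
        map_add' := fun x y => hg (by rw [map_add, hσ1, hσ1, hσ1, map_add, map_add])
        map_smul' := fun r x => hg (by
          rw [RingHom.id_apply, map_smul, hσ1, hσ1, map_smul, map_smul]) } ρ ?_
    ext x : 1
    exact hσ2 x
  exact hasProjectiveDimensionLE_one (P := P) (K := K) i π hi hiπ hπ

theorem IsCotorsionTorsion.isTilting {t : SubcatTriple A} (ht : IsCotorsionTorsion t)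
    (hT : addClosure T = t.C ⊓ t.T) : IsTilting T := by
  have hC := ht.1.toIsLeftWeakCotorsionPair.eq_extPerp
  have hmem : (t.C ⊓ t.T) T := hT ▸ addClosure_self
  have h𝒯 := ht.2.isTorsionClass
  obtain ⟨Y, g, hg, hginj⟩ := ht.1.left_sequence_injective (FGModuleCat.of A A)
  obtain ⟨X, p, hs⟩ := hg.isApproxSequence hC.le
  refine ⟨?_, ht.1.ext_vanishes T T hmem.1 hmem.2, Y, X, g, p, ?_, ?_, hginj, hs.exact,
    hs.surjective⟩
  · refine hasProjectiveDimensionLE_one_of_extPerp h𝒯 (hC ▸ hmem.1) fun M => ?_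
    obtain ⟨Z, f, ⟨W, q, -, hZ, -⟩, hf⟩ := ht.1.left_sequence_injective M
    exact ⟨Z, f, hZ, hf⟩
  · rw [hT, hC]
    exact ⟨hs.extPerp_middle h𝒯, hs.mem⟩
  · rw [hT, hC]
    exact ⟨hs.ext, h𝒯.of_surjective p hs.surjective hs.mem⟩

end Tilting

end WeakCotorsion

namespace WeakCotorsion

/-! ### Krull–Schmidt theory and basic modules. -/

section KrullSchmidt

variable {A : Type u} [Ring A]

theorem isoClass_eq_iff {X Y : FGModuleCat.{u} A} :
    isoClass X = isoClass Y ↔ Nonempty (X ≃ₗ[A] Y) := by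
  constructor
  · intro h
    obtain ⟨i⟩ := Quotient.exact h
    exact ⟨FGModuleCat.isoToLinearEquiv i⟩
  · rintro ⟨e⟩
    exact Quotient.sound ⟨e.toFGModuleCatIso⟩

/-- After scaling the sum to 1, if the first term is nilpotent then the second is 1 minus a
nilpotent element. -/
theorem isUnit_or_isUnit_of_isUnit_add {R : Type*} [Ring R]
    (h : ∀ a : R, IsNilpotent a ∨ IsUnit a) {a b : R} (hab : IsUnit (a + b)) :
    IsUnit a ∨ IsUnit b := by
  obtain ⟨w, hw⟩ := hab
  have key : (↑w⁻¹ : R) * b = 1 - ↑w⁻¹ * a := by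
    rw [eq_sub_iff_add_eq, ← mul_add, add_comm, ← hw, Units.inv_mul]
  rcases h (↑w⁻¹ * a) with h1 | h1
  · right
    have := h1.isUnit_one_sub
    rw [← key] at this
    exact (Units.isUnit_units_mul _ _).1 this
  · left
    exact (Units.isUnit_units_mul _ _).1 h1

theorem exists_isUnit_of_isUnit_sum {R : Type*} [Ring R] [Nontrivial R]
    (h : ∀ a : R, IsNilpotent a ∨ IsUnit a) {ι : Type*} (s : Finset ι) {a : ι → R}
    (ha : IsUnit (∑ i ∈ s, a i)) : ∃ i ∈ s, IsUnit (a i) := by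
  classical
  induction s using Finset.induction_on with
  | empty => simp at ha
  | insert i s hi ih =>
    rw [Finset.sum_insert hi] at ha
    rcases isUnit_or_isUnit_of_isUnit_add h ha with h1 | h1
    · exact ⟨i, Finset.mem_insert_self _ _, h1⟩
    · obtain ⟨j, hj, hj'⟩ := ih h1
      exact ⟨j, Finset.mem_insert_of_mem hj, hj'⟩

theorem addClosure_of_equiv_pi {T M : FGModuleCat.{u} A} {ι : Type*} [Fintype ι]
    {X : ι → FGModuleCat.{u} A} (e : M ≃ₗ[A] ∀ i, X i) (h : ∀ i, addClosure T (X i)) :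
    addClosure T M := by
  classical
  rw [addClosure_iff]
  have : (LinearMap.id : M →ₗ[A] M) = ∑ i, (e.symm.toLinearMap ∘ₗ
      LinearMap.single A (fun i => (X i : Type u)) i) ∘ₗ LinearMap.id ∘ₗ
      (LinearMap.proj i ∘ₗ e.toLinearMap) := by
    ext x
    apply e.injective
    simp only [LinearMap.sum_apply, map_sum, LinearMap.comp_apply, LinearMap.id_apply,
      LinearEquiv.coe_coe, LinearEquiv.apply_symm_apply]
    ext j
    simp
  rw [this]
  exact FactorsThrough.sum _ fun i _ => ((addClosure_iff.1 (h i)).comp_right _).comp_left _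

theorem addClosure_apply_of_equiv_pi {M : FGModuleCat.{u} A} {ι : Type*}
    {X : ι → FGModuleCat.{u} A} (e : M ≃ₗ[A] ∀ i, X i) (i : ι) : addClosure M (X i) := by
  classical
  refine addClosure_of_isDirectSummand ⟨e.symm.toLinearMap ∘ₗ
      LinearMap.single A (fun i => (X i : Type u)) i, LinearMap.proj i ∘ₗ e.toLinearMap, ?_⟩
  ext x
  simp

theorem isDirectSummand_of_isUnit {X Y : Type*} [AddCommGroup X] [Module A X] [AddCommGroup Y]
    [Module A Y] (a : X →ₗ[A] Y) (b : Y →ₗ[A] X) (h : IsUnit (b ∘ₗ a : Module.End A X)) :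
    IsDirectSummand (A := A) X Y := by
  obtain ⟨w, hw⟩ := h
  refine ⟨a, (↑w⁻¹ : Module.End A X) ∘ₗ b, ?_⟩
  rw [LinearMap.comp_assoc, ← hw]
  exact w.inv_mul

variable [IsArtinianRing A]

/-- Fitting's lemma: `M` is the direct sum of the kernel and the image of a high power of `f`, and
one of the two is zero. -/
theorem IsIndecomposable.isNilpotent_or_isUnit {M : FGModuleCat.{u} A} (hM : IsIndecomposable M)
    (f : Module.End A M) : IsNilpotent f ∨ IsUnit f := by
  obtain ⟨n, hn, hn1⟩ := ((f.eventually_isCompl_ker_pow_range_pow).and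
    (Filter.eventually_ge_atTop 1)).exists
  rcases hM.2 _ _ hn with h | h
  · right
    rw [Module.End.isUnit_iff]
    have hinj : Function.Injective (f ^ n) := LinearMap.ker_eq_bot.1 h
    obtain ⟨m, rfl⟩ : ∃ m, n = m + 1 := ⟨n - 1, by omega⟩
    rw [pow_succ] at hinj
    have hf : Function.Injective f := Function.Injective.of_comp (f := ⇑(f ^ m)) hinj
    exact ⟨hf, IsArtinian.surjective_of_injective_endomorphism f hf⟩
  · left
    exact ⟨n, LinearMap.range_eq_bot.1 h⟩

theorem IsIndecomposable.exists_isUnit {M : FGModuleCat.{u} A} (hM : IsIndecomposable M)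
    {ι : Type*} (s : Finset ι) (f : ι → Module.End A M)
    (hf : ∑ i ∈ s, f i = LinearMap.id) : ∃ i ∈ s, IsUnit (f i) := by
  have := hM.1
  refine exists_isUnit_of_isUnit_sum hM.isNilpotent_or_isUnit s ?_
  rw [hf]
  exact isUnit_one

/-- The identity of `X` is a sum of endomorphisms factoring through `T` itself; the endomorphism
ring is local, so one of them is invertible. -/
theorem IsIndecomposable.isDirectSummand {X T : FGModuleCat.{u} A} (hX : IsIndecomposable X)
    (h : addClosure T X) : IsDirectSummand (A := A) X T := by
  obtain ⟨n, a, b, hab⟩ := addClosure_iff.1 h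
  obtain ⟨i, -, hi⟩ := hX.exists_isUnit Finset.univ (fun i => b i ∘ₗ a i) hab.symm
  exact isDirectSummand_of_isUnit _ _ hi

theorem IsIndecomposable.exists_isDirectSummand_pi {X : FGModuleCat.{u} A}
    (hX : IsIndecomposable X) {ι : Type*} [Fintype ι] {Y : ι → FGModuleCat.{u} A}
    (h : IsDirectSummand (A := A) X (∀ i, Y i)) : ∃ i, IsDirectSummand (A := A) X (Y i) := by
  classical
  obtain ⟨a, b, hab⟩ := h
  obtain ⟨i, -, hi⟩ := hX.exists_isUnit Finset.univ (fun i =>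
    (b ∘ₗ LinearMap.single A (fun i => (Y i : Type u)) i) ∘ₗ (LinearMap.proj i ∘ₗ a)) (by
      rw [← hab]
      ext x
      simp only [LinearMap.sum_apply, LinearMap.comp_apply, ← map_sum]
      congr 1
      ext j
      simp)
  exact ⟨i, isDirectSummand_of_isUnit _ _ hi⟩

/-- The idempotent `i ∘ r` of `Y` is not nilpotent, as `X` is nonzero, so it is invertible and `i`
is bijective. -/
theorem IsIndecomposable.nonempty_equiv {X Y : FGModuleCat.{u} A} (hX : IsIndecomposable X)
    (hY : IsIndecomposable Y) (h : IsDirectSummand (A := A) X Y) : Nonempty (X ≃ₗ[A] Y) := by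
  obtain ⟨i, r, hri⟩ := h
  have hri' (x) : r (i x) = x := LinearMap.congr_fun hri x
  have hidem : ∀ n : ℕ, ((i ∘ₗ r : Module.End A Y) ^ n) ∘ₗ i = i := by
    intro n
    induction n with
    | zero => rfl
    | succ n ih =>
      rw [pow_succ]
      ext x
      simp only [LinearMap.comp_apply, Module.End.mul_apply, hri']
      exact LinearMap.congr_fun ih x
  rcases hY.isNilpotent_or_isUnit (i ∘ₗ r) with ⟨n, hn⟩ | h
  · exfalso
    have := hX.1
    obtain ⟨x, hx⟩ := exists_ne (0 : X)
    have h1 := hidem n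
    rw [hn, LinearMap.zero_comp] at h1
    apply hx
    rw [← hri' x, ← h1, LinearMap.zero_apply, map_zero]
  · rw [Module.End.isUnit_iff] at h
    refine ⟨LinearEquiv.ofBijective i ⟨fun x y hxy => ?_, fun y => ?_⟩⟩
    · rw [← hri' x, hxy, hri']
    · obtain ⟨z, hz⟩ := h.2 y
      exact ⟨r z, hz⟩

theorem IsIndecomposable.exists_equiv {X M : FGModuleCat.{u} A}
    (hX : IsIndecomposable X) {ι : Type*} [Fintype ι] {Y : ι → FGModuleCat.{u} A}
    (hY : ∀ i, IsIndecomposable (Y i)) (e : M ≃ₗ[A] ∀ i, Y i)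
    (h : addClosure M X) : ∃ i, Nonempty (X ≃ₗ[A] Y i) := by
  obtain ⟨a, b, hab⟩ := hX.isDirectSummand h
  obtain ⟨i, hi⟩ := hX.exists_isDirectSummand_pi (Y := Y)
    ⟨e.toLinearMap ∘ₗ a, b ∘ₗ e.symm.toLinearMap, by
      rw [← hab]
      ext x
      simp⟩
  exact ⟨i, hX.nonempty_equiv (hY i) hi⟩

theorem exists_indecomposable_decomposition (M : FGModuleCat.{u} A) :
    ∃ (ι : Type) (_ : Fintype ι) (X : ι → FGModuleCat.{u} A), (∀ i, IsIndecomposable (X i)) ∧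
      Nonempty (M ≃ₗ[A] ∀ i, X i) := by
  -- Inducting over submodules of the fixed module `M` makes the descending chain condition on its
  -- lattice available.
  suffices H : ∀ N : Submodule A M, ∃ (ι : Type) (_ : Fintype ι) (X : ι → FGModuleCat.{u} A),
      (∀ i, IsIndecomposable (X i)) ∧ Nonempty (N ≃ₗ[A] ∀ i, X i) by
    obtain ⟨ι, hι, X, hX, ⟨e⟩⟩ := H ⊤
    exact ⟨ι, hι, X, hX, ⟨Submodule.topEquiv.symm ≪≫ₗ e⟩⟩
  intro N
  induction N using WellFoundedLT.induction with
  | ind N ih =>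
  by_cases hN : Nontrivial N
  · by_cases hind : ∀ P Q : Submodule A N, IsCompl P Q → P = ⊥ ∨ Q = ⊥
    · refine ⟨Unit, inferInstance, fun _ => FGModuleCat.of A N, fun _ => ⟨hN, hind⟩, ?_⟩
      exact ⟨(LinearEquiv.funUnique Unit A N).symm⟩
    · push Not at hind
      obtain ⟨P, Q, hPQ, hP, hQ⟩ := hind
      have hlt : ∀ P Q : Submodule A N, IsCompl P Q → Q ≠ ⊥ → P.map N.subtype < N := by
        intro P Q hPQ hQ
        refine lt_of_le_of_ne (Submodule.map_subtype_le _ _) fun h => hQ ?_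
        have hP : P = ⊤ := by
          rw [eq_top_iff]
          rintro x -
          obtain ⟨y, hy, hyx⟩ := h.ge x.2
          rwa [← Subtype.ext hyx]
        have := hPQ.inf_eq_bot
        rwa [hP, top_inf_eq] at this
      obtain ⟨ι, hι, X, hX, ⟨e⟩⟩ := ih _ (hlt P Q hPQ hQ)
      obtain ⟨κ, hκ, Y, hY, ⟨e'⟩⟩ := ih _ (hlt Q P hPQ.symm hP)
      refine ⟨ι ⊕ κ, inferInstance, Sum.elim X Y, ?_, ⟨?_⟩⟩
      · rintro (i | i)
        · exact hX i
        · exact hY i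
      · refine (Submodule.prodEquivOfIsCompl P Q hPQ).symm ≪≫ₗ
          (LinearEquiv.prodCongr ((Submodule.equivMapOfInjective _ N.injective_subtype P) ≪≫ₗ e)
            ((Submodule.equivMapOfInjective _ N.injective_subtype Q) ≪≫ₗ e')) ≪≫ₗ
          (LinearEquiv.sumPiEquivProdPi A ι κ
            (fun i => (Sum.elim X Y i : FGModuleCat.{u} A))).symm
  · rw [not_nontrivial_iff_subsingleton] at hN
    refine ⟨Empty, inferInstance, Empty.elim, fun i => i.elim, ⟨?_⟩⟩
    exact { toFun := 0, map_add' := by simp, map_smul' := by simp, invFun := 0,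
            left_inv := fun _ => Subsingleton.elim _ _,
            right_inv := fun _ => Subsingleton.elim _ _ }

/-- Every module has the same additive closure as a basic module. -/
theorem exists_isBasic_addClosure_eq (M : FGModuleCat.{u} A) :
    ∃ T : FGModuleCat.{u} A, IsBasic T ∧ addClosure T = addClosure M := by
  classical
  obtain ⟨ι, hι, X, hX, ⟨e⟩⟩ := exists_indecomposable_decomposition M
  let s : Setoid ι := ⟨fun i j => Nonempty (X i ≃ₗ[A] X j), fun i => ⟨LinearEquiv.refl _ _⟩,
    fun ⟨f⟩ => ⟨f.symm⟩, fun ⟨f⟩ ⟨g⟩ => ⟨f ≪≫ₗ g⟩⟩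
  let Y : Fin (Fintype.card (Quotient s)) → FGModuleCat.{u} A := fun a =>
    X ((Fintype.equivFin (Quotient s)).symm a).out
  let T := FGModuleCat.of A (∀ a, Y a)
  refine ⟨T, ⟨_, Y, fun a => hX _, fun a b hab => ?_, ⟨LinearEquiv.refl A T⟩⟩,
    le_antisymm (addClosure_le ?_) (addClosure_le ?_)⟩
  · have : (⟦((Fintype.equivFin (Quotient s)).symm a).out⟧ : Quotient s) =
        ⟦((Fintype.equivFin (Quotient s)).symm b).out⟧ := Quotient.sound hab
    rw [Quotient.out_eq, Quotient.out_eq] at this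
    exact (Fintype.equivFin (Quotient s)).symm.injective this
  · exact addClosure_of_equiv_pi (LinearEquiv.refl A T) fun a => addClosure_apply_of_equiv_pi e _
  · refine addClosure_of_equiv_pi e fun i => ?_
    have h1 := addClosure_apply_of_equiv_pi (X := Y) (LinearEquiv.refl A T)
      (Fintype.equivFin (Quotient s) ⟦i⟧)
    have h2 : Nonempty (Y (Fintype.equivFin (Quotient s) ⟦i⟧) ≃ₗ[A] X i) := by
      have : ∀ q : Quotient s, q = ⟦i⟧ → Nonempty (X q.out ≃ₗ[A] X i) := by
        rintro _ rfl
        exact Quotient.mk_out i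
      exact this _ (Equiv.symm_apply_apply _ _)
    exact h1.trans (addClosure_of_equiv h2.some)

/-- Basic modules are determined by their additive closures. -/
theorem IsBasic.nonempty_equiv {T T' : FGModuleCat.{u} A} (hT : IsBasic T) (hT' : IsBasic T')
    (h : addClosure T = addClosure T') : Nonempty (T ≃ₗ[A] T') := by
  obtain ⟨n, X, hX, hXi, ⟨e⟩⟩ := hT
  obtain ⟨m, Y, hY, hYi, ⟨f⟩⟩ := hT'
  choose σ hσ using fun i => (hX i).exists_equiv hY f (h ▸ addClosure_apply_of_equiv_pi e i)
  choose τ hτ using fun j => (hY j).exists_equiv hX e (h ▸ addClosure_apply_of_equiv_pi f j)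
  let w : Fin n ≃ Fin m :=
    { toFun := σ
      invFun := τ
      left_inv := fun i => (hXi _ _ ⟨(hσ i).some ≪≫ₗ (hτ (σ i)).some⟩).symm
      right_inv := fun j => (hYi _ _ ⟨(hτ j).some ≪≫ₗ (hσ (τ j)).some⟩).symm }
  exact ⟨e ≪≫ₗ LinearEquiv.piCongrRight (fun i => (hσ i).some) ≪≫ₗ
    LinearEquiv.piCongrLeft A (fun j => (Y j : Type u)) w ≪≫ₗ f.symm⟩

theorem exists_indecomposable_representatives (M : FGModuleCat.{u} A) :
    ∃ (m : ℕ) (X : Fin m → FGModuleCat.{u} A), (∀ i, IsIndecomposable (X i)) ∧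
      (∀ i j, Nonempty (X i ≃ₗ[A] X j) → i = j) ∧ (∀ i, addClosure M (X i)) ∧
      (∀ Y, IsIndecomposable Y → addClosure M Y → ∃ i, Nonempty (Y ≃ₗ[A] X i)) ∧
      numIndecomposableSummands M = m := by
  obtain ⟨T, ⟨m, X, hX, hXi, ⟨e⟩⟩, hTM⟩ := exists_isBasic_addClosure_eq M
  have h1 : ∀ i, addClosure M (X i) := fun i => hTM ▸ addClosure_apply_of_equiv_pi e i
  have h2 : ∀ Y, IsIndecomposable Y → addClosure M Y → ∃ i, Nonempty (Y ≃ₗ[A] X i) :=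
    fun Y hY h => hY.exists_equiv hX e (hTM ▸ h)
  refine ⟨m, X, hX, hXi, h1, h2, ?_⟩
  have hset : {c : IsoClass A | ∃ X : FGModuleCat.{u} A, isoClass X = c ∧ IsIndecomposable X ∧
      IsDirectSummand (A := A) X M} = Set.range fun i => isoClass (X i) := by
    ext c
    constructor
    · rintro ⟨Y, rfl, hY, hYM⟩
      obtain ⟨i, ⟨f⟩⟩ := h2 Y hY (addClosure_of_isDirectSummand hYM)
      exact ⟨i, isoClass_eq_iff.2 ⟨f.symm⟩⟩
    · rintro ⟨i, rfl⟩
      exact ⟨X i, rfl, hX i, (hX i).isDirectSummand (h1 i)⟩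
  rw [numIndecomposableSummands, hset, ← Set.image_univ,
    Function.Injective.encard_image fun i j hij => hXi i j (isoClass_eq_iff.1 hij)]
  simp

end KrullSchmidt

end WeakCotorsion

namespace WeakCotorsion

/-! ### Extending maps along a projective presentation. -/

section HomSurjective

variable {A : Type u} [Ring A]

/-- Every map from `P₁` to `X` extends along `d : P₁ → P₀`. -/
def HomSurjective {P₁ P₀ : Type*} [AddCommGroup P₁] [Module A P₁] [AddCommGroup P₀] [Module A P₀]
    (d : P₁ →ₗ[A] P₀) (X : Type*) [AddCommGroup X] [Module A X] : Prop :=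
  ∀ h : P₁ →ₗ[A] X, ∃ g : P₀ →ₗ[A] X, g ∘ₗ d = h

/-- A map from `ker π`, pulled back to `P₁`, extends to `P₀`; as `P₁` surjects onto `ker π`, the
extension restricts to the original map. -/
theorem HomSurjective.extOneVanishes [IsNoetherianRing A]
    {P₁ P₀ : FGModuleCat.{u} A} [Module.Projective A P₀] {d : P₁ →ₗ[A] P₀} {M Y : FGModuleCat.{u} A}
    {π : P₀ →ₗ[A] M} (hdπ : Function.Exact d π) (hπ : Function.Surjective π)
    (hY : HomSurjective d Y) : ExtOneVanishes M Y := by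
  let K := FGModuleCat.of A (LinearMap.ker π)
  let i : K →ₗ[A] P₀ := (LinearMap.ker π).subtype
  refine extOneVanishes_of_extend (K := K) (P := P₀) i π Subtype.val_injective
    (LinearMap.exact_subtype_ker_map π) hπ fun f => ?_
  let d' : P₁ →ₗ[A] K := d.codRestrict (LinearMap.ker π) fun x => hdπ.apply_apply_eq_zero x
  obtain ⟨g, hg⟩ := hY (f ∘ₗ d')
  refine ⟨g, ?_⟩
  ext x
  obtain ⟨y, hy⟩ := (hdπ x.1).1 x.2
  have hy' : d' y = x := Subtype.ext hy
  have := LinearMap.congr_fun hg y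
  simp only [LinearMap.comp_apply, hy'] at this
  rw [← this, LinearMap.comp_apply]
  exact congrArg g hy.symm

variable {P₁ P₀ : FGModuleCat.{u} A} [Module.Projective A P₁] [Module.Projective A P₀]
  {d : P₁ →ₗ[A] P₀}

/-- For `d` from a minimal presentation of `M` this is the class of `N` with `Hom(N, τM) = 0`. For
extensions, subtract from `h` a lift of an extension of `p ∘ h`, so that the remainder takes values
in `X`. -/
theorem isTorsionClass_homSurjective :
    IsTorsionClass (fun X : FGModuleCat.{u} A => HomSurjective d X) where
  of_surjective f hf hX h := by
    obtain ⟨h', rfl⟩ := Module.projective_lifting_property f h hf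
    obtain ⟨g, rfl⟩ := hX h'
    exact ⟨f ∘ₗ g, LinearMap.comp_assoc _ _ _⟩
  of_exact {X E Z} i p hi hip hp hX hZ h := by
    obtain ⟨g, hg⟩ := hZ (p ∘ₗ h)
    obtain ⟨g', rfl⟩ := Module.projective_lifting_property p g hp
    have hker : ∀ x, ∃ y, i y = (h - g' ∘ₗ d) x := fun x => (hip _).1 (by
      have := LinearMap.congr_fun hg x
      simp only [LinearMap.comp_apply] at this
      rw [LinearMap.sub_apply, map_sub, LinearMap.comp_apply, this, sub_self])
    let e := LinearEquiv.ofInjective i hi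
    obtain ⟨c, hc⟩ := hX (e.symm.toLinearMap ∘ₗ (h - g' ∘ₗ d).codRestrict (LinearMap.range i) hker)
    refine ⟨i ∘ₗ c + g', ?_⟩
    ext x
    have h1 := congrArg (fun y => (e y : E)) (LinearMap.congr_fun hc x)
    simp only [LinearMap.comp_apply, LinearEquiv.coe_coe, LinearEquiv.apply_symm_apply] at h1
    have h2 : i (c (d x)) = h x - g' (d x) := h1
    simp [h2]

theorem HomSurjective.gen {T X : FGModuleCat.{u} A} (hT : HomSurjective d T) (hX : Gen T X) :
    HomSurjective d X :=
  isTorsionClass_homSurjective.gen_le hT X hX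

/-- Auslander–Smalø: among the corrections `f - g ∘ d` choose one with minimal image. Modulo the
image of `ker d` it factors through `ker π`, and `Ext` vanishing against a factor of `N` extends it
to `P₀`; so some correction has image in that of `ker d`. By minimality `ker d` already has full
image, and since `ker d` is superfluous the chosen map is zero. -/
theorem MinimalPresentation.homSurjective [IsArtinianRing A] {M N : FGModuleCat.{u} A}
    (P : MinimalPresentation M) (h : extPerp (Gen N) M) : HomSurjective P.d N := by
  have := P.cover₀.projective
  have := P.cover₁.projective
  have hsup : IsSuperfluous (LinearMap.ker P.d) := by
    have := P.cover₁.superfluous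
    rwa [LinearMap.ker_rangeRestrict] at this
  -- modulo `d`, the image of a map can be made smaller
  have step : ∀ f : P.P₁ →ₗ[A] N, ∃ g : P.P₀ →ₗ[A] N,
      LinearMap.range (f - g ∘ₗ P.d) ≤ (LinearMap.ker P.d).map f := by
    intro f
    let U := (LinearMap.ker P.d).map f
    let R := LinearMap.range P.d
    have hR : Function.Exact R.subtype P.π := by
      intro x
      rw [P.exact x]
      exact ⟨fun hx => ⟨⟨x, hx⟩, rfl⟩, fun ⟨y, hy⟩ => hy ▸ y.2⟩
    have hle : LinearMap.ker P.d ≤ LinearMap.ker (U.mkQ ∘ₗ f) := fun x hx =>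
      (Submodule.Quotient.mk_eq_zero _).2 ⟨x, hx, rfl⟩
    obtain ⟨c, hc⟩ := exists_factor_of_exact (LinearMap.ker P.d).subtype P.d.rangeRestrict
      (by
        intro x
        rw [← LinearMap.mem_ker, LinearMap.ker_rangeRestrict]
        exact ⟨fun hx => ⟨⟨x, hx⟩, rfl⟩, fun ⟨y, hy⟩ => hy ▸ y.2⟩)
      P.d.surjective_rangeRestrict (U.mkQ ∘ₗ f) (by
        ext x
        exact hle x.2)
    have hU : Gen N (FGModuleCat.of A (N ⧸ U)) :=
      gen_self.of_surjective (Y := FGModuleCat.of A (N ⧸ U)) U.mkQ U.mkQ_surjective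
    obtain ⟨b, hb⟩ := (h _ hU).exists_extend (K := FGModuleCat.of A R) R.subtype P.π
      Subtype.val_injective hR P.cover₀.surjective c
    obtain ⟨g, hg⟩ := Module.projective_lifting_property U.mkQ b U.mkQ_surjective
    refine ⟨g, ?_⟩
    rintro _ ⟨x, rfl⟩
    refine (Submodule.Quotient.eq U).1 ?_
    have e1 := LinearMap.congr_fun hg (P.d x)
    have e2 := LinearMap.congr_fun hb (P.d.rangeRestrict x)
    have e3 := LinearMap.congr_fun hc x
    simp only [LinearMap.comp_apply] at e1 e2 e3
    exact e3.symm.trans (e2.symm.trans e1.symm)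
  intro f
  let S : Set (Submodule A N) :=
    {R | ∃ g : P.P₀ →ₗ[A] N, R = LinearMap.range (f - g ∘ₗ P.d)}
  obtain ⟨R, ⟨g, rfl⟩, hmin⟩ := WellFounded.has_min (wellFounded_lt) S ⟨_, 0, rfl⟩
  obtain ⟨g', hg'⟩ := step (f - g ∘ₗ P.d)
  have hmem : LinearMap.range (f - g ∘ₗ P.d - g' ∘ₗ P.d) ∈ S :=
    ⟨g + g', by rw [LinearMap.add_comp, sub_sub]⟩
  have hle : (LinearMap.ker P.d).map (f - g ∘ₗ P.d) ≤ LinearMap.range (f - g ∘ₗ P.d) :=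
    LinearMap.map_le_range
  have heq : LinearMap.range (f - g ∘ₗ P.d) ≤ (LinearMap.ker P.d).map (f - g ∘ₗ P.d) := by
    by_contra hne
    exact hmin _ hmem (lt_of_le_of_lt hg' (lt_of_le_of_ne hle fun h => hne h.ge))
  refine ⟨g, ?_⟩
  have htop : LinearMap.ker (f - g ∘ₗ P.d) = ⊤ := by
    refine hsup _ ?_
    rw [eq_top_iff]
    rintro x -
    obtain ⟨y, hy, hyx⟩ := heq ⟨x, rfl⟩
    rw [← sub_add_cancel x y]
    refine Submodule.add_mem_sup ?_ hy
    rw [LinearMap.mem_ker, map_sub, hyx, sub_self]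
  exact (sub_eq_zero.1 (LinearMap.ker_eq_top.1 htop)).symm

end HomSurjective

/-! ### The Auslander–Reiten translate and `τ`-rigidity. -/

section Tau

variable (k : Type v) [Field k] {A : Type u} [Ring A] [Algebra k A]

theorem exists_dualBasis (P : FGModuleCat.{u} A) [Module.Projective A P] :
    ∃ (n : ℕ) (x : Fin n → P) (φ : Fin n → P →ₗ[A] A), ∀ p, ∑ i, φ i p • x i = p := by
  classical
  obtain ⟨n, f, hf⟩ := Module.Finite.exists_fin' A P
  obtain ⟨s, hs⟩ := Module.projective_lifting_property f LinearMap.id hf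
  refine ⟨n, fun i => f (Pi.single i 1), fun i => LinearMap.proj i ∘ₗ s, fun p => ?_⟩
  have h1 := LinearMap.congr_fun hs p
  simp only [LinearMap.comp_apply, LinearMap.id_apply] at h1
  conv_rhs => rw [← h1]
  simp only [← map_smul, ← map_sum, LinearMap.comp_apply]
  congr 1
  ext j
  simp [Pi.single_apply]

instance (X : Type*) [AddCommGroup X] [Module k X] [Module Aᵐᵒᵖ X] [SMulCommClass Aᵐᵒᵖ k X] :
    AddMonoidHomClass (KDual k A X) X k :=
  inferInstanceAs (AddMonoidHomClass (X →ₗ[k] k) X k)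

variable {M : FGModuleCat.{u} A} (P : MinimalPresentation M) {N : Type*} [AddCommGroup N]
  [Module A N]

/-- By the dual basis identity `key`, the value `f z χ` depends only on the map `p ↦ χ p • z` from
`P₁` to `N`. An extension of this map along `d` rewrites the value through the forms `ψ j ∘ d`,
which vanish in the transpose. -/
theorem eq_zero_of_homSurjective (h : HomSurjective P.d N) (f : N →ₗ[A] KDual k A P.Tr) :
    f = 0 := by
  have := P.cover₀.projective
  have := P.cover₁.projective
  obtain ⟨n, x, φ, hφ⟩ := exists_dualBasis P.P₁
  obtain ⟨m, y, ψ, hψ⟩ := exists_dualBasis P.P₀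
  let W := LinearMap.range (homDual P.d)
  have hexp : ∀ χ : P.P₁ →ₗ[A] A, ∑ i, MulOpposite.op (χ (x i)) • φ i = χ := by
    intro χ
    ext p
    conv_rhs => rw [← hφ p]
    simp
  have key : ∀ (z : N) (χ : P.P₁ →ₗ[A] A),
      ∑ i, (f (χ (x i) • z)) (W.mkQ (φ i)) = (f z) (W.mkQ χ) := by
    intro z χ
    conv_rhs => rw [← hexp χ]
    rw [map_sum]
    refine Eq.trans ?_ (map_sum (f z) _ _).symm
    refine Finset.sum_congr rfl fun i _ => ?_
    rw [map_smul, KDual.smul_apply]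
    exact congrArg (f z) (map_smul W.mkQ _ _).symm
  refine LinearMap.ext fun z => ?_
  refine LinearMap.ext (f := (f z : P.Tr →ₗ[k] k)) (g := 0) fun t => ?_
  obtain ⟨χ, rfl⟩ := W.mkQ_surjective t
  refine (key z χ).symm.trans ?_
  obtain ⟨g, hg⟩ := h (LinearMap.toSpanSingleton A N z ∘ₗ χ)
  have hg' : ∀ i, χ (x i) • z = ∑ j, ψ j (P.d (x i)) • g (y j) := by
    intro i
    have := LinearMap.congr_fun hg (x i)
    simp only [LinearMap.comp_apply, LinearMap.toSpanSingleton_apply] at this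
    rw [← this]
    conv_lhs => rw [← hψ (P.d (x i))]
    simp
  have hsum : ∀ i, (f (χ (x i) • z)) (W.mkQ (φ i)) =
      ∑ j, (f ((ψ j ∘ₗ P.d) (x i) • g (y j))) (W.mkQ (φ i)) := by
    intro i
    rw [hg', map_sum]
    exact LinearMap.sum_apply _ (fun j => (f (ψ j (P.d (x i)) • g (y j)) : P.Tr →ₗ[k] k)) _
  simp only [hsum]
  rw [Finset.sum_comm]
  refine Finset.sum_eq_zero fun j _ => ?_
  rw [key]
  have : W.mkQ (ψ j ∘ₗ P.d) = 0 := (Submodule.Quotient.mk_eq_zero _).2 ⟨ψ j, rfl⟩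
  rw [this]
  exact map_zero (f (g (y j)))

variable [Module k N] [IsScalarTower k A N]

/-- A map `c` that does not extend is detected by a `k`-linear form `l` vanishing on all extendable
maps. Sending `z` to `φ ↦ l (φ(-) • z)` is an `A`-linear map `N → D Tr M`, hence zero; but a dual
basis writes `c` as a sum of maps `φ(-) • z`, so `l c = 0`. -/
theorem homSurjective_of_forall_eq_zero (h : ∀ f : N →ₗ[A] KDual k A P.Tr, f = 0) :
    HomSurjective P.d N := by
  have := P.cover₁.projective
  by_contra hns
  rw [HomSurjective] at hns
  push Not at hns
  obtain ⟨c, hc⟩ := hns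
  let D : (P.P₀ →ₗ[A] N) →ₗ[k] (P.P₁ →ₗ[A] N) :=
    { toFun := fun g => g ∘ₗ P.d
      map_add' := fun _ _ => rfl
      map_smul' := fun _ _ => rfl }
  obtain ⟨l, hl, hle⟩ := Submodule.exists_le_ker_of_notMem (p := LinearMap.range D) (v := c) (by
    rintro ⟨g, hg⟩
    exact hc g hg)
  let ev : N → (P.P₁ →ₗ[A] A) →ₗ[k] (P.P₁ →ₗ[A] N) := fun z =>
    { toFun := fun φ => LinearMap.toSpanSingleton A N z ∘ₗ φ
      map_add' := fun φ ψ => by ext p; simp [add_smul]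
      map_smul' := fun r φ => by ext p; simp }
  let W := LinearMap.range (homDual P.d)
  have hW : ∀ z, W.restrictScalars k ≤ LinearMap.ker (l ∘ₗ ev z) := by
    rintro z _ ⟨ψ, rfl⟩
    exact hle ⟨LinearMap.toSpanSingleton A N z ∘ₗ ψ, rfl⟩
  let F : N → KDual k A P.Tr := fun z =>
    (W.restrictScalars k).liftQ (l ∘ₗ ev z) (hW z) ∘ₗ
      (Submodule.Quotient.restrictScalarsEquiv k W).symm.toLinearMap
  have hF : ∀ z φ, (F z) (W.mkQ φ) = l (ev z φ) := fun z φ => rfl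
  have hext : ∀ f g : KDual k A P.Tr, (∀ φ, f (W.mkQ φ) = g (W.mkQ φ)) → f = g := by
    intro f g hfg
    refine LinearMap.ext (f := (f : P.Tr →ₗ[k] k)) (g := g) fun t => ?_
    obtain ⟨φ, rfl⟩ := W.mkQ_surjective t
    exact hfg φ
  let f : N →ₗ[A] KDual k A P.Tr :=
    { toFun := F
      map_add' := fun z w => hext _ _ fun φ => by
        rw [hF]
        refine Eq.trans ?_ (LinearMap.add_apply (F z : P.Tr →ₗ[k] k) (F w) _).symm
        refine Eq.trans ?_ (congrArg₂ (· + ·) (hF z φ) (hF w φ)).symm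
        rw [← map_add]
        congr 1
        ext p
        simp [ev]
      map_smul' := fun a z => hext _ _ fun φ => by
        rw [hF, RingHom.id_apply, KDual.smul_apply, ← map_smul, hF]
        congr 1
        ext p
        simp [ev, mul_smul] }
  obtain ⟨n, x, φ, hφ⟩ := exists_dualBasis P.P₁
  have hc' : c = ∑ i, ev (c (x i)) (φ i) := by
    ext p
    conv_lhs => rw [← hφ p]
    simp [ev]
  apply hl
  rw [hc', map_sum]
  refine Finset.sum_eq_zero fun i _ => ?_
  rw [← hF]
  have : F (c (x i)) = 0 := LinearMap.congr_fun (h f) (c (x i))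
  rw [this]
  rfl

/-- `M` is `τ`-rigid if and only if `Ext¹(M, Gen M) = 0`. -/
theorem forall_hom_tau_eq_zero_iff [Module.Finite k A] (M : FGModuleCat.{u} A) :
    (∀ f : M →ₗ[A] tau k M, f = 0) ↔ extPerp (Gen M) M := by
  have : IsArtinianRing A := IsArtinianRing.of_finite k A
  have h₀ := (minimalPresentation k M).cover₀
  have := h₀.projective
  have := (minimalPresentation k M).cover₁.projective
  constructor
  · intro h X hX
    let : Module k M := Module.compHom M (algebraMap k A)
    have : IsScalarTower k A M := ⟨fun c a x => by rw [Algebra.smul_def, mul_smul]; rfl⟩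
    exact ((homSurjective_of_forall_eq_zero k _ h).gen hX).extOneVanishes
      (minimalPresentation k M).exact h₀.surjective
  · intro h
    exact eq_zero_of_homSurjective k _ ((minimalPresentation k M).homSurjective h)

end Tau

end WeakCotorsion

namespace WeakCotorsion

/-! ### Additive functions on modules. -/

section AdditiveFunctions

variable {A : Type u} [Ring A]

/-- An integer valued function on modules that is additive on short exact sequences. -/
def IsAdditive (F : FGModuleCat.{u} A → ℤ) : Prop :=
  ∀ ⦃X Y Z : FGModuleCat.{u} A⦄ (i : X →ₗ[A] Y) (p : Y →ₗ[A] Z), Function.Injective i →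
    Function.Exact i p → Function.Surjective p → F Y = F X + F Z

variable {F : FGModuleCat.{u} A → ℤ}

theorem IsAdditive.sub {G : FGModuleCat.{u} A → ℤ} (hF : IsAdditive F) (hG : IsAdditive G) :
    IsAdditive fun X => F X - G X := by
  intro X Y Z i p hi hip hp
  simp only [hF i p hi hip hp, hG i p hi hip hp]
  ring

theorem IsAdditive.sum_mul {ι : Type*} (s : Finset ι) (c : ι → ℤ) {G : ι → FGModuleCat.{u} A → ℤ}
    (hG : ∀ i, IsAdditive (G i)) : IsAdditive fun X => ∑ i ∈ s, c i * G i X := by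
  intro X Y Z i p hi hip hp
  simp only [fun j => hG j i p hi hip hp, mul_add, Finset.sum_add_distrib]

theorem IsAdditive.eq_zero_of_subsingleton (hF : IsAdditive F) (X : FGModuleCat.{u} A)
    [Subsingleton X] : F X = 0 := by
  have := hF (X := X) (Y := X) (Z := X) 0 0 (fun _ _ _ => Subsingleton.elim _ _)
    (fun x => ⟨fun _ => ⟨0, Subsingleton.elim _ _⟩, fun _ => rfl⟩)
    (fun x => ⟨0, Subsingleton.elim _ _⟩)
  omega

theorem IsAdditive.congr (hF : IsAdditive F) {X Y : FGModuleCat.{u} A} (e : X ≃ₗ[A] Y) :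
    F X = F Y := by
  let Z := FGModuleCat.of A (PUnit.{u + 1})
  have : Subsingleton Z := inferInstanceAs (Subsingleton PUnit)
  have := hF (Z := Z) e.toLinearMap 0 e.injective
    (fun y => ⟨fun _ => e.surjective y, fun _ => rfl⟩) (fun x => ⟨0, Subsingleton.elim _ _⟩)
  rw [this, hF.eq_zero_of_subsingleton Z, add_zero]

/-- An additive function that vanishes on the simple modules vanishes. -/
theorem IsAdditive.eq_zero [IsArtinianRing A] (hF : IsAdditive F)
    (h : ∀ S : FGModuleCat.{u} A, IsSimpleModule A S → F S = 0) (X : FGModuleCat.{u} A) :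
    F X = 0 := by
  suffices H : ∀ U : Submodule A X, F (FGModuleCat.of A U) = 0 by
    rw [← H ⊤]
    exact hF.congr (Y := FGModuleCat.of A (⊤ : Submodule A X)) Submodule.topEquiv.symm
  intro U
  induction U using WellFoundedLT.induction with
  | ind U ih =>
  by_cases hU : U = ⊥
  · have : Subsingleton (FGModuleCat.of A U) := by
      change Subsingleton U
      rw [hU]
      infer_instance
    exact hF.eq_zero_of_subsingleton _
  · obtain ⟨W, hW⟩ := exists_covBy_of_wellFoundedGT (a := U) (fun h => hU (isMin_iff_eq_bot.1 h))
    have hS := (covBy_iff_quot_is_simple hW.le).1 hW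
    have := hF (X := FGModuleCat.of A W) (Y := FGModuleCat.of A U)
      (Z := FGModuleCat.of A (U ⧸ W.comap U.subtype)) (Submodule.inclusion hW.le)
      (W.comap U.subtype).mkQ (Submodule.inclusion_injective _)
      (by
        intro x
        constructor
        · intro hx
          exact ⟨⟨x, (Submodule.Quotient.mk_eq_zero (W.comap U.subtype)).1 hx⟩, rfl⟩
        · rintro ⟨y, rfl⟩
          exact (Submodule.Quotient.mk_eq_zero _).2 y.2)
      (Submodule.mkQ_surjective _)
    rw [this, ih W hW.lt, h _ hS, add_zero]

end AdditiveFunctions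

/-! ### Dimensions of `Hom` spaces. -/

section HomDim

variable (k : Type v) [Field k] {A : Type u} [Ring A] [Algebra k A]

/-- The `k`-vector space structure of an `A`-module. -/
@[reducible]
def scalarModule (X : FGModuleCat.{u} A) : Module k X :=
  Module.compHom X (algebraMap k A)

attribute [local instance] scalarModule

theorem isScalarTower_scalarModule (X : FGModuleCat.{u} A) : IsScalarTower k A X :=
  ⟨fun c a x => by rw [Algebra.smul_def, mul_smul]; rfl⟩

attribute [local instance] isScalarTower_scalarModule

theorem finite_hom [Module.Finite k A] (X : FGModuleCat.{u} A) (Y : Type*) [AddCommGroup Y]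
    [Module A Y] [Module.Finite A Y] [Module k Y] [IsScalarTower k A Y] :
    Module.Finite k (X →ₗ[A] Y) := by
  have : Module.Finite k X := Module.Finite.trans A X
  have : Module.Finite k Y := Module.Finite.trans A Y
  refine Module.Finite.of_injective (LinearMap.restrictScalarsₗ k A X Y k) fun f g h => ?_
  ext x
  exact LinearMap.congr_fun h x

/-- The `k`-dimension of `Hom_A(X, Y)`. -/
noncomputable def homDim (X Y : FGModuleCat.{u} A) : ℤ := Module.finrank k (X →ₗ[A] Y)

theorem finrank_eq_add_of_exact {V₁ V₂ V₃ : Type*} [AddCommGroup V₁] [Module k V₁]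
    [AddCommGroup V₂] [Module k V₂] [AddCommGroup V₃] [Module k V₃] [Module.Finite k V₂]
    (f : V₁ →ₗ[k] V₂) (g : V₂ →ₗ[k] V₃) (hf : Function.Injective f) (hfg : Function.Exact f g)
    (hg : Function.Surjective g) :
    Module.finrank k V₂ = Module.finrank k V₁ + Module.finrank k V₃ := by
  rw [← g.finrank_range_add_finrank_ker, LinearMap.range_eq_top.2 hg, finrank_top,
    hfg.linearMap_ker_eq, LinearMap.finrank_range_of_inj hf, add_comm]

theorem homDim_nonneg (X Y : FGModuleCat.{u} A) : 0 ≤ homDim k X Y := Nat.cast_nonneg _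

theorem homDim_congr_left {X X' : FGModuleCat.{u} A} (e : X ≃ₗ[A] X') (Z : FGModuleCat.{u} A) :
    homDim k X Z = homDim k X' Z := by
  let E : (X →ₗ[A] Z) ≃ₗ[k] (X' →ₗ[A] Z) :=
    { toFun := fun h => h ∘ₗ e.symm.toLinearMap
      map_add' := fun _ _ => rfl
      map_smul' := fun _ _ => rfl
      invFun := fun h => h ∘ₗ e.toLinearMap
      left_inv := fun h => by ext x; simp
      right_inv := fun h => by ext x; simp }
  rw [homDim, homDim, E.finrank_eq]

variable [Module.Finite k A]

theorem isAdditive_homDim (P : FGModuleCat.{u} A) [Module.Projective A P] :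
    IsAdditive (homDim k P) := by
  intro X Y Z i p hi hip hp
  have := finite_hom k P Y
  let post {U V : FGModuleCat.{u} A} (f : U →ₗ[A] V) : (P →ₗ[A] U) →ₗ[k] (P →ₗ[A] V) :=
    { toFun := fun h => f ∘ₗ h
      map_add' := fun _ _ => LinearMap.comp_add _ _ _
      map_smul' := fun c h => by
        ext x
        exact f.map_smul (algebraMap k A c) (h x) }
  have := finrank_eq_add_of_exact k (post i) (post p)
    (fun f g hfg => LinearMap.ext fun x => hi (LinearMap.congr_fun hfg x))
    (by
      intro f
      constructor
      · intro hf
        let e := LinearEquiv.ofInjective i hi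
        have hr : ∀ x, f x ∈ LinearMap.range i := fun x => (hip _).1 (LinearMap.congr_fun hf x)
        refine ⟨e.symm.toLinearMap ∘ₗ f.codRestrict _ hr, ?_⟩
        ext x
        have := congrArg Subtype.val (e.apply_symm_apply ⟨f x, hr x⟩)
        exact this
      · rintro ⟨g, rfl⟩
        ext x
        exact hip.apply_apply_eq_zero (g x))
    (fun f => by
      obtain ⟨g, hg⟩ := Module.projective_lifting_property p f hp
      exact ⟨g, hg⟩)
  simp only [homDim, this]
  push_cast
  ring

theorem homDim_add_of_homSurjective {W Y X Z : FGModuleCat.{u} A} (a : W →ₗ[A] Y) (z : Y →ₗ[A] X)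
    (haz : Function.Exact a z) (hz : Function.Surjective z) (h : HomSurjective a Z) :
    homDim k Y Z = homDim k X Z + homDim k W Z := by
  have := finite_hom k Y Z
  let pre {U V : FGModuleCat.{u} A} (f : U →ₗ[A] V) : (V →ₗ[A] Z) →ₗ[k] (U →ₗ[A] Z) :=
    { toFun := fun h => h ∘ₗ f
      map_add' := fun _ _ => rfl
      map_smul' := fun _ _ => rfl }
  have := finrank_eq_add_of_exact k (pre z) (pre a)
    (fun f g hfg => LinearMap.ext fun x => by
      obtain ⟨y, rfl⟩ := hz x
      exact LinearMap.congr_fun hfg y)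
    (by
      intro f
      constructor
      · intro hf
        exact exists_factor_of_exact a z haz hz f hf
      · rintro ⟨g, rfl⟩
        ext x
        simp [pre, haz.apply_apply_eq_zero])
    h
  simp only [homDim, this]
  push_cast
  ring

theorem homDim_eq_zero_iff {X Y : FGModuleCat.{u} A} :
    homDim k X Y = 0 ↔ ∀ f : X →ₗ[A] Y, f = 0 := by
  have := finite_hom k X Y
  rw [homDim, Nat.cast_eq_zero, Module.finrank_zero_iff]
  exact ⟨fun h f => Subsingleton.elim _ _, fun h => subsingleton_of_forall_eq 0 h⟩

theorem homDim_pi {M : FGModuleCat.{u} A} {ι : Type*} [Fintype ι] {X : ι → FGModuleCat.{u} A}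
    (e : M ≃ₗ[A] ∀ i, X i) (Z : FGModuleCat.{u} A) : homDim k M Z = ∑ i, homDim k (X i) Z := by
  classical
  have := fun i => finite_hom k (X i) Z
  let E : (∀ i, X i →ₗ[A] Z) ≃ₗ[k] (M →ₗ[A] Z) :=
    LinearMap.lsum A (fun i => (X i : Type u)) k ≪≫ₗ
    { toFun := fun h => h ∘ₗ e.toLinearMap
      map_add' := fun _ _ => rfl
      map_smul' := fun _ _ => rfl
      invFun := fun h => h ∘ₗ e.symm.toLinearMap
      left_inv := fun h => by
        apply LinearMap.ext
        simp
      right_inv := fun h => by ext x; simp }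
  rw [homDim, ← E.finrank_eq, Module.finrank_pi_fintype]
  simp [homDim]

/-- On `Gen T` maps extend along the minimal presentation of `X`, so `dim Hom(X, Z) = dim Hom(P₀, Z)
- dim Hom(P₁, Z)`: the pairing with the g-vector of `X`. -/
theorem exists_isAdditive_eq_homDim {T X : FGModuleCat.{u} A} (h : extPerp (Gen T) X) :
    ∃ G : FGModuleCat.{u} A → ℤ, IsAdditive G ∧ ∀ Z, Gen T Z → homDim k X Z = G Z := by
  have : IsArtinianRing A := IsArtinianRing.of_finite k A
  obtain ⟨P⟩ := nonempty_minimalPresentation X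
  have := P.cover₀.projective
  have := P.cover₁.projective
  refine ⟨_, (isAdditive_homDim k P.P₀).sub (isAdditive_homDim k P.P₁), fun Z hZ => ?_⟩
  have := homDim_add_of_homSurjective k P.d P.π P.exact P.cover₀.surjective
    ((P.homSurjective h).gen hZ)
  simp only [this]
  ring

end HomDim

/-! ### Modules without common summands. -/

section DisjointSummands

variable {A : Type u} [Ring A]

theorem exists_isIndecomposable_addClosure [IsArtinianRing A] (M : FGModuleCat.{u} A)
    [Nontrivial M] : ∃ X : FGModuleCat.{u} A, IsIndecomposable X ∧ addClosure M X := by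
  obtain ⟨ι, hι, X, hX, ⟨e⟩⟩ := exists_indecomposable_decomposition M
  rcases isEmpty_or_nonempty ι with h | ⟨⟨i⟩⟩
  · exact absurd e.toEquiv.subsingleton (not_subsingleton M)
  · exact ⟨X i, hX i, addClosure_apply_of_equiv_pi e i⟩

/-- Otherwise the stable image of `f` is a nonzero summand of `M` on which a power of `f` is
invertible, so its identity factors through `N` and it contributes a common indecomposable summand.
-/
theorem isNilpotent_of_factorsThrough [IsArtinianRing A] {M N : FGModuleCat.{u} A}
    (h : ∀ X : FGModuleCat.{u} A, IsIndecomposable X → addClosure M X → ¬ addClosure N X)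
    (f : Module.End A M) (hf : FactorsThrough N f) : IsNilpotent f := by
  obtain ⟨n, hn, hn1⟩ := ((f.eventually_isCompl_ker_pow_range_pow).and
    (Filter.eventually_ge_atTop 1)).exists
  refine ⟨n, LinearMap.range_eq_bot.1 ?_⟩
  by_contra hR
  have hfn : FactorsThrough N (f ^ n) := by
    obtain ⟨m, rfl⟩ : ∃ m, n = m + 1 := ⟨n - 1, by omega⟩
    rw [pow_succ]
    exact hf.comp_left (f ^ m)
  let R : FGModuleCat.{u} A := FGModuleCat.of A (LinearMap.range (f ^ n))
  have hRn : Nontrivial R := Submodule.nontrivial_iff_ne_bot.2 hR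
  let q : M →ₗ[A] R := Submodule.projectionOnto _ _ hn.symm
  let i : R →ₗ[A] M := (LinearMap.range (f ^ n)).subtype
  have hqi : ∀ x : R, q (i x) = x := fun x => Submodule.projectionOnto_apply_left hn.symm x
  let w : Module.End A R := q ∘ₗ (f ^ n) ∘ₗ i
  have hw : Function.Injective w := by
    rw [injective_iff_map_eq_zero]
    intro x hx
    have h1 : q (i ⟨(f ^ n) (i x), ⟨_, rfl⟩⟩) = 0 := hx
    rw [hqi] at h1
    have h2 : (f ^ n) (i x) = 0 := congrArg Subtype.val h1
    have h3 : i x ∈ LinearMap.ker (f ^ n) ⊓ LinearMap.range (f ^ n) := ⟨h2, x.2⟩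
    rw [hn.inf_eq_bot] at h3
    exact Subtype.ext h3
  have hu : IsUnit w := (Module.End.isUnit_iff _).2
    ⟨hw, IsArtinian.surjective_of_injective_endomorphism w hw⟩
  obtain ⟨w', hw'⟩ := hu
  have hRN : addClosure N R := by
    rw [addClosure_iff]
    have h1 := ((hfn.comp_right i).comp_left q).comp_left (↑w'⁻¹ : Module.End A R)
    have h2 : (↑w'⁻¹ : Module.End A R) ∘ₗ q ∘ₗ (f ^ n) ∘ₗ i = LinearMap.id := by
      change (↑w'⁻¹ : Module.End A R) * w = 1
      rw [← hw', Units.inv_mul]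
    rwa [h2] at h1
  have hRM : addClosure M R := addClosure_of_isDirectSummand ⟨i, q, LinearMap.ext hqi⟩
  obtain ⟨X, hX, hXR⟩ := exists_isIndecomposable_addClosure R
  exact h X hX (hRM.trans hXR) (hRN.trans hXR)

attribute [local instance] scalarModule isScalarTower_scalarModule

/-- Modules without common summands that generate each other vanish. -/
theorem subsingleton_of_gen (k : Type v) [Field k] [Algebra k A] [Module.Finite k A]
    {M N : FGModuleCat.{u} A} (hM : Gen N M) (hN : Gen M N)
    (h : ∀ X : FGModuleCat.{u} A, IsIndecomposable X → addClosure M X → ¬ addClosure N X) :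
    Subsingleton M := by
  have : IsArtinianRing A := IsArtinianRing.of_finite k A
  have : Module.Finite k M := Module.Finite.trans A M
  have : Module.Finite (Module.End A M) M :=
    Module.Finite.of_restrictScalars_finite k (Module.End A M) M
  -- Every left multiple of `f` again factors through `N`, hence is nilpotent.
  have hjac : ∀ f : Module.End A M, FactorsThrough N f → f ∈ Ring.jacobson (Module.End A M) := by
    intro f hf
    rw [← Ideal.jacobson_bot, Ideal.mem_jacobson_iff]
    intro y
    obtain ⟨z, hz⟩ := (isNilpotent_of_factorsThrough h (y * f) (hf.comp_left y)).isUnit_one_add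
    refine ⟨(↑z⁻¹ : Module.End A M), ?_⟩
    have h1 : (↑z⁻¹ : Module.End A M) * y * f + ↑z⁻¹ - 1 = ↑z⁻¹ * (1 + y * f) - 1 := by
      rw [mul_add, mul_one, mul_assoc]
      abel
    rw [h1, ← hz, Units.inv_mul, sub_self]
    exact Submodule.zero_mem _
  -- Mutual generation writes each element of `M` as a sum of values of composites `M → N → M`, so
  -- `M` equals its radical multiple and Nakayama applies.
  have htop : (⊤ : Submodule (Module.End A M) M) ≤
      Ring.jacobson (Module.End A M) • (⊤ : Submodule (Module.End A M) M) := by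
    rintro x -
    have hx : x ∈ trace N M := by
      rw [gen_iff_trace.1 hM]
      trivial
    refine Submodule.iSup_induction _ (motive := fun x => x ∈ Ring.jacobson (Module.End A M) •
      (⊤ : Submodule (Module.End A M) M)) hx ?_ (Submodule.zero_mem _)
      fun _ _ => Submodule.add_mem _
    rintro g _ ⟨y, rfl⟩
    have hy : y ∈ trace M N := by
      rw [gen_iff_trace.1 hN]
      trivial
    refine Submodule.iSup_induction _ (motive := fun y => g y ∈ Ring.jacobson (Module.End A M) •
      (⊤ : Submodule (Module.End A M) M)) hy ?_ (by rw [map_zero]; exact Submodule.zero_mem _)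
      fun _ _ h1 h2 => by rw [map_add]; exact Submodule.add_mem _ h1 h2
    rintro c _ ⟨z, rfl⟩
    exact Submodule.smul_mem_smul (r := (g ∘ₗ c : Module.End A M))
      (hjac _ (factorsThrough_comp c g)) (Submodule.mem_top (x := z))
  have := Submodule.FG.eq_bot_of_le_jacobson_smul (Module.Finite.fg_top) htop
  exact (Submodule.subsingleton_iff (Module.End A M)).1 (subsingleton_of_bot_eq_top this.symm)

end DisjointSummands

end WeakCotorsion

namespace WeakCotorsion

/-! ### Counting indecomposable summands against simple modules. -/

section Counting

variable {A : Type u} [Ring A]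

/-- Move the negative terms to the other side: the sums of the `X i` with positive and with negative
coefficient have zero `Hom` into the same modules of `Gen T`. They therefore generate each other,
but share no summand, so both vanish. -/
theorem forall_le_zero_of_sum_homDim_eq_zero (k : Type v) [Field k] [Algebra k A] [Module.Finite k A]
    {T : FGModuleCat.{u} A} (hT : extPerp (Gen T) T)
    {m : ℕ} (X : Fin m → FGModuleCat.{u} A) (hX : ∀ i, IsIndecomposable (X i))
    (hXi : ∀ i j, Nonempty (X i ≃ₗ[A] X j) → i = j) (hXT : ∀ i, addClosure T (X i))
    (c : Fin m → ℤ) (hc : ∀ Z, Gen T Z → ∑ j, c j * homDim k (X j) Z = 0) (j : Fin m) :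
    c j ≤ 0 := by
  classical
  have : IsArtinianRing A := IsArtinianRing.of_finite k A
  let part (s : Fin m → Prop) : FGModuleCat.{u} A :=
    FGModuleCat.of A (∀ i : {i // s i}, (X i : Type u))
  have hpart (s : Fin m → Prop) : addClosure T (part s) :=
    addClosure_of_equiv_pi (X := fun i : {i // s i} => X i) (LinearEquiv.refl A (part s))
      fun i => hXT i
  have hhom (s : Fin m → Prop) (Z : FGModuleCat.{u} A) :
      (∀ f : part s →ₗ[A] Z, f = 0) ↔ ∀ i, s i → homDim k (X i) Z = 0 := by
    rw [← homDim_eq_zero_iff k, homDim_pi k (X := fun i : {i // s i} => X i)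
      (LinearEquiv.refl A (part s)), Finset.sum_eq_zero_iff_of_nonneg fun i _ => homDim_nonneg k _ _]
    simp
  -- `⨁_{c i > 0} X i` and `⨁_{c i < 0} X i` have the same perpendicular modules in `Gen T`
  have hsum (Z : FGModuleCat.{u} A) (hZ : Gen T Z) :
      ∑ i, max (c i) 0 * homDim k (X i) Z = ∑ i, max (-c i) 0 * homDim k (X i) Z := by
    rw [← sub_eq_zero, ← Finset.sum_sub_distrib]
    refine Eq.trans (Finset.sum_congr rfl fun i _ => ?_) (hc Z hZ)
    rw [← sub_mul]
    congr 1
    omega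
  have hvan (b : Fin m → ℤ) (Z : FGModuleCat.{u} A) :
      ∑ i, max (b i) 0 * homDim k (X i) Z = 0 ↔ ∀ i, 0 < b i → homDim k (X i) Z = 0 := by
    rw [Finset.sum_eq_zero_iff_of_nonneg fun i _ =>
      mul_nonneg (le_max_right _ _) (homDim_nonneg k _ _)]
    simp only [Finset.mem_univ, true_implies, mul_eq_zero]
    refine forall_congr' fun i => ⟨fun h hi => h.resolve_left (by omega), fun h => ?_⟩
    by_cases hi : 0 < b i
    · exact Or.inr (h hi)
    · exact Or.inl (by omega)
  let M := part fun i => 0 < c i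
  let N := part fun i => 0 < -c i
  have hMN (Z : FGModuleCat.{u} A) (hZ : Gen T Z) :
      (∀ f : M →ₗ[A] Z, f = 0) ↔ ∀ f : N →ₗ[A] Z, f = 0 := by
    rw [hhom, hhom, ← hvan c, ← hvan (fun i => -c i), hsum Z hZ]
  -- `V / tr_U V` is in `Gen T` and receives no map from `U`, because `Ext¹(U, tr_U V) = 0`; so it
  -- receives none from `V`, and the projection is zero.
  have hgen : ∀ U V : FGModuleCat.{u} A, addClosure T U → addClosure T V →
      (∀ Z, Gen T Z → (∀ f : U →ₗ[A] Z, f = 0) → ∀ f : V →ₗ[A] Z, f = 0) → Gen U V := by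
    intro U V hU hV h
    have hU' : Gen T (FGModuleCat.of A (trace U V)) :=
      (gen_of_addClosure hU).trans (gen_trace V)
    have hq : Gen T (FGModuleCat.of A (V ⧸ trace U V)) :=
      (gen_of_addClosure hV).of_surjective (Y := FGModuleCat.of A (V ⧸ trace U V))
        (trace U V).mkQ (Submodule.mkQ_surjective _)
    have h0 := h _ hq (homPerp_quotient_trace V ((hT _ hU').of_addClosure hU)) (trace U V).mkQ
    rw [gen_iff_trace, ← Submodule.ker_mkQ (trace U V), h0, LinearMap.ker_zero]
  have hM : Gen N M := hgen N M (hpart _) (hpart _) fun Z hZ => (hMN Z hZ).2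
  have hN : Gen M N := hgen M N (hpart _) (hpart _) fun Z hZ => (hMN Z hZ).1
  have hsub : Subsingleton M := subsingleton_of_gen k hM hN fun Y hY hYM hYN => by
    obtain ⟨⟨a, ha⟩, ⟨e⟩⟩ := hY.exists_equiv (Y := fun i : {i // 0 < c i} => X i) (fun i => hX i)
      (LinearEquiv.refl A M) hYM
    obtain ⟨⟨b, hb⟩, ⟨e'⟩⟩ := hY.exists_equiv (Y := fun i : {i // 0 < -c i} => X i) (fun i => hX i)
      (LinearEquiv.refl A N) hYN
    have := hXi a b ⟨e.symm ≪≫ₗ e'⟩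
    subst this
    omega
  by_contra hj
  push Not at hj
  obtain ⟨i, r, hir⟩ := (hX j).isDirectSummand
    (addClosure_apply_of_equiv_pi (X := fun i : {i // 0 < c i} => X i)
      (LinearEquiv.refl A M) ⟨j, hj⟩)
  have := (hX j).1
  obtain ⟨x, hx⟩ := exists_ne (0 : X j)
  apply hx
  have h1 : r (i x) = x := LinearMap.congr_fun hir x
  rw [← h1, Subsingleton.elim (i x) 0, map_zero]

theorem eq_zero_of_sum_homDim_eq_zero (k : Type v) [Field k] [Algebra k A] [Module.Finite k A]
    {T : FGModuleCat.{u} A} (hT : extPerp (Gen T) T)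
    {m : ℕ} (X : Fin m → FGModuleCat.{u} A) (hX : ∀ i, IsIndecomposable (X i))
    (hXi : ∀ i j, Nonempty (X i ≃ₗ[A] X j) → i = j) (hXT : ∀ i, addClosure T (X i))
    (c : Fin m → ℤ) (hc : ∀ Z, Gen T Z → ∑ j, c j * homDim k (X j) Z = 0) (j : Fin m) :
    c j = 0 := by
  refine le_antisymm (forall_le_zero_of_sum_homDim_eq_zero k hT X hX hXi hXT c hc j) ?_
  have := forall_le_zero_of_sum_homDim_eq_zero k hT X hX hXi hXT (fun i => -c i)
    (fun Z hZ => by simpa using hc Z hZ) j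
  simpa using this

/-- A `τ`-rigid module has at most as many indecomposable summands as there are simple modules. -/
theorem numIndecomposableSummands_le_numSimples (k : Type v) [Field k] [Algebra k A] [Module.Finite k A]
    {T : FGModuleCat.{u} A} (hT : extPerp (Gen T) T) :
    numIndecomposableSummands T ≤ numSimples A := by
  have : IsArtinianRing A := IsArtinianRing.of_finite k A
  obtain ⟨m, X, hX, hXi, hXT, -, hm⟩ := exists_indecomposable_representatives T
  rw [hm, numSimples]
  set 𝒮 := {c : IsoClass A | ∃ S : FGModuleCat.{u} A, isoClass S = c ∧ IsSimpleModule A S} with h𝒮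
  -- An infinite count makes the bound trivial, so finiteness of the set of simples need not be
  -- proved.
  by_cases hfin : 𝒮.Finite
  swap
  · rw [Set.Infinite.encard_eq hfin]
    exact le_top
  have := hfin.fintype
  choose S hS hSs using fun c : 𝒮 => c.2
  choose G hG hGX using fun j => exists_isAdditive_eq_homDim k (extPerp_addClosure hT (hXT j))
  -- A relation between values on simples holds on all modules by additivity, and on `Gen T` it
  -- becomes a relation between the `Hom` dimensions.
  have hli : LinearIndependent ℤ fun (j : Fin m) (c : 𝒮) => G j (S c) := by
    rw [Fintype.linearIndependent_iff]
    intro c hc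
    refine eq_zero_of_sum_homDim_eq_zero k hT X hX hXi hXT c fun Z hZ => ?_
    simp only [fun j => hGX j Z hZ]
    refine (IsAdditive.sum_mul Finset.univ c hG).eq_zero (fun S' hS' => ?_) Z
    have hmem : isoClass S' ∈ 𝒮 := ⟨S', rfl, hS'⟩
    obtain ⟨e⟩ := isoClass_eq_iff.1 (hS ⟨_, hmem⟩)
    have := congrFun hc ⟨_, hmem⟩
    simp only [Finset.sum_apply, Pi.smul_apply, smul_eq_mul, Pi.zero_apply] at this
    rw [← this]
    exact Finset.sum_congr rfl fun j _ => by rw [(hG j).congr e]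
  have := hli.fintype_card_le_finrank
  rw [Module.finrank_fintype_fun_eq_card, Fintype.card_fin] at this
  rw [Set.encard_eq_coe_toFinset_card, Set.toFinset_card]
  exact_mod_cast this

/-- The superfluous submodule `ker π` lies in the maximal submodule `ker f`, so `f` induces a
nonzero map between simples. -/
theorem IsProjectiveCover.nonempty_equiv {P S S' : FGModuleCat.{u} A} {π : P →ₗ[A] S}
    (hπ : IsProjectiveCover π) (hS : IsSimpleModule A S) (hS' : IsSimpleModule A S')
    (f : P →ₗ[A] S') (hf : f ≠ 0) : Nonempty (S ≃ₗ[A] S') := by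
  have hfs : Function.Surjective f := LinearMap.surjective_of_ne_zero hf
  have hle : LinearMap.ker π ≤ LinearMap.ker f := by
    by_contra hle
    have hco : IsCoatom (LinearMap.ker f) := LinearMap.isCoatom_ker_of_surjective hfs
    refine hf (LinearMap.ker_eq_top.1 (hπ.superfluous _ ?_))
    exact hco.2 _ (left_lt_sup.2 hle)
  obtain ⟨g, hg⟩ := exists_factor_of_exact (LinearMap.ker π).subtype π
    (LinearMap.exact_subtype_ker_map π) hπ.surjective f (by
      ext x
      exact hle x.2)
  have hg0 : g ≠ 0 := by
    rintro rfl
    exact hf (by rw [← hg, LinearMap.zero_comp])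
  exact ⟨LinearEquiv.ofBijective g (LinearMap.bijective_of_ne_zero hg0)⟩

theorem exists_homDim_eq_sum (k : Type v) [Field k] [Algebra k A] [Module.Finite k A]
    {T L : FGModuleCat.{u} A} {m : ℕ} (X : Fin m → FGModuleCat.{u} A)
    (hTX : ∀ Y, IsIndecomposable Y → addClosure T Y → ∃ i, Nonempty (Y ≃ₗ[A] X i))
    (hL : addClosure T L) : ∃ c : Fin m → ℤ, ∀ Z, homDim k L Z = ∑ j, c j * homDim k (X j) Z := by
  classical
  have : IsArtinianRing A := IsArtinianRing.of_finite k A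
  obtain ⟨ι, hι, Y, hY, ⟨e⟩⟩ := exists_indecomposable_decomposition L
  choose σ hσ using fun i => hTX (Y i) (hY i) (hL.trans (addClosure_apply_of_equiv_pi e i))
  -- The coefficient of `X j` is the number of summands of `L` assigned to it.
  refine ⟨fun j => ∑ i, if σ i = j then 1 else 0, fun Z => ?_⟩
  rw [homDim_pi k e]
  simp only [Finset.sum_mul]
  rw [Finset.sum_comm]
  refine Finset.sum_congr rfl fun i _ => ?_
  simp [homDim_congr_left k (hσ i).some Z]

/-- If every simple module embeds into a module generated by the silting module `T`, then `T` has
at least as many indecomposable summands as there are simple modules. -/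
theorem IsSilting.numSimples_le (k : Type v) [Field k] [Algebra k A] [Module.Finite k A]
    {T : FGModuleCat.{u} A} (hT : IsSilting T)
    (h : ∀ S : FGModuleCat.{u} A, IsSimpleModule A S →
      ∃ (Z : FGModuleCat.{u} A) (i : S →ₗ[A] Z), Gen T Z ∧ Function.Injective i) :
    numSimples A ≤ numIndecomposableSummands T := by
  have : IsArtinianRing A := IsArtinianRing.of_finite k A
  obtain ⟨m, X, hX, hXi, hXT, hTX, hm⟩ := exists_indecomposable_representatives T
  rw [hm]
  by_contra hlt
  rw [not_le, ← ENat.add_one_le_iff (ENat.natCast_ne_top m)] at hlt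
  -- It suffices to contradict the existence of `m + 1` simples: the matrix of `dim Hom(P c, S c')`
  -- is diagonal with nonzero diagonal, yet its rows will lie in a span of `m` vectors.
  obtain ⟨t, ht, htm⟩ := Set.exists_subset_encard_eq hlt
  have htfin : t.Finite := Set.finite_of_encard_eq_coe (k := m + 1) (by exact_mod_cast htm)
  have := htfin.fintype
  choose S hS hSs using fun c : t => ht c.2
  choose P π hπ using fun c => exists_projectiveCover (S c)
  choose G hG hGX using fun j => exists_isAdditive_eq_homDim k (extPerp_addClosure hT.ext (hXT j))
  have hPp := fun c => (hπ c).projective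
  have hoff : ∀ c c', c ≠ c' → homDim k (P c) (S c') = 0 := by
    intro c c' hcc
    rw [homDim_eq_zero_iff]
    intro f
    by_contra hf
    have := isoClass_eq_iff.2 ((hπ c).nonempty_equiv (hSs c) (hSs c') f hf)
    rw [hS, hS] at this
    exact hcc (Subtype.ext this)
  have hdiag : ∀ c, homDim k (P c) (S c) ≠ 0 := by
    intro c h0
    rw [homDim_eq_zero_iff] at h0
    have := (hSs c).nontrivial
    obtain ⟨x, hx⟩ := exists_ne (0 : S c)
    obtain ⟨y, rfl⟩ := (hπ c).surjective x
    exact hx (by rw [h0 (π c), LinearMap.zero_apply])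
  have hli : LinearIndependent ℤ fun (c c' : t) => homDim k (P c) (S c') := by
    rw [Fintype.linearIndependent_iff]
    intro a ha c
    have := congrFun ha c
    simp only [Finset.sum_apply, Pi.smul_apply, smul_eq_mul, Pi.zero_apply] at this
    rw [Finset.sum_eq_single c (fun b _ hb => by rw [hoff b c hb, mul_zero]) (by simp)] at this
    exact (mul_eq_zero.1 this).resolve_right (hdiag c)
  obtain ⟨Y, V, g, p, hY, hV, hs⟩ := hT.exists_approxSequence
  have h𝒯 := isTorsionClass_gen hT.ext
  have hspan : Set.range (fun (c c' : t) => homDim k (P c) (S c')) ≤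
      Submodule.span ℤ (Set.range fun (j : Fin m) (c' : t) => G j (S c')) := by
    rintro _ ⟨c, rfl⟩
    -- The left sequence `P c → L → V^n → 0` has `L` and `V^n` in `add T`, so on `Gen T` the
    -- function `dim Hom(P c, -)` is an integer combination of the `G j`.
    obtain ⟨n, L, l, q, hL, hlq, hq, hl, -⟩ := hs.exists_left h𝒯 (P c)
    have hVn : addClosure T (FGModuleCat.of A (Fin n → V)) := hV.trans (addClosure_pi n)
    have hLT : addClosure T L := by
      rw [hT.addClosure_eq]
      exact ⟨h𝒯.extPerp_of_approx (X := FGModuleCat.of A (Fin n → V)) l q hlq hq hL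
        (extPerp_addClosure hT.ext hVn) hl, hL⟩
    obtain ⟨a, ha⟩ := exists_homDim_eq_sum k X hTX hLT
    obtain ⟨b, hb⟩ := exists_homDim_eq_sum k X hTX hVn
    have hadd : IsAdditive fun Z => homDim k (P c) Z - ∑ j, (a j - b j) * G j Z :=
      (isAdditive_homDim k (P c)).sub (IsAdditive.sum_mul _ _ hG)
    have hzero : ∀ Z, Gen T Z → homDim k (P c) Z - ∑ j, (a j - b j) * G j Z = 0 := by
      intro Z hZ
      have h1 := homDim_add_of_homSurjective k (X := FGModuleCat.of A (Fin n → V)) l q hlq hq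
        (hl Z hZ)
      rw [ha, hb] at h1
      simp only [← fun j => hGX j Z hZ, sub_mul, Finset.sum_sub_distrib, h1]
      ring
    have hrow : (fun c' : t => homDim k (P c) (S c')) =
        ∑ j, (a j - b j) • fun c' : t => G j (S c') := by
      ext c'
      -- The additive difference vanishes on `Z` and on `Z / S c'`, both in `Gen T`, hence also on
      -- the simple module, which need not be in `Gen T`.
      obtain ⟨Z, i, hZ, hi⟩ := h (S c') (hSs c')
      have h1 := hadd (Z := FGModuleCat.of A (Z ⧸ LinearMap.range i)) i (LinearMap.range i).mkQ hi
        (LinearMap.exact_map_mkQ_range i) (Submodule.mkQ_surjective _)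
      have h2 := hzero _ (hZ.of_surjective (Y := FGModuleCat.of A (Z ⧸ LinearMap.range i))
        (LinearMap.range i).mkQ (Submodule.mkQ_surjective _))
      beta_reduce at h1
      rw [hzero Z hZ, h2, add_zero] at h1
      simp only [Finset.sum_apply, Pi.smul_apply, smul_eq_mul]
      exact sub_eq_zero.1 h1.symm
    simp only [hrow]
    exact Submodule.sum_mem _ fun j _ => Submodule.smul_mem _ _ (Submodule.subset_span ⟨j, rfl⟩)
  classical
  have hcard := linearIndependent_le_span_aux' _ hli _ hspan
  have h1 : Fintype.card (Set.range fun (j : Fin m) (c' : t) => G j (S c')) ≤ m := by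
    simpa using Fintype.card_range_le (fun (j : Fin m) (c' : t) => G j (S c'))
  have h2 : Fintype.card t = m + 1 := by
    rw [Set.encard_eq_coe_toFinset_card, Set.toFinset_card] at htm
    exact_mod_cast htm
  omega

end Counting

end WeakCotorsion

namespace WeakCotorsion

/-! ### Bongartz completion; `τ`-tilting modules are silting. -/

section Completion

variable {A : Type u} [Ring A]

attribute [local instance] scalarModule isScalarTower_scalarModule

/-- A `τ`-rigid module is a direct summand of a silting module. -/
theorem exists_isSilting_addClosure (k : Type v) [Field k] [Algebra k A] [Module.Finite k A]
    {T : FGModuleCat.{u} A} (hT : extPerp (Gen T) T) :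
    ∃ T' : FGModuleCat.{u} A, IsSilting T' ∧ addClosure T' T := by
  classical
  have : IsArtinianRing A := IsArtinianRing.of_finite k A
  obtain ⟨P⟩ := nonempty_minimalPresentation T
  have := P.cover₀.projective
  have := P.cover₁.projective
  have hπ := P.cover₀.surjective
  have hdT : HomSurjective P.d T := P.homSurjective hT
  have := finite_hom k P.P₁ A
  -- The `φ i` span `Hom(P₁, A)` over `k`. Pushing `r` copies of `d` out along their sum `l` gives
  -- `j : A → E` for which every composite `P₁ → A → E` extends along `d`.
  obtain ⟨r, φ, hφ⟩ := Module.Finite.exists_fin (R := k) (M := P.P₁ →ₗ[A] A)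
  let dr : (Fin r → P.P₁) →ₗ[A] (Fin r → P.P₀) := P.d.compLeft (Fin r)
  let πr : (Fin r → P.P₀) →ₗ[A] (Fin r → T) := P.π.compLeft (Fin r)
  let l : (Fin r → P.P₁) →ₗ[A] A := ∑ i, φ i ∘ₗ LinearMap.proj i
  have hl (i) : l ∘ₗ LinearMap.single A (fun _ => (P.P₁ : Type u)) i = φ i := by
    ext x
    simp only [l, LinearMap.comp_apply, LinearMap.sum_apply]
    rw [Finset.sum_eq_single i (fun b _ hb => by simp [Pi.single_eq_of_ne hb]) (by simp)]
    simp
  have hdr (i) : dr ∘ₗ LinearMap.single A (fun _ => (P.P₁ : Type u)) i =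
      LinearMap.single A (fun _ => (P.P₀ : Type u)) i ∘ₗ P.d := by
    ext x j
    by_cases hij : j = i
    · subst hij
      simp [dr]
    · simp [dr, Pi.single_eq_of_ne hij]
  have hdπr : Function.Exact dr πr := by
    intro x
    constructor
    · intro hx
      choose w hw using fun i => (P.exact (x i)).1 (congrFun hx i)
      exact ⟨w, funext hw⟩
    · rintro ⟨w, rfl⟩
      ext i
      exact P.exact.apply_apply_eq_zero (w i)
  have hπr : Function.Surjective πr := fun x => by
    choose w hw using fun i => hπ (x i)
    exact ⟨w, funext hw⟩
  obtain ⟨E, a, j, h1, h2, -, h4⟩ := exists_pushout (K := FGModuleCat.of A (Fin r → P.P₁))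
    (P := FGModuleCat.of A (Fin r → P.P₀)) (L := FGModuleCat.of A A) dr l
  have h1' (x) : a (dr x) = j (l x) := LinearMap.congr_fun h1 x
  obtain ⟨q, hqa, hqj⟩ := h4 (FGModuleCat.of A (Fin r → T)) πr 0 (by
    refine LinearMap.ext fun x => ?_
    simpa using hdπr.apply_apply_eq_zero x)
  have hqa' (x) : q (a x) = πr x := LinearMap.congr_fun hqa x
  have hqj' (x) : q (j x) = 0 := LinearMap.congr_fun hqj x
  let 𝒯 : ObjectProperty (FGModuleCat.{u} A) := fun X => HomSurjective P.d X
  have h𝒯 : IsTorsionClass 𝒯 := isTorsionClass_homSurjective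
  have hext : extPerp 𝒯 T := fun Y hY => HomSurjective.extOneVanishes P.exact hπ hY
  have hE : 𝒯 E := by
    let D : Submodule k (P.P₁ →ₗ[A] E) := LinearMap.range
      ({ toFun := fun g => g ∘ₗ P.d
         map_add' := fun _ _ => rfl
         map_smul' := fun _ _ => rfl } : (P.P₀ →ₗ[A] E) →ₗ[k] (P.P₁ →ₗ[A] E))
    let J : (P.P₁ →ₗ[A] A) →ₗ[k] (P.P₁ →ₗ[A] E) :=
      { toFun := fun h => j ∘ₗ h
        map_add' := fun _ _ => LinearMap.comp_add _ _ _
        map_smul' := fun c h => by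
          ext x
          exact (congrArg j (Algebra.smul_def c (h x))).trans (j.map_smul (algebraMap k A c) (h x)) }
    have hJ : ∀ γ, j ∘ₗ γ ∈ D := by
      have : (⊤ : Submodule k (P.P₁ →ₗ[A] A)) ≤ D.comap J := by
        rw [← hφ, Submodule.span_le]
        rintro _ ⟨i, rfl⟩
        refine ⟨a ∘ₗ LinearMap.single A (fun _ => (P.P₀ : Type u)) i, ?_⟩
        change (a ∘ₗ LinearMap.single A (fun _ => (P.P₀ : Type u)) i) ∘ₗ P.d = j ∘ₗ φ i
        rw [LinearMap.comp_assoc, ← hdr, ← LinearMap.comp_assoc, h1, LinearMap.comp_assoc, hl]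
      exact fun γ => this (Submodule.mem_top (x := γ))
    -- Since `T` is in `𝒯`, `πr ∘ α` extends along `d`. Lifting the extension to `γ'` leaves a
    -- remainder that factors through `dr`, and `a ∘ dr = j ∘ l` reduces it to `hJ`.
    have hA : ∀ α : P.P₁ →ₗ[A] (Fin r → P.P₀), a ∘ₗ α ∈ D := by
      intro α
      obtain ⟨γ, hγ⟩ := h𝒯.pi hdT r (πr ∘ₗ α)
      obtain ⟨γ', rfl⟩ := Module.projective_lifting_property πr γ hπr
      obtain ⟨δ, hδ⟩ := Module.projective_lifting_property dr.rangeRestrict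
        ((α - γ' ∘ₗ P.d).codRestrict (LinearMap.range dr) fun x => (hdπr _).1 (by
          have := LinearMap.congr_fun hγ x
          simp only [LinearMap.comp_apply] at this
          rw [LinearMap.sub_apply, map_sub, LinearMap.comp_apply, this, sub_self]))
        dr.surjective_rangeRestrict
      have hδ' : α = γ' ∘ₗ P.d + dr ∘ₗ δ := by
        refine LinearMap.ext fun x => ?_
        have : dr (δ x) = α x - γ' (P.d x) := congrArg Subtype.val (LinearMap.congr_fun hδ x)
        simp [this]
      rw [hδ', LinearMap.comp_add, ← LinearMap.comp_assoc, ← LinearMap.comp_assoc, h1]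
      exact D.add_mem ⟨a ∘ₗ γ', rfl⟩ (hJ (l ∘ₗ δ))
    intro h
    obtain ⟨c, rfl⟩ := Module.projective_lifting_property (a.coprod j) h fun e => by
      obtain ⟨x, y, rfl⟩ := h2 e
      exact ⟨(x, y), by simp⟩
    have hsplit : (a.coprod j) ∘ₗ c = a ∘ₗ (LinearMap.fst A (Fin r → P.P₀) A ∘ₗ c) +
        j ∘ₗ (LinearMap.snd A (Fin r → P.P₀) A ∘ₗ c) := by
      ext x
      simp
    have hmem : (a.coprod j) ∘ₗ c ∈ D := hsplit ▸ D.add_mem (hA _) (hJ _)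
    exact hmem
  have hs : IsApproxSequence 𝒯 (X := FGModuleCat.of A (Fin r → T)) j q := by
    refine ⟨fun e => ⟨fun he => ?_, ?_⟩, fun x => ?_, hE, extPerp_addClosure hext (addClosure_pi r),
      fun Z hZ h => ?_⟩
    · obtain ⟨x, y, rfl⟩ := h2 e
      rw [map_add, hqa', hqj', add_zero] at he
      obtain ⟨w, rfl⟩ := (hdπr x).1 he
      exact ⟨l w + y, by rw [map_add, h1']⟩
    · rintro ⟨y, rfl⟩
      exact hqj' y
    · obtain ⟨y, rfl⟩ := hπr x
      exact ⟨a y, hqa' y⟩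
    -- For `Z` in `𝒯` each `h ∘ φ i` extends along `d`; the extensions and `h` together define a map
    -- on the pushout, so `j` is an approximation.
    · choose t ht using fun i => hZ (h ∘ₗ φ i)
      obtain ⟨f, -, hf⟩ := h4 Z (∑ i, t i ∘ₗ LinearMap.proj i) h (by
        refine LinearMap.ext fun x => ?_
        have ht' (i) (x) : t i (P.d x) = h (φ i x) := LinearMap.congr_fun (ht i) x
        simp [dr, l, ht'])
      exact ⟨f, hf⟩
  have hadd := hs.addClosure_prod_eq h𝒯
  exact ⟨_, hs.isSilting h𝒯 hadd, hadd ▸ ⟨hext, hdT⟩⟩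

theorem IsSilting.of_addClosure_eq [IsNoetherianRing A] {T T' : FGModuleCat.{u} A}
    (hT : IsSilting T) (h : addClosure T' = addClosure T) : IsSilting T' := by
  obtain ⟨Y, X, g, p, -, -, hs⟩ := hT.exists_approxSequence
  exact hs.isSilting (isTorsionClass_gen hT.ext) (h.trans hT.addClosure_eq)

/-- `τ`-tilting modules are silting. -/
theorem IsTauTilting.isSilting {k : Type v} [Field k] [Algebra k A] [Module.Finite k A]
    {T : FGModuleCat.{u} A} (hT : IsTauTilting k T) : IsSilting T := by
  have : IsArtinianRing A := IsArtinianRing.of_finite k A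
  obtain ⟨T', hT', hTT'⟩ := exists_isSilting_addClosure k ((forall_hom_tau_eq_zero_iff k T).1 hT.1)
  have hle := numIndecomposableSummands_le_numSimples k hT'.ext
  obtain ⟨m, X, hX, hXi, hXT, -, hm⟩ := exists_indecomposable_representatives T
  obtain ⟨m', X', hX', hXi', hXT', hTX', hm'⟩ := exists_indecomposable_representatives T'
  rw [← hT.2, hm, hm', Nat.cast_le] at hle
  -- The summands of `T` inject into those of `T'`, of which there are no more, so both modules have
  -- the same indecomposable summands.
  choose σ hσ using fun i => hTX' (X i) (hX i) (hTT'.trans (hXT i))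
  have hσi : Function.Injective σ := fun i j hij =>
    hXi i j ⟨(hσ i).some ≪≫ₗ (hij ▸ (hσ j).some.symm)⟩
  have hσs : Function.Surjective σ := by
    have hcard : m = m' := le_antisymm (by simpa using Fintype.card_le_of_injective σ hσi) hle
    exact ((Fintype.bijective_iff_injective_and_card σ).2 ⟨hσi, by simpa using hcard⟩).2
  refine hT'.of_addClosure_eq (le_antisymm (addClosure_le hTT') (addClosure_le ?_))
  obtain ⟨ι, hι, Y, hY, ⟨e⟩⟩ := exists_indecomposable_decomposition T'
  refine addClosure_of_equiv_pi e fun i => ?_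
  obtain ⟨j, ⟨f⟩⟩ := hTX' (Y i) (hY i) (addClosure_apply_of_equiv_pi e i)
  obtain ⟨i', rfl⟩ := hσs j
  exact (hXT i').trans (addClosure_of_equiv ((hσ i').some ≪≫ₗ f.symm))

theorem IsSilting.isTauTilting (k : Type v) [Field k] [Algebra k A] [Module.Finite k A]
    {T : FGModuleCat.{u} A} (hT : IsSilting T)
    (h : ∀ S : FGModuleCat.{u} A, IsSimpleModule A S →
      ∃ (Z : FGModuleCat.{u} A) (i : S →ₗ[A] Z), Gen T Z ∧ Function.Injective i) :
    IsTauTilting k T :=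
  ⟨(forall_hom_tau_eq_zero_iff k T).2 hT.ext,
    le_antisymm (numIndecomposableSummands_le_numSimples k hT.ext) (hT.numSimples_le k h)⟩

end Completion

end WeakCotorsion

namespace WeakCotorsion

/-! ### Restriction along `A → A / I`. -/

section Restriction

variable {A : Type u} [Ring A] (I : Ideal A) [I.IsTwoSided]

/-- Restriction of an `A / I`-module to `A`. -/
def res (X : FGModuleCat.{u} (A ⧸ I)) : FGModuleCat.{u} A :=
  letI : Module A X := Module.compHom X (Ideal.Quotient.mk I)
  haveI : Module.Finite A X := by
    obtain ⟨s, hs⟩ := (Module.Finite.fg_top : (⊤ : Submodule (A ⧸ I) X).FG)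
    refine ⟨⟨s, eq_top_iff.2 fun x _ => ?_⟩⟩
    have hx : x ∈ Submodule.span (A ⧸ I) (s : Set X) := by
      rw [hs]
      trivial
    refine Submodule.span_induction (fun y hy => Submodule.subset_span hy) (Submodule.zero_mem _)
      (fun _ _ _ _ => Submodule.add_mem _) (fun a y _ hy => ?_) hx
    obtain ⟨b, rfl⟩ := Ideal.Quotient.mk_surjective a
    exact Submodule.smul_mem _ b hy
  FGModuleCat.of A X

variable {I}

/-- `A / I`-linear maps are `A`-linear. -/
def resMap {X Y : FGModuleCat.{u} (A ⧸ I)} (f : X →ₗ[A ⧸ I] Y) : res I X →ₗ[A] res I Y where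
  toFun := f
  map_add' := f.map_add
  map_smul' a x := f.map_smul (Ideal.Quotient.mk I a) x

/-- `A`-linear maps between `A / I`-modules are `A / I`-linear. -/
def unresMap {X Y : FGModuleCat.{u} (A ⧸ I)} (f : res I X →ₗ[A] res I Y) : X →ₗ[A ⧸ I] Y where
  toFun := f
  map_add' := f.map_add
  map_smul' b x := by
    obtain ⟨a, rfl⟩ := Ideal.Quotient.mk_surjective b
    exact f.map_smul a x

theorem exists_equiv_res {M : FGModuleCat.{u} A} (hM : ∀ a ∈ I, ∀ m : M, a • m = 0) :
    ∃ X : FGModuleCat.{u} (A ⧸ I), Nonempty (M ≃ₗ[A] res I X) := by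
  have hM' : Module.IsTorsionBySet A M I := fun m a => hM a a.2 m
  let _ : Module (A ⧸ I) M := hM'.module
  have hmk (a : A) (m : M) : Ideal.Quotient.mk I a • m = a • m := rfl
  have : Module.Finite (A ⧸ I) M := by
    obtain ⟨s, hs⟩ := (Module.Finite.fg_top : (⊤ : Submodule A M).FG)
    refine ⟨⟨s, eq_top_iff.2 fun x _ => ?_⟩⟩
    have hx : x ∈ Submodule.span A (s : Set M) := by
      rw [hs]
      trivial
    refine Submodule.span_induction (fun y hy => Submodule.subset_span hy) (Submodule.zero_mem _)
      (fun _ _ _ _ => Submodule.add_mem _) (fun a y _ hy => ?_) hx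
    rw [← hmk]
    exact Submodule.smul_mem _ _ hy
  let f : M →ₗ[A] res I (FGModuleCat.of (A ⧸ I) M) :=
    { toFun := id
      map_add' := fun _ _ => rfl
      map_smul' := fun _ _ => rfl }
  exact ⟨FGModuleCat.of (A ⧸ I) M, ⟨LinearEquiv.ofBijective f Function.bijective_id⟩⟩

theorem smul_res_eq_zero (X : FGModuleCat.{u} (A ⧸ I)) {a : A} (ha : a ∈ I) (x : res I X) :
    a • x = 0 := by
  have : Ideal.Quotient.mk I a = 0 := Ideal.Quotient.eq_zero_iff_mem.2 ha
  change (Ideal.Quotient.mk I a • (show X from x) : X) = 0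
  rw [this, zero_smul]

theorem addClosure_res_iff {N X : FGModuleCat.{u} (A ⧸ I)} :
    addClosure (res I N) (res I X) ↔ addClosure N X := by
  constructor
  · rintro ⟨n, i, r, h⟩
    refine ⟨n, { toFun := i, map_add' := i.map_add, map_smul' := fun b x => ?_ },
      { toFun := r, map_add' := r.map_add, map_smul' := fun b x => ?_ },
      LinearMap.ext fun x => LinearMap.congr_fun h x⟩
    · obtain ⟨a, rfl⟩ := Ideal.Quotient.mk_surjective b
      exact i.map_smul a x
    · obtain ⟨a, rfl⟩ := Ideal.Quotient.mk_surjective b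
      exact r.map_smul a x
  · rintro ⟨n, i, r, h⟩
    exact ⟨n, { toFun := i, map_add' := i.map_add,
                map_smul' := fun a x => i.map_smul (Ideal.Quotient.mk I a) x },
      { toFun := r, map_add' := r.map_add,
        map_smul' := fun a x => r.map_smul (Ideal.Quotient.mk I a) x },
      LinearMap.ext fun x => LinearMap.congr_fun h x⟩

theorem gen_res_iff {N X : FGModuleCat.{u} (A ⧸ I)} : Gen (res I N) (res I X) ↔ Gen N X := by
  constructor
  · rintro ⟨n, f, hf⟩
    refine ⟨n, { toFun := f, map_add' := f.map_add, map_smul' := fun b x => ?_ }, hf⟩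
    obtain ⟨a, rfl⟩ := Ideal.Quotient.mk_surjective b
    exact f.map_smul a x
  · rintro ⟨n, f, hf⟩
    exact ⟨n, { toFun := f, map_add' := f.map_add,
                map_smul' := fun a x => f.map_smul (Ideal.Quotient.mk I a) x }, hf⟩

theorem Gen.exists_equiv_res {N : FGModuleCat.{u} (A ⧸ I)} {Z : FGModuleCat.{u} A}
    (hZ : Gen (res I N) Z) :
    ∃ Z' : FGModuleCat.{u} (A ⧸ I), Gen N Z' ∧ Nonempty (Z ≃ₗ[A] res I Z') := by
  have hkill : ∀ a ∈ I, ∀ z : Z, a • z = 0 := by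
    intro a ha z
    obtain ⟨n, f, hf⟩ := hZ
    obtain ⟨x, rfl⟩ := hf z
    rw [← map_smul]
    have : a • x = 0 := by
      ext i
      exact smul_res_eq_zero N ha (x i)
    rw [this, map_zero]
  obtain ⟨Z', ⟨e⟩⟩ := WeakCotorsion.exists_equiv_res hkill
  exact ⟨Z', gen_res_iff.1 (hZ.of_surjective e.toLinearMap e.surjective), ⟨e⟩⟩

theorem isSimpleModule_res {S : FGModuleCat.{u} (A ⧸ I)} (hS : IsSimpleModule (A ⧸ I) S) :
    IsSimpleModule A (res I S) := by
  rw [isSimpleModule_iff_toSpanSingleton_surjective] at *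
  refine ⟨hS.1, fun x hx y => ?_⟩
  obtain ⟨b, hb⟩ := hS.2 x hx y
  obtain ⟨a, rfl⟩ := Ideal.Quotient.mk_surjective b
  exact ⟨a, hb⟩

variable [IsNoetherianRing A]

theorem ExtOneVanishes.congr_right {X Y Y' : FGModuleCat.{u} A} (h : ExtOneVanishes X Y)
    (e : Y ≃ₗ[A] Y') : ExtOneVanishes X Y' := by
  refine extOneVanishes_of_split fun E i p hi hip hp => ?_
  refine h.exists_lift (i ∘ₗ e.toLinearMap) p (hi.comp e.injective) (fun y => ?_) hp LinearMap.id
  rw [hip y]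
  constructor
  · rintro ⟨x, rfl⟩
    exact ⟨e.symm x, by simp⟩
  · rintro ⟨x, rfl⟩
    exact ⟨e x, rfl⟩

theorem extOneVanishes_of_res {X Y : FGModuleCat.{u} (A ⧸ I)}
    (h : ExtOneVanishes (res I X) (res I Y)) : ExtOneVanishes X Y := by
  have : IsNoetherianRing (A ⧸ I) :=
    isNoetherianRing_of_surjective A (A ⧸ I) (Ideal.Quotient.mk I) Ideal.Quotient.mk_surjective
  refine extOneVanishes_of_split fun E i p hi hip hp => ?_
  obtain ⟨s, hs⟩ := h.exists_lift (resMap i) (resMap p) hi hip hp LinearMap.id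
  refine ⟨unresMap s, ?_⟩
  ext x
  exact LinearMap.congr_fun hs x

/-- Holds for every two-sided ideal: `A / I`-extensions are `A`-extensions, and a map from `A` to a
module killed by `I` factors through `A / I`. -/
theorem isSilting_of_res {N : FGModuleCat.{u} (A ⧸ I)} (hN : IsSilting (res I N)) :
    IsSilting N where
  ext X hX := extOneVanishes_of_res (hN.ext _ (gen_res_iff.2 hX))
  sequence := by
    obtain ⟨Y, X, g, p, hY, hX, hgp, hp, hg⟩ := hN.sequence
    obtain ⟨Y', -, ⟨eY⟩⟩ := (gen_of_addClosure hY).exists_equiv_res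
    obtain ⟨X', -, ⟨eX⟩⟩ := (gen_of_addClosure hX).exists_equiv_res
    let p' : Y' →ₗ[A ⧸ I] X' := unresMap (eX.toLinearMap ∘ₗ p ∘ₗ eY.symm.toLinearMap)
    let g' : (A ⧸ I) →ₗ[A ⧸ I] Y' := LinearMap.toSpanSingleton (A ⧸ I) Y' (eY (g 1))
    have hp' (y) : p' y = eX (p (eY.symm y)) := rfl
    have hg' (a : A) : g' (Ideal.Quotient.mk I a) = eY (g a) := by
      have : g a = a • g 1 := by rw [← map_smul, smul_eq_mul, mul_one]
      rw [this, map_smul]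
      rfl
    refine ⟨Y', X', g', p', addClosure_res_iff.1 (hY.trans (addClosure_of_equiv eY)),
      addClosure_res_iff.1 (hX.trans (addClosure_of_equiv eX)), ?_, ?_, ?_⟩
    · intro y
      refine (eX.map_eq_zero_iff (x := p (eY.symm y))).trans ((hgp _).trans ?_)
      constructor
      · rintro ⟨a, ha⟩
        exact ⟨Ideal.Quotient.mk I a,
          (hg' a).trans ((congrArg eY ha).trans (eY.apply_symm_apply y))⟩
      · rintro ⟨b, hb⟩
        obtain ⟨a, rfl⟩ := Ideal.Quotient.mk_surjective b
        exact ⟨a, (eY.eq_symm_apply).2 ((hg' a).symm.trans hb)⟩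
    · intro x
      obtain ⟨y, hy⟩ := hp (eX.symm x)
      exact ⟨eY y, (congrArg (fun z => eX (p z)) (eY.symm_apply_apply y)).trans
        ((congrArg eX hy).trans (eX.apply_symm_apply x))⟩
    · intro Z hZ h
      obtain ⟨c, hc⟩ := hg (res I Z) (gen_res_iff.2 hZ)
        (LinearMap.toSpanSingleton A (res I Z) (h 1))
      refine ⟨unresMap (c ∘ₗ eY.symm.toLinearMap), LinearMap.ext_ring ?_⟩
      have h1 : c (g 1) = h 1 := (LinearMap.congr_fun hc 1).trans (one_smul A _)
      have h2 : g' 1 = eY (g 1) := one_smul (A ⧸ I) _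
      exact (congrArg (fun z => c (eY.symm z)) h2).trans
        ((congrArg c (eY.symm_apply_apply _)).trans h1)

end Restriction

/-! ### The support idempotent and passage to `A / AeA`. -/

section SupportIdempotent

variable {A : Type u} [Ring A]

theorem smul_eq_zero_of_mem_idealGen {e : A} {M : Type*} [AddCommGroup M] [Module A M]
    (h : ∀ m : M, e • m = 0) {a : A} (ha : a ∈ idealGen e) (m : M) : a • m = 0 := by
  have hle : TwoSidedIdeal.span {e} ≤ TwoSidedIdeal.ker (Module.toAddMonoidEnd A M) := by
    rw [TwoSidedIdeal.span_le]
    rintro _ rfl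
    refine (TwoSidedIdeal.mem_ker _).2 ?_
    ext m
    exact h m
  have h1 := (TwoSidedIdeal.mem_ker _).1 (hle (TwoSidedIdeal.mem_asIdeal.1 ha))
  exact DFunLike.congr_fun h1 m

theorem mem_idealGen_self (e : A) : e ∈ idealGen e :=
  TwoSidedIdeal.mem_asIdeal.2 (TwoSidedIdeal.subset_span rfl)

/-- Here the idempotent matters: if `e` kills both ends of an extension, then `e` maps the middle
term into the submodule and `e * e` kills it; as `e * e = e`, the extension is one of `A /
AeA`-modules. -/
theorem extOneVanishes_res [IsNoetherianRing A] {e : A} (he : IsIdempotentElem e)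
    {X Y : FGModuleCat.{u} (A ⧸ idealGen e)} (h : ExtOneVanishes X Y) :
    ExtOneVanishes (res (idealGen e) X) (res (idealGen e) Y) := by
  refine extOneVanishes_of_split fun E i p hi hip hp => ?_
  have hE : ∀ m : E, e • m = 0 := by
    intro m
    obtain ⟨y, hy⟩ := (hip (e • m)).1 (by
      rw [map_smul]
      exact smul_res_eq_zero X (mem_idealGen_self e) _)
    rw [← he.eq, mul_smul, ← hy, ← map_smul, smul_res_eq_zero Y (mem_idealGen_self e), map_zero]
  obtain ⟨E', ⟨f⟩⟩ := exists_equiv_res (I := idealGen e) (M := E)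
    fun a ha m => smul_eq_zero_of_mem_idealGen hE ha m
  obtain ⟨s, hs⟩ := h.exists_lift (unresMap (f.toLinearMap ∘ₗ i))
    (unresMap (p ∘ₗ f.symm.toLinearMap)) (f.injective.comp hi) (by
      intro z
      change p (f.symm z) = 0 ↔ _
      rw [hip]
      constructor
      · rintro ⟨y, hy⟩
        exact ⟨y, (congrArg f hy).trans (f.apply_symm_apply z)⟩
      · rintro ⟨y, rfl⟩
        exact ⟨y, (f.symm_apply_apply (i y)).symm⟩)
    (hp.comp f.symm.surjective) LinearMap.id
  refine ⟨f.symm.toLinearMap ∘ₗ resMap s, ?_⟩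
  ext x
  exact LinearMap.congr_fun hs x

theorem isSilting_res [IsNoetherianRing A] {e : A} (he : IsIdempotentElem e)
    {N : FGModuleCat.{u} (A ⧸ idealGen e)} (hN : IsSilting N) :
    IsSilting (res (idealGen e) N) where
  ext X hX := by
    obtain ⟨X', hX', ⟨f⟩⟩ := hX.exists_equiv_res
    exact (extOneVanishes_res he (hN.ext X' hX')).congr_right f.symm
  sequence := by
    obtain ⟨Y, X, g, p, hY, hX, hgp, hp, hg⟩ := hN.sequence
    let g' : A →ₗ[A] res (idealGen e) Y :=
      LinearMap.toSpanSingleton A (res (idealGen e) Y) (g 1)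
    have hg' (a : A) : g' a = g (Ideal.Quotient.mk _ a) := by
      have : g (Ideal.Quotient.mk (idealGen e) a) = Ideal.Quotient.mk (idealGen e) a • g 1 := by
        rw [← map_smul, smul_eq_mul, mul_one]
      rw [this]
      rfl
    refine ⟨res _ Y, res _ X, g', resMap p, addClosure_res_iff.2 hY, addClosure_res_iff.2 hX,
      ?_, hp, ?_⟩
    · intro y
      refine (hgp y).trans ?_
      constructor
      · rintro ⟨b, hb⟩
        obtain ⟨a, rfl⟩ := Ideal.Quotient.mk_surjective b
        exact ⟨a, (hg' a).trans hb⟩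
      · rintro ⟨a, ha⟩
        exact ⟨_, (hg' a).symm.trans ha⟩
    · intro Z hZ h
      obtain ⟨Z', hZ', ⟨f⟩⟩ := hZ.exists_equiv_res
      obtain ⟨c, hc⟩ := hg Z' hZ' (LinearMap.toSpanSingleton (A ⧸ idealGen e) Z' (f (h 1)))
      refine ⟨f.symm.toLinearMap ∘ₗ resMap c, LinearMap.ext_ring ?_⟩
      have h1 : c (g 1) = f (h 1) :=
        (LinearMap.congr_fun hc 1).trans (one_smul (A ⧸ idealGen e) _)
      have h2 : g' 1 = g 1 := one_smul A _
      exact (congrArg (fun z => f.symm (resMap c z)) h2).trans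
        ((congrArg f.symm h1).trans (f.symm_apply_apply _))

/-- The simple modules annihilated by a suitable idempotent that annihilates `M` embed into factor
modules of `M`. -/
theorem exists_support_idempotent [IsArtinianRing A] (M : FGModuleCat.{u} A) :
    ∃ e : A, IsIdempotentElem e ∧ (∀ m : M, e • m = 0) ∧
      ∀ S : FGModuleCat.{u} A, IsSimpleModule A S → (∀ s : S, e • s = 0) →
        ∃ (Z : FGModuleCat.{u} A) (i : S →ₗ[A] Z), Gen M Z ∧ Function.Injective i := by
  let idems : Set (Submodule A A) :=
    {J | ∃ e : A, IsIdempotentElem e ∧ (∀ m : M, e • m = 0) ∧ J = Submodule.span A {e}}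
  obtain ⟨J, ⟨e, he, heM, rfl⟩, hmax⟩ := WellFounded.has_min
    (wellFounded_gt (α := Submodule A A)) idems ⟨_, 0, IsIdempotentElem.zero, by simp, rfl⟩
  refine ⟨e, he, heM, fun S hS heS => ?_⟩
  obtain ⟨P, π, hπ⟩ := exists_projectiveCover S
  have hPp := hπ.projective
  by_contra hno
  -- A nonzero `w` would induce a nonzero map from `S` to `M / w (ker π)`, since `ker π` is
  -- superfluous; this is an embedding of the excluded kind.
  have hPM : ∀ w : P →ₗ[A] M, w = 0 := by
    intro w
    by_contra hw
    let U := (LinearMap.ker π).map w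
    obtain ⟨i, hi⟩ := exists_factor_of_exact (LinearMap.ker π).subtype π
      (LinearMap.exact_subtype_ker_map π) hπ.surjective (U.mkQ ∘ₗ w) (by
        ext x
        exact (Submodule.Quotient.mk_eq_zero _).2 ⟨x, x.2, rfl⟩)
    refine hno ⟨FGModuleCat.of A (M ⧸ U), i, gen_self.of_surjective
      (Y := FGModuleCat.of A (M ⧸ U)) U.mkQ U.mkQ_surjective,
      LinearMap.injective_of_ne_zero ?_⟩
    rintro rfl
    refine hw (LinearMap.ker_eq_top.1 (hπ.superfluous _ (eq_top_iff.2 fun x _ => ?_)))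
    have hx : U.mkQ (w x) = 0 := by
      have := LinearMap.congr_fun hi x
      exact this.symm
    obtain ⟨y, hy, hyx⟩ := (Submodule.Quotient.mk_eq_zero U).1 hx
    rw [← sub_add_cancel x y]
    refine Submodule.add_mem_sup ?_ hy
    rw [LinearMap.mem_ker, map_sub, hyx, sub_self]
  have := hS.nontrivial
  obtain ⟨s, hs⟩ := exists_ne (0 : S)
  obtain ⟨y, rfl⟩ := hπ.surjective s
  let α : A →ₗ[A] P := LinearMap.toSpanSingleton A P ((1 - e) • y)
  have hα1 : α 1 = (1 - e) • y := by simp [α]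
  have hαs (a : A) : α a = a • α 1 := by rw [← map_smul, smul_eq_mul, mul_one]
  have hπα : π (α 1) = π y := by
    rw [hα1, map_smul, sub_smul, one_smul, heS, sub_zero]
  have hαsurj : Function.Surjective α := by
    rw [← LinearMap.range_eq_top]
    refine hπ.superfluous _ (eq_top_iff.2 fun x _ => ?_)
    have hne : π ∘ₗ α ≠ 0 := fun h0 => hs (by
      rw [← hπα]
      exact LinearMap.congr_fun h0 1)
    obtain ⟨a, ha⟩ := LinearMap.surjective_of_ne_zero hne (π x)
    rw [← add_sub_cancel (α a) x]
    refine Submodule.add_mem_sup ⟨a, rfl⟩ ?_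
    rw [LinearMap.mem_ker, map_sub, sub_eq_zero]
    exact ha.symm
  obtain ⟨β, hβ⟩ := Module.projective_lifting_property α LinearMap.id hαsurj
  have hβ' (x) : α (β x) = x := LinearMap.congr_fun hβ x
  -- Splitting the surjection `A → P` yields an idempotent with `e * f₀ = 0` that kills `M` because
  -- `Hom(P, M) = 0`.
  let f₀ := β (α 1)
  have hf₀ : f₀ * f₀ = f₀ := by
    change f₀ • β (α 1) = f₀
    rw [← map_smul, ← hαs, hβ']
  have hef₀ : e * f₀ = 0 := by
    change e • β (α 1) = 0
    rw [← map_smul, hα1, ← mul_smul, mul_sub, mul_one, he.eq, sub_self, zero_smul, map_zero]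
  have hf₀M (m : M) : f₀ • m = 0 :=
    LinearMap.congr_fun (hPM (LinearMap.toSpanSingleton A M m ∘ₗ β)) (α 1)
  -- The extra factor makes `f` orthogonal to `e` on both sides, so `e + f` is an idempotent killing
  -- `M`; maximality of `Ae` then forces `f = 0`, contradicting that the generator `α 1 = f • y` of
  -- `P` is nonzero.
  let f := f₀ * (1 - e)
  have hfe : f * e = 0 := by rw [mul_assoc, sub_mul, one_mul, he.eq, sub_self, mul_zero]
  have hef : e * f = 0 := by rw [← mul_assoc, hef₀, zero_mul]
  have hff : f * f = f := by
    calc f * f = f₀ * (f₀ - e * f₀) * (1 - e) := by simp only [f]; noncomm_ring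
      _ = f := by rw [hef₀, sub_zero, hf₀]
  have hidem : IsIdempotentElem (e + f) := by
    change (e + f) * (e + f) = e + f
    rw [mul_add, add_mul, add_mul, he.eq, hfe, hef, hff, add_zero, zero_add]
  have hle : Submodule.span A {e} ≤ Submodule.span A {e + f} := by
    rw [Submodule.span_singleton_le_iff_mem, Submodule.mem_span_singleton]
    exact ⟨e, by rw [smul_eq_mul, mul_add, he.eq, hef, add_zero]⟩
  have heq : Submodule.span A {e + f} ≤ Submodule.span A {e} := by
    by_contra hne
    refine hmax _ ⟨e + f, hidem, fun m => ?_, rfl⟩ (lt_of_le_of_ne hle fun h => hne h.ge)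
    rw [add_smul, heM, zero_add]
    change (f₀ * (1 - e)) • m = 0
    rw [mul_smul, hf₀M]
  rw [Submodule.span_singleton_le_iff_mem, Submodule.mem_span_singleton] at heq
  obtain ⟨a, ha⟩ := heq
  have hf0 : f = 0 := by
    have h1 : (e + f) * e = e + f := by rw [← ha, smul_eq_mul, mul_assoc, he.eq]
    rw [add_mul, he.eq, hfe, add_zero] at h1
    exact left_eq_add.1 h1
  apply hs
  rw [← hπα]
  have h1 : α 1 = f • y := by
    have h2 := hβ' (α 1)
    rw [hαs] at h2
    calc α 1 = f₀ • α 1 := h2.symm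
      _ = f • y := by rw [hα1, ← mul_smul]
  rw [h1, hf0, zero_smul, map_zero]

/-- Support `τ`-tilting modules are the silting modules. -/
theorem isSupportTauTilting_iff_isSilting (k : Type v) [Field k] [Algebra k A] [Module.Finite k A]
    (M : FGModuleCat.{u} A) : IsSupportTauTilting k M ↔ IsSilting M := by
  have : IsArtinianRing A := IsArtinianRing.of_finite k A
  constructor
  · rintro ⟨e, he, N, hN, φ, hφ⟩
    let φ' : M →ₗ[A] res (idealGen e) N :=
      { toFun := φ, map_add' := φ.map_add, map_smul' := φ.map_smulₛₗ }
    let f : M ≃ₗ[A] res (idealGen e) N := LinearEquiv.ofBijective φ' hφ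
    exact (isSilting_res he hN.isSilting).of_addClosure_eq (le_antisymm
      (addClosure_le (addClosure_of_equiv f.symm)) (addClosure_le (addClosure_of_equiv f)))
  · intro hM
    -- With this `e`, every simple `A / AeA`-module embeds into a module generated by `M`, as the
    -- count of summands requires.
    obtain ⟨e, he, heM, hsimple⟩ := exists_support_idempotent M
    obtain ⟨N, ⟨f⟩⟩ := exists_equiv_res (I := idealGen e) (M := M)
      fun a ha m => smul_eq_zero_of_mem_idealGen heM ha m
    have hN : IsSilting (res (idealGen e) N) := hM.of_addClosure_eq (le_antisymm
      (addClosure_le (addClosure_of_equiv f)) (addClosure_le (addClosure_of_equiv f.symm)))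
    refine ⟨e, he, N, (isSilting_of_res hN).isTauTilting k fun S hS => ?_,
      { toFun := f, map_add' := f.map_add, map_smul' := f.map_smul }, f.bijective⟩
    obtain ⟨Z, i, hZ, hi⟩ := hsimple (res (idealGen e) S) (isSimpleModule_res hS)
      fun s => smul_res_eq_zero S (mem_idealGen_self e) s
    obtain ⟨Z', hZ', ⟨g⟩⟩ :=
      ((gen_of_addClosure (addClosure_of_equiv f.symm)).trans hZ).exists_equiv_res
    exact ⟨Z', unresMap (g.toLinearMap ∘ₗ i), hZ', g.injective.comp hi⟩

end SupportIdempotent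

end WeakCotorsion

/-! ### The bijections. -/

theorem theorem4 (k : Type v) [Field k] (A : Type u) [Ring A] [Algebra k A]
    [Module.Finite k A] :
    Set.BijOn WeakCotorsion.tripleMap (WeakCotorsion.basicSupportTauTilting k A)
        {t | WeakCotorsion.IsLwCotorsionTorsion t} ∧
      (∀ (t : WeakCotorsion.SubcatTriple A), WeakCotorsion.IsLwCotorsionTorsion t →
        ∀ T : FGModuleCat.{u} A, WeakCotorsion.IsBasic T →
          (WeakCotorsion.addClosure T = t.C ⊓ t.T ↔
            WeakCotorsion.IsSupportTauTilting k T ∧ WeakCotorsion.tripleOf T = t)) ∧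
      WeakCotorsion.basicTilting A ⊆ WeakCotorsion.basicSupportTauTilting k A ∧
      Set.BijOn WeakCotorsion.tripleMap (WeakCotorsion.basicTilting A)
        {t | WeakCotorsion.IsCotorsionTorsion t} := by

  have : IsArtinianRing A := IsArtinianRing.of_finite k A
  have hsub : WeakCotorsion.basicTilting A ⊆ WeakCotorsion.basicSupportTauTilting k A := by
    rintro _ ⟨T, ⟨hb, hT⟩, rfl⟩
    exact ⟨T, ⟨hb, (WeakCotorsion.isSupportTauTilting_iff_isSilting k T).2 hT.isSilting⟩, rfl⟩
  have hinj : Set.InjOn WeakCotorsion.tripleMap (WeakCotorsion.basicSupportTauTilting k A) := by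
    rintro _ ⟨T, ⟨hb, hT⟩, rfl⟩ _ ⟨T', ⟨hb', hT'⟩, rfl⟩ h
    rw [WeakCotorsion.isSupportTauTilting_iff_isSilting] at hT hT'
    have h' : WeakCotorsion.tripleOf T = WeakCotorsion.tripleOf T' := h
    refine WeakCotorsion.isoClass_eq_iff.2 (hb.nonempty_equiv hb' ?_)
    rw [hT.addClosure_eq, hT'.addClosure_eq]
    exact congrArg (fun t => t.C ⊓ t.T) h'
  refine ⟨⟨?_, hinj, ?_⟩, fun t ht T _ => ⟨fun hT => ?_, ?_⟩, hsub, ?_, hinj.mono hsub, ?_⟩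
  · rintro _ ⟨T, ⟨-, hT⟩, rfl⟩
    exact ((WeakCotorsion.isSupportTauTilting_iff_isSilting k T).1 hT).isLwCotorsionTorsion
  · intro t ht
    obtain ⟨M, hM⟩ := ht.exists_addClosure_eq
    obtain ⟨T, hb, hT⟩ := WeakCotorsion.exists_isBasic_addClosure_eq M
    exact ⟨_, ⟨T, ⟨hb, (WeakCotorsion.isSupportTauTilting_iff_isSilting k T).2
      (ht.isSilting (hT.trans hM))⟩, rfl⟩, ht.tripleOf_eq (hT.trans hM)⟩
  · exact ⟨(WeakCotorsion.isSupportTauTilting_iff_isSilting k T).2 (ht.isSilting hT),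
      ht.tripleOf_eq hT⟩
  · rintro ⟨hT, rfl⟩
    exact ((WeakCotorsion.isSupportTauTilting_iff_isSilting k T).1 hT).addClosure_eq
  · rintro _ ⟨T, ⟨-, hT⟩, rfl⟩
    exact hT.isCotorsionTorsion
  · intro t ht
    have ht' : WeakCotorsion.IsLwCotorsionTorsion t := ⟨ht.1.toIsLeftWeakCotorsionPair, ht.2⟩
    obtain ⟨M, hM⟩ := ht'.exists_addClosure_eq
    obtain ⟨T, hb, hT⟩ := WeakCotorsion.exists_isBasic_addClosure_eq M
    exact ⟨_, ⟨T, ⟨hb, ht.isTilting (hT.trans hM)⟩, rfl⟩, ht'.tripleOf_eq (hT.trans hM)⟩
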